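/- Theorem. For integers $\alpha,\beta$ let $$H_{\alpha,\beta}(q)=q^{-(\alpha+2\beta)/24}\,\eta(\tau)^{\alpha}\,\eta(2\tau)^{\beta}=\sum_{n\ge 0}a(\alpha,\beta;n)\,q^n,\qquad q=e^{2\pi i\tau},\ \operatorname{Im}\tau>0,$$ where $\eta(\tau)=q^{1/24}\prod_{m\ge1}(1-q^m)$. For $k\ge1$ let $s(h,k)=\sum_{r=1}^{k-1}((r/k))((hr/k))$, where $((x))=0$ for $x\in\mathbb Z$ and $((x))=x-\lfloor x\rfloor-\tfrac12$ otherwise, and put $$\omega_{\alpha,\beta}(h,k)=\exp\bigl(-\pi i(\alpha\, s(h,k)+\beta\, s(2h,k))\bigr).$$ For $\gcd(h,k)=1$ let $h'$ be an integer with $hh'\equiv-1\pmod k$, chosen even if $k$ is odd. Define the Kloosterman sums $$A_k(\alpha,\beta,j;n)=\sum_{\substack{0\le h<k\\(h,k)=1}}\omega_{\alpha,\beta}(h,k)\exp\Bigl(-\frac{2\pi i nh}{k}+\frac{2\pi i h'j}{k}\Bigr),$$ $$B_k(\alpha,\beta,j;n)=\sum_{\substack{0\le h<k\\(h,k)=1}}\omega_{\alpha,\beta}(h,k)\exp\Bigl(-\frac{2\pi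 i nh}{k}+\frac{\pi i h'j}{k}\Bigr).$$ Let $I_v(z)=(z/2)^v\sum_{m\ge0}\frac{(z^2/4)^m}{m!\,\Gamma(v+m+1)}$ and $v=1-\frac{\alpha+\beta}2$. Put $$c=(\alpha+2\beta)\frac{\pi}{12}+2\pi n,\quad d_0(j,k)=-(\alpha+2\beta)\frac{\pi}{12k^2}-\frac{2\pi j}{k^2},\quad d_1(j,k)=-(2\alpha+\beta)\frac{\pi}{24k^2}-\frac{\pi j}{k^2},$$ and, for $r\in\{0,1\}$, $$L^*(r,j,k;n)=d_r(j,k)^{\frac12-\frac{\alpha+\beta}4}\;c^{-\frac12+\frac{\alpha+\beta}4}\;I_v\bigl(2\sqrt{d_r(j,k)\,c}\bigr).$$ Suppose $\alpha+\beta\le0$ and let $n\ge0$ be an integer with $n>-(\alpha+2\beta)/24$. Then $$\begin{aligned}a(\alpha,\beta;n)={}&2\pi\sum_{0\le j<-\frac{\alpha+2\beta}{24}}\ \sum_{\substack{k\ge2\\k\text{ even}}}\frac{A_k(\alpha,\beta,j;n)\,a(\alpha,\beta;j)}{k^{(\alpha+\beta)/2}}\,L^*(0,j,k;n)\\&+2\pi\sum_{0\le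 j<-\frac{2\alpha+\beta}{24}}\ \sum_{\substack{k\ge1\\k\text{ odd}}}\frac{B_k(\alpha,\beta,j;n)\,a(\beta,\alpha;j)}{2^{\beta/2}\,k^{(\alpha+\beta)/2}}\,L^*(1,j,k;n),\end{aligned}$$ where $j$ runs over integers and each of the series over $k$ converges absolutely. -/

import Mathlib

open scoped Real

namespace EtaQuotient

noncomputable section

/-- The eta quotient `H_{α,β}(q) = q^{-(α+2β)/24} η(τ)^α η(2τ)^β`, with `q = exp(2πiτ)`,
as a function of `τ` in the upper half-plane; the fractional power of `q` is
`exp(-2πiτ(α+2β)/24)`. -/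
def H (α β : ℤ) (τ : UpperHalfPlane) : ℂ :=
  Complex.exp (-(2 * π * Complex.I * (τ : ℂ) * (((α + 2 * β : ℤ) : ℂ) / 24))) *
    ModularForm.eta (τ : ℂ) ^ α * ModularForm.eta (2 * (τ : ℂ)) ^ β

/-- `a(α,β;n)`: the coefficient of `q^n` in the expansion of `H_{α,β}` in powers of
`q = exp(2πiτ)`. -/
def a (α β : ℤ) (n : ℕ) : ℂ :=
  (UpperHalfPlane.qExpansion 1 (H α β)).coeff n

/-- The sawtooth function `((x))`: zero at integers, `x - ⌊x⌋ - 1/2` elsewhere. -/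
def sawtooth (x : ℝ) : ℝ :=
  if Int.fract x = 0 then 0 else x - ⌊x⌋ - 1 / 2

/-- The Dedekind sum `s(h,k)`; coprimality of `h` and `k` is not assumed. -/
def dedekindSum (h k : ℕ) : ℝ :=
  ∑ r ∈ Finset.Ico 1 k, sawtooth ((r : ℝ) / k) * sawtooth ((h : ℝ) * r / k)

/-- The root of unity `ω_{α,β}(h,k) = exp(-πi(α s(h,k) + β s(2h,k)))`. -/
def omega (α β : ℤ) (h k : ℕ) : ℂ :=
  Complex.exp (-(π * Complex.I *
    ((α * dedekindSum h k + β * dedekindSum (2 * h) k : ℝ) : ℂ)))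

/-- An integer `h'` with `h h' ≡ -1 (mod k)`, chosen to be even when `k` is odd. Modulo `k`
(for even `k`), respectively modulo `2k` (for odd `k`), these conditions determine `h'`. -/
def hPrime (h k : ℕ) : ℕ :=
  if Odd k ∧ Odd (-(h : ZMod k)⁻¹).val then (-(h : ZMod k)⁻¹).val + k
  else (-(h : ZMod k)⁻¹).val

theorem hPrime_cast (h k : ℕ) [NeZero k] : (hPrime h k : ZMod k) = -(h : ZMod k)⁻¹ := by
  unfold hPrime
  split_ifs <;> simp

theorem hPrime_modEq (h k : ℕ) [NeZero k] (hk : h.Coprime k) :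
    (h : ℤ) * hPrime h k ≡ -1 [ZMOD k] := by
  rw [← ZMod.intCast_eq_intCast_iff]
  push_cast
  rw [hPrime_cast, mul_neg, ZMod.coe_mul_inv_eq_one h hk]

theorem hPrime_even (h k : ℕ) (hk : Odd k) : Even (hPrime h k) := by
  unfold hPrime
  split_ifs with hc
  · exact hc.2.add_odd hk
  · exact Nat.not_odd_iff_even.1 fun ho => hc ⟨hk, ho⟩

/-- The Kloosterman sum `A_k(α,β,j;n)`. -/
def A (k : ℕ) (α β : ℤ) (j n : ℕ) : ℂ :=
  ∑ h ∈ (Finset.range k).filter (fun h => h.Coprime k),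
    omega α β h k * Complex.exp (-(2 * π * Complex.I * n * h / k) +
      2 * π * Complex.I * hPrime h k * j / k)

/-- The Kloosterman sum `B_k(α,β,j;n)`. -/
def B (k : ℕ) (α β : ℤ) (j n : ℕ) : ℂ :=
  ∑ h ∈ (Finset.range k).filter (fun h => h.Coprime k),
    omega α β h k * Complex.exp (-(2 * π * Complex.I * n * h / k) +
      π * Complex.I * hPrime h k * j / k)

/-- The modified Bessel function of the first kind, by its power series. -/
def besselI (v z : ℝ) : ℝ :=
  (z / 2) ^ v * ∑' m : ℕ, (z ^ 2 / 4) ^ m / ((m.factorial : ℝ) * Real.Gamma (v + m + 1))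

/-- The order `v = 1 - (α+β)/2` of the Bessel functions. -/
def order (α β : ℤ) : ℝ := 1 - ((α : ℝ) + β) / 2

/-- The quantity `(α+2β)π/12 + 2πn`. -/
def wCoeff (α β : ℤ) (n : ℕ) : ℝ := ((α : ℝ) + 2 * β) * (π / 12) + 2 * π * n

/-- The quantity `-(α+2β)π/(12k²) - 2πj/k²`. -/
def invCoeff0 (α β : ℤ) (j k : ℕ) : ℝ :=
  -((α : ℝ) + 2 * β) * (π / (12 * (k : ℝ) ^ 2)) - 2 * π * j / (k : ℝ) ^ 2

/-- The quantity `-(2α+β)π/(24k²) - πj/k²`. -/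
def invCoeff1 (α β : ℤ) (j k : ℕ) : ℝ :=
  -(2 * (α : ℝ) + β) * (π / (24 * (k : ℝ) ^ 2)) - π * j / (k : ℝ) ^ 2

/-- `L*(0,j,k;n)`, for the pair `(α,β)`. -/
def L0 (α β : ℤ) (j k n : ℕ) : ℝ :=
  invCoeff0 α β j k ^ (1 / 2 - ((α : ℝ) + β) / 4) *
    wCoeff α β n ^ (-(1 / 2) + ((α : ℝ) + β) / 4) *
    besselI (order α β) (2 * √(invCoeff0 α β j k * wCoeff α β n))

/-- `L*(1,j,k;n)`, for the pair `(α,β)`. -/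
def L1 (α β : ℤ) (j k n : ℕ) : ℝ :=
  invCoeff1 α β j k ^ (1 / 2 - ((α : ℝ) + β) / 4) *
    wCoeff α β n ^ (-(1 / 2) + ((α : ℝ) + β) / 4) *
    besselI (order α β) (2 * √(invCoeff1 α β j k * wCoeff α β n))

/-- The summand of the exact formula for even `k`. -/
def evenTerm (α β : ℤ) (n j k : ℕ) : ℂ :=
  A k α β j n * a α β j / (((k : ℝ) ^ (((α : ℝ) + β) / 2) : ℝ) : ℂ) * (L0 α β j k n : ℂ)

/-- The summand of the exact formula for odd `k`; note the coefficient of `H_{β,α}`. -/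
def oddTerm (α β : ℤ) (n j k : ℕ) : ℂ :=
  B k α β j n * a β α j /
    (((2 : ℝ) ^ ((β : ℝ) / 2) * (k : ℝ) ^ (((α : ℝ) + β) / 2) : ℝ) : ℂ) * (L1 α β j k n : ℂ)

end

end EtaQuotient

/-! ### The Euler product, holomorphy in q, and the coefficients as integrals. -/

namespace EtaQuotient

noncomputable section

open Complex ModularForm
open UpperHalfPlane hiding I
open scoped Manifold

/-! The proof is Rademacher's circle method, with a separate arithmetic argument in weight zero. Put
s = 2 - (α+β)/2, so that s ≥ 2. For every y > 0 the coefficient is ∫₀¹ H(x+iy) exp(-2πin(x+iy)) dx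
(`a_eq_integral`). Take y = 1/N² and cut the period into Farey arcs of order N (`farey_dissection`).
On the arc of h/k write τ = h/k + iζ with ζ = y - iφ. The transformation law of the Euler product at
a rational point, obtained by Euclidean descent with Dedekind reciprocity supplying the phase
(`eulerFun_transform`), expresses H through H_{α,β} at h'/k + i/(k²ζ) when k is even, and through
H_{β,α} at half that point when k is odd. Expanding in the new variable gives terms (kζ)^(s-2)
exp(cζ + D_j/(k²ζ)) with c = `wCoeff`, and only finitely many D_j are positive.

A polar term (D_j > 0), integrated over |φ| ≤ 1/(kN), becomes in the variable u = 1/ζ an integral of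
u^(-s) exp(du + c/u) with d = D_j/k². Its path may be replaced by a vertical line with a controlled
error (`norm_integral_segment_sub_le`), and on the full line the integral is the Bessel value
(`integral_line_besselKernel`).

The remaining errors are controlled by summing over h first. For fixed φ, the h whose arc contains φ
are those with -1/h in an interval modulo k (`exists_interval_of_fareyArc`), so the multipliers
occur in incomplete Kloosterman sums. If W(k) bounds these, the error from denominator k is O(W(k)
k⁻¹ N^(1-s)) (`norm_arcIntegral_sub_le`). As k ≤ N, this is dominated by W(k) k^(-s), so convergence
of ∑ W(k) k^(-s) is all that is required (`hasSum_cuspTerm`).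

If α+β < 0 then s > 2 and the trivial W(k) = k suffices. If α+β = 0 then s = 2 and a power saving is
needed. Then H is, up to a power of q, a power of η(τ)/η(2τ), whose multiplier on Γ₀(2) is explicit
(`ratioLaw`). Hence ω is an additive phase in h and h' times a phase depending only on residues
modulo 48. Write k = tm with m squarefree, coprime to t and free of small primes. The sum splits
over classes modulo t into honest Kloosterman sums modulo m, which are at most m^(4/5) by
Kloosterman's fourth moment argument (`norm_kloosterman_pow_four_le`, `norm_sum_fiber_le`).
Completing the sums costs a logarithm, and since t is powerful up to a bounded factor the series
over k converges (`exists_summable_bound`). -/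

/-- The Euler product `∏ (1 - q^n)` in the variable `q`. -/
def eulerProd (q : ℂ) : ℂ := ∏' n : ℕ, (1 - q ^ (n + 1))

/-- The Euler product as a function of `τ`, with `q = exp(2πiτ)`. -/
def eulerFun (τ : ℂ) : ℂ := eulerProd (cexp (2 * π * I * τ))

theorem norm_cexp_lt_one {τ : ℂ} (hτ : 0 < τ.im) : ‖cexp (2 * π * I * τ)‖ < 1 :=
  norm_exp_two_pi_I_lt_one ⟨τ, hτ⟩

theorem eulerFun_eq (τ : ℂ) : eulerFun τ = ∏' n, (1 - eta_q n τ) := by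
  simp only [eulerFun, eulerProd, eta_q_eq_pow]

theorem eta_eq_eulerFun (τ : ℂ) : ModularForm.eta τ = cexp (2 * π * I * τ / 24) * eulerFun τ := by
  rw [eulerFun_eq, ModularForm.eta, Function.Periodic.qParam]
  norm_num

/-- No factor vanishes in the unit disc and the product converges absolutely. The exponents of the
eta quotient may be negative, so holomorphy of the integer powers rests on this. -/
theorem eulerProd_ne_zero {q : ℂ} (hq : ‖q‖ < 1) : eulerProd q ≠ 0 := by
  have := tprod_one_add_ne_zero_of_summable (f := fun n : ℕ ↦ -q ^ (n + 1)) (fun i h => ?_) ?_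
  · simpa [eulerProd, sub_eq_add_neg] using this
  · have h1 : q ^ (i + 1) = 1 := by linear_combination -h
    have h2 : ‖q‖ ^ (i + 1) < 1 := pow_lt_one₀ (norm_nonneg _) hq (by simp)
    rw [← norm_pow, h1] at h2
    simp at h2
  · simpa using (summable_nat_add_iff 1).mpr (summable_geometric_of_lt_one (norm_nonneg _) hq)

theorem eulerFun_ne_zero {τ : ℂ} (hτ : 0 < τ.im) : eulerFun τ ≠ 0 :=
  eulerProd_ne_zero (norm_cexp_lt_one hτ)

theorem eulerFun_add_int (τ : ℂ) (m : ℤ) : eulerFun (τ + m) = eulerFun τ := by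
  unfold eulerFun
  congr 1
  rw [Complex.exp_eq_exp_iff_exists_int]
  exact ⟨m, by ring⟩

theorem eulerFun_congr {τ τ' : ℂ} (m : ℤ) (h : τ = τ' + m) : eulerFun τ = eulerFun τ' := by
  rw [h, eulerFun_add_int]

/-- The inversion law of η in terms of a principal power: on the right half-plane log(iw) = log i +
log w, so the two separate square roots combine without a branch correction. -/
theorem eta_I_div {w : ℂ} (hw : 0 < w.re) :
    ModularForm.eta (I / w) = w ^ (1 / 2 : ℂ) * ModularForm.eta (I * w) := by
  have hw0 : w ≠ 0 := by rintro rfl; simp at hw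
  have h : (I * w) ∈ upperHalfPlaneSet := by simpa using hw
  have h1 := eta_comp_eq_csqrt_I_inv h
  simp only [Function.comp, Pi.smul_apply, Pi.mul_apply, smul_eq_mul] at h1
  rw [show I / w = -1 / (I * w) by field_simp; simp, h1, ← mul_assoc]
  congr 1
  simp only [sqrt_eq_exp (mul_ne_zero I_ne_zero hw0), sqrt_eq_exp I_ne_zero]
  rw [cpow_def_of_ne_zero hw0, ← Complex.exp_neg, ← Complex.exp_add]
  have habs := abs_lt.1 (abs_arg_lt_pi_div_two_iff.2 (Or.inl hw))
  have : log (I * w) = log I + log w := by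
    refine log_mul I_ne_zero hw0 ⟨?_, ?_⟩ <;> rw [arg_I] <;> linarith [habs.1, habs.2, Real.pi_pos]
  rw [this]
  ring_nf

theorem eulerFun_I_mul {w : ℂ} (hw : 0 < w.re) :
    eulerFun (I * w) = w ^ (-(1 / 2) : ℂ) * cexp (-(π / (12 * w)) + π * w / 12) *
      eulerFun (I / w) := by
  have hw0 : w ≠ 0 := by rintro rfl; simp at hw
  have h := eta_I_div hw
  rw [eta_eq_eulerFun, eta_eq_eulerFun] at h
  have h2 : w ^ (1 / 2 : ℂ) ≠ 0 := by simp [cpow_eq_zero_iff, hw0]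
  rw [cpow_neg, Complex.exp_add]
  have e1 : cexp (2 * π * I * (I / w) / 24) = cexp (-(π / (12 * w))) := by
    congr 1; field_simp; rw [I_sq]; ring
  have e2 : cexp (2 * π * I * (I * w) / 24) = (cexp (π * w / 12))⁻¹ := by
    rw [← Complex.exp_neg]; congr 1; ring_nf; rw [I_sq]; ring
  rw [e1, e2] at h
  field_simp
  have := Complex.exp_ne_zero (π * w / 12)
  field_simp at h
  rw [mul_comm I w, mul_comm w (π : ℂ), mul_comm w 12]
  linear_combination -h

theorem H_eq (α β : ℤ) (τ : UpperHalfPlane) :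
    H α β τ = eulerFun τ ^ α * eulerFun (2 * τ) ^ β := by
  unfold H
  rw [eta_eq_eulerFun, eta_eq_eulerFun, mul_zpow, mul_zpow, ← Complex.exp_int_mul,
    ← Complex.exp_int_mul]
  have : cexp (-(2 * π * I * (τ : ℂ) * (((α + 2 * β : ℤ) : ℂ) / 24))) *
      cexp (α * (2 * π * I * τ / 24)) * cexp (β * (2 * π * I * (2 * τ) / 24)) = 1 := by
    rw [← Complex.exp_add, ← Complex.exp_add, ← Complex.exp_zero]
    congr 1
    push_cast
    ring
  linear_combination eulerFun τ ^ α * eulerFun (2 * τ) ^ β * this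

/-- `H_{α,β}` as a function of `q`. -/
def HDisc (α β : ℤ) (q : ℂ) : ℂ := eulerProd q ^ α * eulerProd (q ^ 2) ^ β

theorem H_eq_HDisc (α β : ℤ) (τ : UpperHalfPlane) :
    H α β τ = HDisc α β (cexp (2 * π * I * τ)) := by
  rw [H_eq, HDisc, eulerFun, eulerFun, ← Complex.exp_nat_mul]
  congr 4
  push_cast; ring

theorem differentiableAt_eulerProd {q : ℂ} (hq : ‖q‖ < 1) : DifferentiableAt ℂ eulerProd q :=
  differentiableOn_tprod_one_sub_pow.differentiableAt
    (Metric.isOpen_ball.mem_nhds (by simpa using hq))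

/-- Periodicity, holomorphy and boundedness at i∞ of `H`, needed for its q-expansion, are all read
off from the variable q. -/
theorem differentiableAt_HDisc (α β : ℤ) {q : ℂ} (hq : ‖q‖ < 1) :
    DifferentiableAt ℂ (HDisc α β) q := by
  have hq2 : ‖q ^ 2‖ < 1 := by
    rw [norm_pow]; exact pow_lt_one₀ (norm_nonneg _) hq (by simp)
  refine DifferentiableAt.mul ?_ ?_
  · exact (differentiableAt_eulerProd hq).zpow (Or.inl (eulerProd_ne_zero hq))
  · exact DifferentiableAt.zpow
      (DifferentiableAt.comp q (differentiableAt_eulerProd hq2) (by fun_prop))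
      (Or.inl (eulerProd_ne_zero hq2))

theorem H_periodic (α β : ℤ) : Function.Periodic (H α β ∘ UpperHalfPlane.ofComplex) (1 : ℝ) := by
  intro τ
  by_cases h : 0 < τ.im
  · have h' : 0 < (τ + (1 : ℝ)).im := by simpa using h
    simp only [Function.comp, ofComplex_apply_of_im_pos h, ofComplex_apply_of_im_pos h',
      H_eq_HDisc]
    congr 1
    rw [Complex.exp_eq_exp_iff_exists_int]
    exact ⟨1, by push_cast; ring⟩
  · have h' : ¬ 0 < (τ + (1 : ℝ)).im := by simpa using h
    simp only [Function.comp, ofComplex_apply_of_im_nonpos (not_lt.1 h),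
      ofComplex_apply_of_im_nonpos (not_lt.1 h')]

theorem H_mdiff (α β : ℤ) : MDiff (H α β) := by
  rw [UpperHalfPlane.mdifferentiable_iff]
  refine DifferentiableOn.congr (f := fun τ => HDisc α β (cexp (2 * π * I * τ))) ?_ ?_
  · intro τ hτ
    refine DifferentiableAt.differentiableWithinAt ?_
    exact DifferentiableAt.comp τ (differentiableAt_HDisc α β (norm_cexp_lt_one hτ))
      (by fun_prop)
  · intro τ hτ
    simp only [Function.comp, ofComplex_apply_of_im_pos hτ, H_eq_HDisc]

theorem H_bounded (α β : ℤ) : IsBoundedAtImInfty (H α β) := by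
  have h1 : Filter.Tendsto (HDisc α β) (nhds 0) (nhds (HDisc α β 0)) :=
    (differentiableAt_HDisc α β (by simp)).continuousAt
  have h2 := h1.comp (UpperHalfPlane.qParam_tendsto_atImInfty zero_lt_one
    )
  refine Filter.Tendsto.isBigO_one ℝ (c := HDisc α β 0) (h2.congr fun τ => ?_)
  rw [H_eq_HDisc]
  simp [Function.Periodic.qParam]

theorem H_hasSum (α β : ℤ) {τ : ℂ} (hτ : 0 < τ.im) :
    HasSum (fun j : ℕ => a α β j * cexp (2 * π * I * j * τ)) (H α β ⟨τ, hτ⟩) := by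
  have := hasSum_qExpansion zero_lt_one (H_periodic α β) (H_mdiff α β) (H_bounded α β) ⟨τ, hτ⟩
  convert this using 2 with j
  rw [a, smul_eq_mul, Function.Periodic.qParam, ← Complex.exp_nat_mul]
  simp only [ofReal_one, div_one]
  congr 2
  ring

theorem summable_norm_a (α β : ℤ) {r : ℝ} (hr : 0 < r) :
    Summable fun j : ℕ => ‖a α β j‖ * Real.exp (-(r * j)) := by
  have := (H_hasSum α β (τ := r / (2 * π) * I) (by
    rw [← ofReal_ofNat, ← ofReal_mul, ← ofReal_div, im_ofReal_mul, Complex.I_im]; positivity)).summable.norm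
  refine this.congr fun j => ?_
  rw [norm_mul, Complex.norm_exp]
  congr 2
  rw [show 2 * π * I * j * (r / (2 * π) * I) = ((-(r * j) : ℝ) : ℂ) by
    have : (π : ℂ) ≠ 0 := by exact_mod_cast Real.pi_ne_zero
    push_cast; field_simp; rw [I_sq]; ring, ofReal_re]

/-- The height y is free; the circle method lets it tend to 0 as 1/N². -/
theorem a_eq_integral (α β : ℤ) (n : ℕ) {y : ℝ} (hy : 0 < y) :
    a α β n = ∫ x in (0 : ℝ)..1, cexp (-(2 * π * I * n * (x + y * I))) *
      HDisc α β (cexp (2 * π * I * (x + y * I))) := by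
  rw [a, qExpansion_coeff_eq_intervalIntegral zero_lt_one (H_periodic α β) (H_mdiff α β)
    (H_bounded α β) n hy]
  simp only [ofReal_one, div_one, one_mul]
  refine intervalIntegral.integral_congr fun x _ => ?_
  simp only [H_eq_HDisc]
  congr 1
  rw [Function.Periodic.qParam, ← Complex.exp_nat_mul, one_div, ← Complex.exp_neg]
  simp only [ofReal_one, div_one]
  congr 1
  simp only [UpperHalfPlane.I]
  ring

end

end EtaQuotient

/-! ### Dedekind sums and their reciprocity law. -/

namespace EtaQuotient

theorem sawtooth_eq (x : ℝ) : sawtooth x = if Int.fract x = 0 then 0 else Int.fract x - 1 / 2 := by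
  unfold sawtooth Int.fract; rfl

theorem sawtooth_add_int (x : ℝ) (m : ℤ) : sawtooth (x + m) = sawtooth x := by
  simp only [sawtooth_eq, Int.fract_add_intCast]

theorem sawtooth_neg (x : ℝ) : sawtooth (-x) = -sawtooth x := by
  simp only [sawtooth_eq]
  by_cases h : Int.fract x = 0
  · simp [h, Int.fract_neg_eq_zero.2 h]
  · rw [if_neg h, Int.fract_neg h, if_neg]
    · ring
    · have := Int.fract_lt_one x
      linarith

theorem sawtooth_natCast_div (m k : ℕ) (hk : 0 < k) :
    sawtooth ((m : ℝ) / k) = if m % k = 0 then 0 else ((m % k : ℕ) : ℝ) / k - 1 / 2 := by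
  rw [sawtooth_eq, Int.fract_div_natCast_eq_div_natCast_mod]
  have : (k : ℝ) ≠ 0 := by positivity
  simp [this]

theorem dedekindSum_congr {h g k : ℕ} (hk : 0 < k) (hg : h ≡ g [MOD k]) :
    dedekindSum h k = dedekindSum g k := by
  unfold dedekindSum
  refine Finset.sum_congr rfl fun r _ => ?_
  congr 1
  rw [← Nat.cast_mul, ← Nat.cast_mul, sawtooth_natCast_div _ _ hk, sawtooth_natCast_div _ _ hk,
    (hg.mul_right r : (h * r) % k = (g * r) % k)]

theorem dedekindSum_neg {h g k : ℕ} (hk : 0 < k) (hg : k ∣ h + g) :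
    dedekindSum g k = -dedekindSum h k := by
  unfold dedekindSum
  rw [← Finset.sum_neg_distrib]
  refine Finset.sum_congr rfl fun r _ => ?_
  obtain ⟨c, hc⟩ := hg
  have hk' : (k : ℝ) ≠ 0 := by positivity
  have hc' : (h : ℝ) + g = k * c := by exact_mod_cast hc
  have : (g : ℝ) * r / k = -((h : ℝ) * r / k) + ((c * r : ℤ) : ℝ) := by
    push_cast
    field_simp
    linear_combination (r : ℝ) * hc'
  rw [this, sawtooth_add_int, sawtooth_neg]
  ring

theorem sawtooth_zero : sawtooth 0 = 0 := by simp [sawtooth]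

theorem dedekindSum_eq_range (h k : ℕ) : dedekindSum h k =
    ∑ r ∈ Finset.range k, sawtooth ((r : ℝ) / k) * sawtooth ((h : ℝ) * r / k) := by
  rcases Nat.eq_zero_or_pos k with rfl | hk
  · simp [dedekindSum]
  · rw [dedekindSum, Finset.range_eq_Ico, Finset.sum_eq_sum_Ico_succ_bot hk]
    simp [sawtooth_zero]

theorem sawtooth_two (r K : ℕ) (hr : r < K) :
    sawtooth ((r : ℝ) / (2 * K : ℕ)) + sawtooth (((K + r : ℕ) : ℝ) / (2 * K : ℕ)) =
      sawtooth ((r : ℝ) / K) := by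
  have hK : 0 < K := by omega
  rw [sawtooth_natCast_div _ _ (by omega), sawtooth_natCast_div _ _ (by omega),
    sawtooth_natCast_div _ _ hK, Nat.mod_eq_of_lt (by omega : r < 2 * K),
    Nat.mod_eq_of_lt (by omega : K + r < 2 * K), Nat.mod_eq_of_lt hr]
  have hK' : (K : ℝ) ≠ 0 := by positivity
  rw [if_neg (by omega : ¬ K + r = 0)]
  split_ifs with h0
  · subst h0
    push_cast
    field_simp
    ring
  · push_cast
    field_simp
    ring

/-- Pairing r with K + r leaves the second sawtooth unchanged, by periodicity, while the
distribution relation `sawtooth_two` collapses the first. For even k = 2K this turns the s(h, K)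
produced by η(2τ) into the s(2h, k) of `omega`. -/
theorem dedekindSum_two_mul (h K : ℕ) : dedekindSum (2 * h) (2 * K) = dedekindSum h K := by
  rcases Nat.eq_zero_or_pos K with rfl | hK
  · simp [dedekindSum]
  have hK' : (K : ℝ) ≠ 0 := by positivity
  rw [dedekindSum_eq_range, dedekindSum_eq_range, two_mul K, Finset.sum_range_add,
    ← Finset.sum_add_distrib, ← two_mul K]
  refine Finset.sum_congr rfl fun r hr => ?_
  rw [← sawtooth_two r K (Finset.mem_range.1 hr)]
  have e1 : ((2 * h : ℕ) : ℝ) * r / (2 * K : ℕ) = (h : ℝ) * r / K := by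
    push_cast; field_simp
  have e2 : ((2 * h : ℕ) : ℝ) * (K + r : ℕ) / (2 * K : ℕ) = (h : ℝ) * r / K + (h : ℤ) := by
    push_cast; field_simp; ring
  rw [e1, e2, sawtooth_add_int]
  ring

theorem image_mul_mod {h k : ℕ} (hk : 0 < k) (hc : h.Coprime k) :
    (Finset.range k).image (fun r => h * r % k) = Finset.range k := by
  refine Finset.eq_of_subset_of_card_le ?_ ?_
  · intro x hx
    obtain ⟨r, _, rfl⟩ := Finset.mem_image.1 hx
    exact Finset.mem_range.2 (Nat.mod_lt _ hk)
  · rw [Finset.card_image_of_injOn]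
    intro r hr s hs hrs
    have h1 : h * r ≡ h * s [MOD k] := hrs
    have h2 : r ≡ s [MOD k] := Nat.ModEq.cancel_left_of_coprime
      (by simpa [Nat.coprime_comm] using hc) h1
    have hr := Finset.mem_range.1 hr
    have hs := Finset.mem_range.1 hs
    rwa [Nat.ModEq, Nat.mod_eq_of_lt hr, Nat.mod_eq_of_lt hs] at h2

theorem sum_mul_mod {M : Type*} [AddCommMonoid M] {h k : ℕ} (hk : 0 < k) (hc : h.Coprime k)
    (f : ℕ → M) :
    ∑ r ∈ Finset.range k, f (h * r % k) = ∑ r ∈ Finset.range k, f r := by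
  conv_rhs => rw [← image_mul_mod hk hc]
  rw [Finset.sum_image]
  refine Finset.injOn_of_card_image_eq ?_
  rw [image_mul_mod hk hc]

/-- The sum `∑ r ⌊hr/k⌋` over `r < k`. -/
def floorSum (h k : ℕ) : ℕ := ∑ r ∈ Finset.range k, r * (h * r / k)

theorem sum_range_cast (k : ℕ) : ∑ r ∈ Finset.range k, (r : ℝ) = k * (k - 1) / 2 := by
  induction k with
  | zero => simp
  | succ k ih => rw [Finset.sum_range_succ, ih]; push_cast; ring

theorem sum_range_cast_sq (k : ℕ) :
    ∑ r ∈ Finset.range k, (r : ℝ) ^ 2 = k * (k - 1) * (2 * k - 1) / 6 := by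
  induction k with
  | zero => simp
  | succ k ih => rw [Finset.sum_range_succ, ih]; push_cast; ring

theorem mod_eq_real (m k : ℕ) : ((m % k : ℕ) : ℝ) = m - k * (m / k : ℕ) := by
  have := Nat.mod_add_div m k
  have h2 : ((m % k : ℕ) : ℝ) + k * (m / k : ℕ) = m := by exact_mod_cast this
  linarith

theorem dedekindSum_eq_floorSum {h k : ℕ} (hk : 0 < k) (hc : h.Coprime k) :
    dedekindSum h k = h * (k - 1) * (2 * k - 1) / (6 * k) - floorSum h k / k - (k - 1) / 4 := by
  have hk' : (k : ℝ) ≠ 0 := by positivity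
  -- At r = 0 the sawtooth vanishes whereas (-1/2)² = 1/4, hence the correction. Coprimality
  -- excludes every other r with k ∣ hr.
  have key : ∀ r ∈ Finset.range k, sawtooth ((r : ℝ) / k) * sawtooth ((h : ℝ) * r / k) =
      ((r : ℝ) / k - 1 / 2) * (((h * r % k : ℕ) : ℝ) / k - 1 / 2) - if r = 0 then 1 / 4 else 0 := by
    intro r hr
    have hr := Finset.mem_range.1 hr
    rw [← Nat.cast_mul, sawtooth_natCast_div _ _ hk, sawtooth_natCast_div _ _ hk,
      Nat.mod_eq_of_lt hr]
    split_ifs with h1 h2 h3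
    · subst h1; norm_num
    · subst h1; simp at h2
    · exfalso
      have : k ∣ r := (Nat.Coprime.dvd_of_dvd_mul_left
        (by simpa [Nat.coprime_comm] using hc) (Nat.dvd_of_mod_eq_zero h3))
      exact absurd (Nat.le_of_dvd (Nat.pos_of_ne_zero h1) this) (by omega)
    · ring
  rw [dedekindSum_eq_range, Finset.sum_congr rfl key, Finset.sum_sub_distrib]
  have h0 : ∑ r ∈ Finset.range k, (if r = 0 then (1 / 4 : ℝ) else 0) = 1 / 4 := by
    rw [Finset.sum_ite_eq' ]
    simp [hk]
  have expand : ∀ r ∈ Finset.range k,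
      ((r : ℝ) / k - 1 / 2) * (((h * r % k : ℕ) : ℝ) / k - 1 / 2) =
      h / k ^ 2 * (r : ℝ) ^ 2 - ((r * (h * r / k) : ℕ) : ℝ) / k - 1 / (2 * k) * r -
        1 / (2 * k) * ((h * r % k : ℕ) : ℝ) + 1 / 4 := by
    intro r _
    have := mod_eq_real (h * r) k
    push_cast at this ⊢
    rw [show ((r : ℝ) / k - 1 / 2) * (((h * r % k : ℕ) : ℝ) / k - 1 / 2) =
      r / k ^ 2 * ((h * r % k : ℕ) : ℝ) - 1 / (2 * k) * r - 1 / (2 * k) * ((h * r % k : ℕ) : ℝ)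
        + 1 / 4 by field_simp; ring]
    rw [show r / (k : ℝ) ^ 2 * ((h * r % k : ℕ) : ℝ) =
      r / (k : ℝ) ^ 2 * (h * r - k * (h * r / k : ℕ)) by rw [this]]
    field_simp
  rw [h0, Finset.sum_congr rfl expand, Finset.sum_add_distrib, Finset.sum_sub_distrib,
    Finset.sum_sub_distrib, Finset.sum_sub_distrib, ← Finset.mul_sum, ← Finset.mul_sum,
    ← Finset.mul_sum, ← Finset.sum_div,
    sum_mul_mod hk hc (fun r => (r : ℝ)), sum_range_cast, sum_range_cast_sq, floorSum]
  push_cast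
  simp only [Finset.sum_const, Finset.card_range, nsmul_eq_mul]
  field_simp
  ring

/-- The double count behind the reciprocity law: `∑ ⌊hr/k⌋(⌊hr/k⌋+1)` in terms of
`∑ m⌊km/h⌋`. -/
theorem sum_floor_mul_succ {h k : ℕ} (hh : 0 < h) (hk : 0 < k) (hc : h.Coprime k) :
    ∑ r ∈ Finset.range k, ((h * r / k : ℕ) : ℝ) * ((h * r / k : ℕ) + 1) =
      (k - 1) * (h * (h - 1)) - 2 * floorSum k h := by
  -- A product ⌊x⌋(⌊x⌋+1) is twice the sum of the integers up to ⌊x⌋, so the sum runs over lattice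
  -- points under a line, with weight 2m. They are then counted with m fixed.
  have h1 : ∀ r ∈ Finset.range k, ((h * r / k : ℕ) : ℝ) * ((h * r / k : ℕ) + 1) =
      ∑ m ∈ Finset.range h, if k * m ≤ h * r then 2 * (m : ℝ) else 0 := by
    intro r hr
    have hr := Finset.mem_range.1 hr
    have hlt : h * r / k < h := by
      rw [Nat.div_lt_iff_lt_mul hk]
      exact Nat.mul_lt_mul_of_pos_left hr hh
    rw [← Finset.sum_filter]
    have : (Finset.range h).filter (fun m => k * m ≤ h * r) = Finset.range (h * r / k + 1) := by
      ext m
      simp only [Finset.mem_filter, Finset.mem_range]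
      have : k * m ≤ h * r ↔ m < h * r / k + 1 := by
        rw [Nat.lt_succ_iff, Nat.le_div_iff_mul_le hk, mul_comm]
      rw [this]
      omega
    rw [this, ← Finset.mul_sum, sum_range_cast]
    push_cast
    ring
  have h2 : ∀ m ∈ Finset.range h, (∑ r ∈ Finset.range k, if k * m ≤ h * r then 2 * (m : ℝ) else 0)
      = 2 * m * (k - 1) - 2 * ((m * (k * m / h) : ℕ) : ℝ) := by
    intro m hm
    have hm := Finset.mem_range.1 hm
    rcases Nat.eq_zero_or_pos m with rfl | hm0
    · simp
    have hlt : k * m / h < k := by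
      rw [Nat.div_lt_iff_lt_mul hh]
      exact Nat.mul_lt_mul_of_pos_left hm hk
    -- For 0 < m < h no lattice point lies on the line itself, so ≤ and < count the same points.
    have hnd : ¬ h ∣ k * m := by
      intro hd
      have := Nat.le_of_dvd hm0 (hc.dvd_of_dvd_mul_left hd)
      omega
    have : (Finset.range k).filter (fun r => k * m ≤ h * r) = Finset.Ico (k * m / h + 1) k := by
      ext r
      simp only [Finset.mem_filter, Finset.mem_range, Finset.mem_Ico]
      have : k * m ≤ h * r ↔ k * m / h + 1 ≤ r := by
        rw [Nat.succ_le_iff, Nat.div_lt_iff_lt_mul hh, mul_comm r h]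
        refine ⟨fun hle => lt_of_le_of_ne hle ?_, le_of_lt⟩
        rintro heq
        exact hnd ⟨r, heq⟩
      rw [this]
      omega
    rw [← Finset.sum_filter, this, Finset.sum_const, Nat.card_Ico, nsmul_eq_mul,
      Nat.cast_sub hlt]
    push_cast
    ring
  rw [Finset.sum_congr rfl h1, Finset.sum_comm, Finset.sum_congr rfl h2, Finset.sum_sub_distrib,
    ← Finset.sum_mul, ← Finset.mul_sum, ← Finset.mul_sum, sum_range_cast, floorSum]
  push_cast
  ring

/-- Multiplication by h permutes the residues modulo k, so ∑ (x² - x) over x = {hr/k} equals the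
same sum over x = r/k. Expanding the fractional parts through ⌊hr/k⌋, the terms quadratic in the
floor are those of `sum_floor_mul_succ`, and these bring in `floorSum k h`. -/
theorem floorSum_reciprocity {h k : ℕ} (hh : 0 < h) (hk : 0 < k) (hc : h.Coprime k) :
    12 * ((h : ℝ) * floorSum h k + k * floorSum k h) =
      (k - 1) * (h - 1) * (8 * h * k - h - k - 1) := by
  have hk' : (k : ℝ) ≠ 0 := by positivity
  have h1 := sum_mul_mod hk hc (fun r => ((r : ℝ) / k) ^ 2 - (r : ℝ) / k)
  have h2 : ∀ r ∈ Finset.range k, (((h * r % k : ℕ) : ℝ) / k) ^ 2 - ((h * r % k : ℕ) : ℝ) / k =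
      h ^ 2 / k ^ 2 * (r : ℝ) ^ 2 - h / k * r - 2 * h / k * ((r * (h * r / k) : ℕ) : ℝ) +
      ((h * r / k : ℕ) : ℝ) * ((h * r / k : ℕ) + 1) := by
    intro r _
    rw [mod_eq_real]
    push_cast
    field_simp
    ring
  rw [Finset.sum_congr rfl h2, Finset.sum_add_distrib, Finset.sum_sub_distrib,
    Finset.sum_sub_distrib, ← Finset.mul_sum, ← Finset.mul_sum, ← Finset.mul_sum,
    sum_floor_mul_succ hh hk hc, Finset.sum_sub_distrib] at h1
  have hfs : ∑ r ∈ Finset.range k, ((r * (h * r / k) : ℕ) : ℝ) = floorSum h k := by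
    rw [floorSum, Nat.cast_sum]
  rw [hfs] at h1
  simp only [div_pow] at h1
  rw [← Finset.sum_div, ← Finset.sum_div, sum_range_cast, sum_range_cast_sq] at h1
  field_simp at h1
  linear_combination (-1 / 2) * h1

theorem dedekindSum_reciprocity {h k : ℕ} (hh : 0 < h) (hk : 0 < k) (hc : h.Coprime k) :
    dedekindSum h k + dedekindSum k h =
      -1 / 4 + ((h : ℝ) / k + k / h + 1 / (h * k)) / 12 := by
  have hk' : (k : ℝ) ≠ 0 := by positivity
  have hh' : (h : ℝ) ≠ 0 := by positivity
  rw [dedekindSum_eq_floorSum hk hc, dedekindSum_eq_floorSum hh hc.symm]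
  have := floorSum_reciprocity hh hk hc
  field_simp
  linear_combination -24 * this

end EtaQuotient

/-! ### Modular transformation of the Euler product and of H at rational points. -/

namespace EtaQuotient

noncomputable section

open Complex

theorem arg_lt_of_re_pos {z : ℂ} (hz : 0 < z.re) : -(π / 2) < arg z ∧ arg z < π / 2 :=
  abs_lt.1 (abs_arg_lt_pi_div_two_iff.2 (Or.inl hz))

/-- Both arguments lie in (-π/2, π/2), so their sum stays on the principal branch. -/
theorem mul_cpow_of_re_pos {z w : ℂ} (hz : 0 < z.re) (hw : 0 < w.re) (s : ℂ) :
    (z * w) ^ s = z ^ s * w ^ s := by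
  have hz0 : z ≠ 0 := by rintro rfl; simp at hz
  have hw0 : w ≠ 0 := by rintro rfl; simp at hw
  have h1 := arg_lt_of_re_pos hz
  have h2 := arg_lt_of_re_pos hw
  rw [cpow_def_of_ne_zero hz0, cpow_def_of_ne_zero hw0, cpow_def_of_ne_zero (mul_ne_zero hz0 hw0),
    log_mul hz0 hw0 ⟨by linarith, by linarith⟩, ← Complex.exp_add]
  ring_nf

theorem neg_I_mul_cpow {z : ℂ} (hz : 0 < z.re) :
    (-I * z) ^ (-(1 / 2) : ℂ) = cexp (π * I / 4) * z ^ (-(1 / 2) : ℂ) := by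
  have hz0 : z ≠ 0 := by rintro rfl; simp at hz
  have hI : -I ≠ 0 := by simp
  have h1 := arg_lt_of_re_pos hz
  rw [cpow_def_of_ne_zero hz0, cpow_def_of_ne_zero (mul_ne_zero hI hz0),
    log_mul hI hz0 ⟨by rw [arg_neg_I]; linarith, by rw [arg_neg_I]; linarith [Real.pi_pos]⟩,
    ← Complex.exp_add, log_neg_I]
  ring_nf

theorem eulerFun_transform_base (h : ℕ) (h' : ℤ) {ζ : ℂ} (hζ : 0 < ζ.re) :
    eulerFun ((h : ℂ) / (1 : ℕ) + I * ζ) = cexp (-(π * I * dedekindSum h 1)) *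
      (((1 : ℕ) : ℂ) * ζ) ^ (-(1 / 2) : ℂ) *
      cexp (-(π / (12 * (((1 : ℕ) : ℂ) ^ 2 * ζ))) + π * ζ / 12) *
      eulerFun (h' / (1 : ℕ) + I / (((1 : ℕ) : ℂ) ^ 2 * ζ)) := by
  rw [eulerFun_congr (τ' := I * ζ) h (by push_cast; ring),
    eulerFun_congr (τ := h' / (1 : ℕ) + I / (((1 : ℕ) : ℂ) ^ 2 * ζ)) (τ' := I / ζ) h'
      (by push_cast; ring), eulerFun_I_mul hζ]
  simp [dedekindSum]

/-- One step of the Euclidean algorithm. With iw = h/k + iζ, the inversion w ↦ 1/w carries a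
neighbourhood of h/k to one of -k/h, where the law with denominator h is available. Reciprocity
exchanges s(k,h) for s(h,k), and its constant -1/4 cancels the eighth root of unity coming from the
square root of -i. -/
theorem eulerFun_transform_step {k h : ℕ} (hk : 0 < k) (h0 : 0 < h) (hc : h.Coprime k)
    (ih : ∀ (g : ℕ) (g' : ℤ), g.Coprime h → (h : ℤ) ∣ g * g' + 1 → ∀ ζ : ℂ, 0 < ζ.re →
      eulerFun ((g : ℂ) / h + I * ζ) = cexp (-(π * I * dedekindSum g h)) *
      ((h : ℂ) * ζ) ^ (-(1 / 2) : ℂ) * cexp (-(π / (12 * ((h : ℂ) ^ 2 * ζ))) + π * ζ / 12) *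
      eulerFun (g' / h + I / ((h : ℂ) ^ 2 * ζ)))
    (h' : ℤ) (hh' : (k : ℤ) ∣ h * h' + 1) {ζ : ℂ} (hζ : 0 < ζ.re) :
    eulerFun ((h : ℂ) / k + I * ζ) = cexp (-(π * I * dedekindSum h k)) *
      ((k : ℂ) * ζ) ^ (-(1 / 2) : ℂ) * cexp (-(π / (12 * ((k : ℂ) ^ 2 * ζ))) + π * ζ / 12) *
      eulerFun (h' / k + I / ((k : ℂ) ^ 2 * ζ)) := by
  have hk0 : (k : ℂ) ≠ 0 := by exact_mod_cast hk.ne'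
  have hh0 : (h : ℂ) ≠ 0 := by exact_mod_cast h0.ne'
  have hζ0 : ζ ≠ 0 := by rintro rfl; simp at hζ
  -- A natural number congruent to -k modulo h: numerators are natural numbers in the inductive
  -- hypothesis.
  obtain ⟨g, hg⟩ : ∃ g, g + k = h * k :=
    ⟨(h - 1) * k, by obtain ⟨m, rfl⟩ : ∃ m, h = m + 1 := ⟨h - 1, by omega⟩
                     simp; ring⟩
  obtain ⟨c, hc'⟩ := hh'
  have hgC : (g : ℂ) + k = h * k := by exact_mod_cast hg
  have hcC : (h : ℂ) * h' + 1 = k * c := by exact_mod_cast hc'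
  have hgZ : (g : ℤ) + k = h * k := by exact_mod_cast hg
  have hgc : g.Coprime h := by
    have : (g + k).gcd h = h := by rw [hg]; simp
    rw [Nat.Coprime, ← Nat.dvd_one, ← (Nat.Coprime.gcd_eq_one hc)]
    refine Nat.dvd_gcd (Nat.gcd_dvd_right _ _) ?_
    have h1 : g.gcd h ∣ g + k := hg ▸ (Nat.gcd_dvd_right g h).mul_right k
    exact (Nat.dvd_add_right (Nat.gcd_dvd_left g h)).1 h1
  set w : ℂ := ζ - I * (h / k) with hw
  have hwre : 0 < w.re := by
    have : (I * ((h : ℂ) / k)).re = 0 := by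
      rw [show (h : ℂ) / k = ((h / k : ℝ) : ℂ) by push_cast; rfl]; simp
    rw [hw, sub_re, this]; simpa using hζ
  have hw0 : w ≠ 0 := by intro h; rw [h] at hwre; simp at hwre
  have hIw : I * w = h / k + I * ζ := by
    rw [hw]; ring_nf; rw [I_sq]; ring
  set ζ₁ : ℂ := 1 / w - I * (k / h) with hζ₁
  have hζ₁re : 0 < ζ₁.re := by
    have : (I * ((k : ℂ) / h)).re = 0 := by
      rw [show (k : ℂ) / h = ((k / h : ℝ) : ℂ) by push_cast; rfl]; simp
    rw [hζ₁, sub_re, this, one_div, inv_re, sub_zero]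
    exact div_pos hwre (normSq_pos.2 hw0)
  have hprod : w * (h * ζ₁) = -I * (k * ζ) := by
    rw [hζ₁]; field_simp; rw [hw]; field_simp; ring_nf; rw [I_sq]; ring
  have hζ₁0 : ζ₁ ≠ 0 := by intro h; rw [h] at hζ₁re; simp at hζ₁re
  -- After multiplication by i, the first summand is the real shift -1/(hk), which moves c/h to h'/k
  -- because hh' + 1 = kc.
  have hinv : 1 / ((h : ℂ) ^ 2 * ζ₁) = I / (h * k) + 1 / ((k : ℂ) ^ 2 * ζ) := by
    have e : (h : ℂ) ^ 2 * ζ₁ = h * (-I * (k * ζ)) / w := by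
      rw [← hprod]; field_simp
    rw [e, hw]
    field_simp
    ring_nf
    rw [I_sq]; ring
  have hIh := ih g c hgc ⟨k * c - h', by linear_combination c * hgZ + hc'⟩ ζ₁ hζ₁re
  rw [← hIw, eulerFun_I_mul hwre, eulerFun_congr (τ := I / w) (τ' := g / h + I * ζ₁) (-k) (by
    rw [hζ₁]; push_cast; field_simp; ring_nf; rw [I_sq]; linear_combination (-w) * hgC), hIh,
    eulerFun_congr (τ := c / h + I / ((h : ℂ) ^ 2 * ζ₁)) (τ' := h' / k + I / ((k : ℂ) ^ 2 * ζ)) 0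
    (by
      rw [div_eq_mul_one_div I ((h : ℂ) ^ 2 * ζ₁), hinv]; push_cast; field_simp; ring_nf
      rw [I_sq]; linear_combination (-k * ζ) * hcC),
    dedekindSum_neg h0 ⟨k, by rw [add_comm]; exact hg⟩]
  have hrec := dedekindSum_reciprocity h0 hk hc
  have hrecC : (dedekindSum k h : ℂ) = -1 / 4 + ((h : ℂ) / k + k / h + 1 / (h * k)) / 12 -
      dedekindSum h k := by
    have := congrArg (fun x : ℝ => (x : ℂ)) hrec
    push_cast at this
    linear_combination this
  have hcp : w ^ (-(1 / 2) : ℂ) * ((h : ℂ) * ζ₁) ^ (-(1 / 2) : ℂ) =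
      cexp (π * I / 4) * ((k : ℂ) * ζ) ^ (-(1 / 2) : ℂ) := by
    rw [← mul_cpow_of_re_pos hwre, hprod, neg_I_mul_cpow]
    · rw [← ofReal_natCast, re_ofReal_mul]; positivity
    · rw [← ofReal_natCast, re_ofReal_mul]; positivity
  have hexp : cexp (-(π / (12 * w)) + π * w / 12) * cexp (-(π * I * (-dedekindSum k h : ℝ))) *
      cexp (-(π / (12 * ((h : ℂ) ^ 2 * ζ₁))) + π * ζ₁ / 12) * cexp (π * I / 4) =
      cexp (-(π * I * dedekindSum h k)) * cexp (-(π / (12 * ((k : ℂ) ^ 2 * ζ))) + π * ζ / 12) := by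
    simp only [← Complex.exp_add]
    congr 1
    have e1 : (π : ℂ) / (12 * ((h : ℂ) ^ 2 * ζ₁)) =
        π / 12 * (I / (h * k) + 1 / ((k : ℂ) ^ 2 * ζ)) := by
      rw [← hinv]; field_simp
    have e2 : (π : ℂ) / (12 * w) = π / 12 * (ζ₁ + I * (k / h)) := by
      rw [hζ₁]; field_simp; ring
    rw [e1, e2, hw]
    push_cast
    rw [hrecC]
    field_simp
    ring
  linear_combination (eulerFun (h' / k + I / ((k : ℂ) ^ 2 * ζ)) *
    (cexp (-(π / (12 * w)) + π * w / 12) * cexp (-(π * I * (-dedekindSum k h : ℝ))) *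
      cexp (-(π / (12 * ((h : ℂ) ^ 2 * ζ₁))) + π * ζ₁ / 12))) * hcp +
      (eulerFun (h' / k + I / ((k : ℂ) ^ 2 * ζ)) * ((k : ℂ) * ζ) ^ (-(1 / 2) : ℂ)) * hexp

/-- The modular transformation of the Euler product at a rational point. -/
theorem eulerFun_transform : ∀ (k : ℕ), 0 < k → ∀ (h : ℕ) (h' : ℤ), h.Coprime k →
    (k : ℤ) ∣ h * h' + 1 → ∀ ζ : ℂ, 0 < ζ.re →
    eulerFun ((h : ℂ) / k + I * ζ) = cexp (-(π * I * dedekindSum h k)) *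
      ((k : ℂ) * ζ) ^ (-(1 / 2) : ℂ) * cexp (-(π / (12 * ((k : ℂ) ^ 2 * ζ))) + π * ζ / 12) *
      eulerFun (h' / k + I / ((k : ℂ) ^ 2 * ζ)) := by
  intro k
  induction k using Nat.strong_induction_on with
  | _ k IH =>
    intro hk h h' hc hh' ζ hζ
    rcases Nat.eq_or_lt_of_le (Nat.one_le_iff_ne_zero.2 hk.ne') with rfl | hk1
    · exact eulerFun_transform_base h h' hζ
    have hk0 : (k : ℂ) ≠ 0 := by exact_mod_cast hk.ne'
    have hdm := Nat.mod_add_div h k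
    have hc2 : (h % k).Coprime k := by
      rw [Nat.Coprime, ← Nat.gcd_rec, Nat.gcd_comm]; exact hc
    have hpos : 0 < h % k := by
      rcases Nat.eq_zero_or_pos (h % k) with h0 | h0
      · rw [h0, Nat.coprime_zero_left] at hc2; omega
      · exact h0
    have hlt := Nat.mod_lt h hk
    have hdC : ((h % k : ℕ) : ℂ) + k * (h / k : ℕ) = h := by exact_mod_cast hdm
    -- By periodicity h may be replaced by its remainder modulo k, so the Euclidean step descends to
    -- a denominator smaller than k.
    rw [eulerFun_congr (τ := (h : ℂ) / k + I * ζ) (τ' := ((h % k : ℕ) : ℂ) / k + I * ζ)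
      ((h / k : ℕ) : ℤ) (by rw [Int.cast_natCast]; field_simp; linear_combination -hdC),
      dedekindSum_congr hk (Nat.mod_modEq h k).symm]
    refine eulerFun_transform_step hk hpos hc2 (fun g g' h1 h2 ζ h3 => IH _ hlt hpos g g' h1 h2 ζ h3)
      h' ?_ hζ
    have : ((h % k : ℕ) : ℤ) * h' + 1 = (h * h' + 1) - k * ((h / k : ℕ) * h') := by
      have : ((h % k : ℕ) : ℤ) + k * (h / k : ℕ) = h := by exact_mod_cast hdm
      rw [← this]; ring
    rw [this]
    exact dvd_sub hh' (dvd_mul_right _ _)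

/-- `H_{α,β}` as a function on the complex plane. -/
def HFun (α β : ℤ) (τ : ℂ) : ℂ := eulerFun τ ^ α * eulerFun (2 * τ) ^ β

theorem HFun_eq_HDisc (α β : ℤ) (τ : ℂ) : HFun α β τ = HDisc α β (cexp (2 * π * I * τ)) := by
  rw [HFun, HDisc, eulerFun, eulerFun, ← Complex.exp_nat_mul]
  congr 4
  push_cast; ring

theorem HFun_hasSum (α β : ℤ) {τ : ℂ} (hτ : 0 < τ.im) :
    HasSum (fun j : ℕ => a α β j * cexp (2 * π * I * j * τ)) (HFun α β τ) := by
  have := H_hasSum α β hτ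
  rwa [H_eq_HDisc, ← HFun_eq_HDisc] at this

theorem cpow_neg_half_zpow (z : ℂ) (m : ℤ) : (z ^ (-(1 / 2) : ℂ)) ^ m = z ^ (-((m : ℂ) / 2)) := by
  rw [← cpow_mul_int]; congr 1; ring

/-- With k = 2K, doubling the point gives h/K + i(2ζ), for which the same h' is admissible. Its
image is twice the image of the original point, so the same pair (α, β) reappears. -/
theorem HFun_transform_even (α β : ℤ) {k h : ℕ} (hk : 0 < k) (hk2 : Even k) (hc : h.Coprime k)
    (h' : ℤ) (hh' : (k : ℤ) ∣ h * h' + 1) {ζ : ℂ} (hζ : 0 < ζ.re) :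
    HFun α β ((h : ℂ) / k + I * ζ) = omega α β h k * ((k : ℂ) * ζ) ^ (-(((α : ℂ) + β) / 2)) *
      cexp ((α + 2 * β) * (π / 12) * ζ - (α + 2 * β) * (π / 12) / ((k : ℂ) ^ 2 * ζ)) *
      HFun α β (h' / k + I / ((k : ℂ) ^ 2 * ζ)) := by
  obtain ⟨K, rfl⟩ := hk2
  rw [← two_mul] at *
  have hK : 0 < K := by omega
  have hK0 : (K : ℂ) ≠ 0 := by exact_mod_cast hK.ne'
  have hζ0 : ζ ≠ 0 := by rintro rfl; simp at hζ
  have hc2 : h.Coprime K := hc.coprime_dvd_right (dvd_mul_left _ _)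
  have h1 := eulerFun_transform (2 * K) hk h h' hc hh' ζ hζ
  have h2 := eulerFun_transform K hK h h' hc2
    (dvd_trans (by push_cast; exact dvd_mul_left _ _) hh') (2 * ζ) (by simpa using hζ)
  rw [← dedekindSum_two_mul] at h2
  have e1 : 2 * ((h : ℂ) / (2 * K : ℕ) + I * ζ) = h / K + I * (2 * ζ) := by
    push_cast; field_simp
  have e2 : (h' : ℂ) / K + I / ((K : ℂ) ^ 2 * (2 * ζ)) =
      2 * (h' / (2 * K : ℕ) + I / (((2 * K : ℕ) : ℂ) ^ 2 * ζ)) := by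
    push_cast; field_simp
  have e3 : (K : ℂ) * (2 * ζ) = (2 * K : ℕ) * ζ := by push_cast; ring
  have hne : ((2 * K : ℕ) : ℂ) * ζ ≠ 0 := by
    simp only [ne_eq, mul_eq_zero, hζ0, or_false, Nat.cast_eq_zero]; omega
  rw [HFun, HFun, e1, h1, h2, e2, e3]
  simp only [mul_zpow, cpow_neg_half_zpow, ← Complex.exp_int_mul]
  rw [show -(((α : ℂ) + β) / 2) = -((α : ℂ) / 2) + -((β : ℂ) / 2) by ring, cpow_add _ _ hne, omega]
  have hexp : cexp (α * -(π * I * dedekindSum h (2 * K))) *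
      cexp (β * -(π * I * dedekindSum (2 * h) (2 * K))) *
      cexp (α * (-(π / (12 * (((2 * K : ℕ) : ℂ) ^ 2 * ζ))) + π * ζ / 12)) *
      cexp (β * (-(π / (12 * ((K : ℂ) ^ 2 * (2 * ζ)))) + π * (2 * ζ) / 12)) =
      cexp (-(π * I * ((α * dedekindSum h (2 * K) + β * dedekindSum (2 * h) (2 * K) : ℝ) : ℂ))) *
      cexp ((α + 2 * β) * (π / 12) * ζ -
        (α + 2 * β) * (π / 12) / (((2 * K : ℕ) : ℂ) ^ 2 * ζ)) := by
    simp only [← Complex.exp_add]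
    congr 1
    push_cast
    field_simp
    ring
  linear_combination (((2 * K : ℕ) * ζ) ^ (-((α : ℂ) / 2)) * ((2 * K : ℕ) * ζ) ^ (-((β : ℂ) / 2)) *
    eulerFun (h' / (2 * K : ℕ) + I / (((2 * K : ℕ) : ℂ) ^ 2 * ζ)) ^ α *
    eulerFun (2 * (h' / (2 * K : ℕ) + I / (((2 * K : ℕ) : ℂ) ^ 2 * ζ))) ^ β) * hexp

/-- For odd k, doubling keeps the denominator and replaces h by 2h, whose negative inverse is h'/2;
this is why h' must be even. The image of the doubled point is half the other image, so the
exponents change places, and 2^(-β/2) comes from the factor (2kζ)^(-1/2). -/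
theorem HFun_transform_odd (α β : ℤ) {k h : ℕ} (hk2 : Odd k) (hc : h.Coprime k)
    (h' : ℤ) (hh' : (k : ℤ) ∣ h * h' + 1) (h'2 : Even h') {ζ : ℂ} (hζ : 0 < ζ.re) :
    HFun α β ((h : ℂ) / k + I * ζ) = omega α β h k * (2 : ℂ) ^ (-((β : ℂ) / 2)) *
      ((k : ℂ) * ζ) ^ (-(((α : ℂ) + β) / 2)) *
      cexp ((α + 2 * β) * (π / 12) * ζ - (2 * α + β) * (π / 24) / ((k : ℂ) ^ 2 * ζ)) *
      HFun β α ((h' / k + I / ((k : ℂ) ^ 2 * ζ)) / 2) := by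
  have hk : 0 < k := hk2.pos
  have hk0 : (k : ℂ) ≠ 0 := by exact_mod_cast hk.ne'
  have hζ0 : ζ ≠ 0 := by rintro rfl; simp at hζ
  obtain ⟨g, rfl⟩ := h'2
  rw [← two_mul] at *
  have hc2 : (2 * h).Coprime k := Nat.Coprime.mul_left (Nat.coprime_two_left.2 hk2) hc
  have h1 := eulerFun_transform k hk h (2 * g) hc hh' ζ hζ
  have h2 := eulerFun_transform k hk (2 * h) g hc2 (by
    convert hh' using 1; push_cast; ring) (2 * ζ) (by simpa using hζ)
  have e1 : ((2 * h : ℕ) : ℂ) / k + I * (2 * ζ) = 2 * ((h : ℂ) / k + I * ζ) := by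
    push_cast; ring
  have e2 : (g : ℂ) / k + I / ((k : ℂ) ^ 2 * (2 * ζ)) =
      (((2 * g : ℤ) : ℂ) / k + I / ((k : ℂ) ^ 2 * ζ)) / 2 := by
    push_cast; field_simp
  have hne : (k : ℂ) * ζ ≠ 0 := mul_ne_zero hk0 hζ0
  have e3 : ((k : ℂ) * (2 * ζ)) ^ (-(1 / 2) : ℂ) =
      2 ^ (-(1 / 2) : ℂ) * ((k : ℂ) * ζ) ^ (-(1 / 2) : ℂ) := by
    rw [show (k : ℂ) * (2 * ζ) = 2 * (k * ζ) by ring]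
    refine mul_cpow_of_re_pos (by simp) ?_ _
    rw [← ofReal_natCast, re_ofReal_mul]; positivity
  rw [e1, e2, e3] at h2
  rw [HFun, HFun, h1, h2, mul_div_cancel₀ _ (two_ne_zero)]
  simp only [mul_zpow, cpow_neg_half_zpow, ← Complex.exp_int_mul]
  rw [show -(((α : ℂ) + β) / 2) = -((α : ℂ) / 2) + -((β : ℂ) / 2) by ring, cpow_add _ _ hne, omega]
  have hexp : cexp (α * -(π * I * dedekindSum h k)) *
      cexp (β * -(π * I * dedekindSum (2 * h) k)) *
      cexp (α * (-(π / (12 * ((k : ℂ) ^ 2 * ζ))) + π * ζ / 12)) *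
      cexp (β * (-(π / (12 * ((k : ℂ) ^ 2 * (2 * ζ)))) + π * (2 * ζ) / 12)) =
      cexp (-(π * I * ((α * dedekindSum h k + β * dedekindSum (2 * h) k : ℝ) : ℂ))) *
      cexp ((α + 2 * β) * (π / 12) * ζ - (2 * α + β) * (π / 24) / ((k : ℂ) ^ 2 * ζ)) := by
    simp only [← Complex.exp_add]
    congr 1
    push_cast
    field_simp
    ring
  linear_combination (2 ^ (-((β : ℂ) / 2)) * (k * ζ) ^ (-((α : ℂ) / 2)) *
    (k * ζ) ^ (-((β : ℂ) / 2)) *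
    eulerFun (((2 * g : ℤ) : ℂ) / k + I / ((k : ℂ) ^ 2 * ζ)) ^ α *
    eulerFun ((((2 * g : ℤ) : ℂ) / k + I / ((k : ℂ) ^ 2 * ζ)) / 2) ^ β) * hexp

end

end EtaQuotient

/-! ### The Laplace transform of a power and its inversion. -/

namespace EtaQuotient

noncomputable section

open Complex MeasureTheory Set Filter Topology FourierTransform

theorem integrableOn_rpow_mul_exp {s r : ℝ} (hs : 0 < s) (hr : 0 < r) :
    IntegrableOn (fun x : ℝ => x ^ (s - 1) * Real.exp (-(r * x))) (Ioi 0) := by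
  have := integrableOn_rpow_mul_exp_neg_mul_rpow (p := 1) (s := s - 1) (by linarith) one_pos hr
  simpa using this

/-- The measure with density `x^(s-1)` on the positive half-line. -/
def powerMeasure (s : ℝ) : Measure ℝ :=
  (volume.restrict (Ioi (0 : ℝ))).withDensity fun x => ((Real.toNNReal (x ^ (s - 1)) : NNReal) : ENNReal)

theorem measurable_powerDensity (s : ℝ) : Measurable fun x : ℝ => Real.toNNReal (x ^ (s - 1)) := by
  fun_prop

theorem integral_powerMeasure (s : ℝ) (f : ℝ → ℂ) :
    ∫ x, f x ∂(powerMeasure s) = ∫ x in Ioi (0 : ℝ), ((x ^ (s - 1) : ℝ) : ℂ) * f x := by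
  rw [powerMeasure, integral_withDensity_eq_integral_smul (measurable_powerDensity s)]
  refine setIntegral_congr_fun measurableSet_Ioi fun x hx => ?_
  have : 0 ≤ x ^ (s - 1) := Real.rpow_nonneg (le_of_lt hx) _
  simp [NNReal.smul_def, Real.coe_toNNReal _ this]

theorem integrable_powerMeasure {s : ℝ} (f : ℝ → ℝ)
    (hf : IntegrableOn (fun x => x ^ (s - 1) * f x) (Ioi 0)) : Integrable f (powerMeasure s) := by
  rw [powerMeasure, integrable_withDensity_iff_integrable_smul (measurable_powerDensity s)]
  refine IntegrableOn.congr_fun hf (fun x hx => ?_) measurableSet_Ioi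
  have : 0 ≤ x ^ (s - 1) := Real.rpow_nonneg (le_of_lt hx) _
  simp [NNReal.smul_def, Real.coe_toNNReal _ this]

/-- Both sides are holomorphic on the right half-plane, the left one being the complex moment
generating function of `powerMeasure s`. They agree at real z by Euler's integral, hence everywhere
by the identity theorem. -/
theorem integral_cpow_mul_exp_neg {s : ℝ} (hs : 0 < s) {z : ℂ} (hz : 0 < z.re) :
    ∫ x in Ioi (0 : ℝ), ((x ^ (s - 1) : ℝ) : ℂ) * cexp (-(z * x)) =
      (Real.Gamma s : ℂ) * z ^ (-(s : ℂ)) := by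
  have hmgf : ∀ z : ℂ, ProbabilityTheory.complexMGF id (powerMeasure s) (-z) =
      ∫ x in Ioi (0 : ℝ), ((x ^ (s - 1) : ℝ) : ℂ) * cexp (-(z * x)) := by
    intro z
    rw [ProbabilityTheory.complexMGF, integral_powerMeasure]
    simp
  have hsub : ∀ z : ℂ, 0 < z.re → (-z).re ∈ interior
      (ProbabilityTheory.integrableExpSet id (powerMeasure s)) := by
    intro z hz
    refine mem_interior.2 ⟨Iio 0, fun t ht => ?_, isOpen_Iio, by simpa using hz⟩
    refine integrable_powerMeasure _ ?_
    refine IntegrableOn.congr_fun (integrableOn_rpow_mul_exp hs (neg_pos.2 ht))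
      (fun x _ => ?_) measurableSet_Ioi
    simp
  have hopen : IsOpen {z : ℂ | 0 < z.re} := isOpen_lt continuous_const continuous_re
  have han : AnalyticOnNhd ℂ (fun z : ℂ => ProbabilityTheory.complexMGF id (powerMeasure s) (-z))
      {z : ℂ | 0 < z.re} := by
    refine DifferentiableOn.analyticOnNhd (fun z hz => ?_) hopen
    have h1 := (ProbabilityTheory.hasDerivAt_complexMGF (hsub z hz)).differentiableAt
    exact (DifferentiableAt.comp z h1 differentiableAt_id.neg).differentiableWithinAt
  have han2 : AnalyticOnNhd ℂ (fun z : ℂ => (Real.Gamma s : ℂ) * z ^ (-(s : ℂ)))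
      {z : ℂ | 0 < z.re} := by
    refine DifferentiableOn.analyticOnNhd (fun z hz => ?_) hopen
    refine DifferentiableAt.differentiableWithinAt ?_
    exact (differentiableAt_id.cpow_const (Or.inl hz)).const_mul _
  have hconn : IsPreconnected {z : ℂ | 0 < z.re} :=
    (convex_halfSpace_re_gt 0).isPreconnected
  have hreal : ∀ r : ℝ, 0 < r → ProbabilityTheory.complexMGF id (powerMeasure s) (-(r : ℂ)) =
      (Real.Gamma s : ℂ) * (r : ℂ) ^ (-(s : ℂ)) := by
    intro r hr
    rw [hmgf]
    have := Real.integral_rpow_mul_exp_neg_mul_Ioi hs hr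
    have e : ∀ x : ℝ, ((x ^ (s - 1) : ℝ) : ℂ) * cexp (-(r * x)) =
        ((x ^ (s - 1) * Real.exp (-(r * x)) : ℝ) : ℂ) := by intro x; push_cast; rfl
    simp only [e]
    rw [integral_complex_ofReal, this, one_div, Real.inv_rpow hr.le, ← Real.rpow_neg hr.le]
    push_cast
    rw [ofReal_cpow hr.le]
    push_cast
    ring
  have := AnalyticOnNhd.eqOn_of_preconnected_of_frequently_eq han han2 hconn
    (z₀ := 1) (by simp) ?_ hz
  · simp only [hmgf] at this
    exact this
  -- The identity theorem needs agreement on points accumulating at 1; the real points 1 + 1/(n+1)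
  -- serve.
  · have htend : Tendsto (fun n : ℕ => ((1 + 1 / ((n : ℝ) + 1) : ℝ) : ℂ)) atTop (𝓝[≠] 1) := by
      refine tendsto_nhdsWithin_iff.2 ⟨?_, Eventually.of_forall fun n => ?_⟩
      · have h1 : Tendsto (fun n : ℕ => (1 + 1 / ((n : ℝ) + 1) : ℝ)) atTop (𝓝 (1 + 0)) :=
          tendsto_const_nhds.add tendsto_one_div_add_atTop_nhds_zero_nat
        have h2 := (continuous_ofReal.tendsto _).comp h1
        simpa [Function.comp_def] using h2
      · have : (0 : ℝ) < 1 / ((n : ℝ) + 1) := by positivity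
        simp only [mem_compl_iff, mem_singleton_iff]
        intro h
        have h2 : (1 + 1 / ((n : ℝ) + 1) : ℝ) = 1 := by exact_mod_cast h
        linarith
    exact htend.frequently (Eventually.frequently (Eventually.of_forall fun n =>
      hreal _ (by positivity)))

theorem add_mul_I_ne_zero {σ : ℝ} (hσ : 0 < σ) (t : ℝ) : (σ : ℂ) + t * I ≠ 0 := by
  intro h
  have := congrArg Complex.re h
  simp at this
  exact hσ.ne' this

theorem norm_cpow_neg_line (σ s t : ℝ) :
    ‖((σ : ℂ) + t * I) ^ (-(s : ℂ))‖ = ‖(σ : ℂ) + t * I‖ ^ (-s) := by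
  rw [← ofReal_neg, norm_cpow_real]

theorem continuous_line_cpow {σ : ℝ} (hσ : 0 < σ) (s : ℂ) :
    Continuous fun t : ℝ => ((σ : ℂ) + t * I) ^ s := by
  refine Continuous.cpow (by fun_prop) continuous_const fun t => Or.inl ?_
  simpa using hσ

theorem integrable_norm_line {σ s : ℝ} (hσ : 0 < σ) (hs : 2 ≤ s) :
    Integrable fun t : ℝ => ‖(σ : ℂ) + t * I‖ ^ (-s) := by
  have hcont : Continuous fun t : ℝ => ‖(σ : ℂ) + t * I‖ ^ (-s) := by
    refine Continuous.rpow_const (by fun_prop) fun t => Or.inl ?_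
    exact norm_ne_zero_iff.2 (add_mul_I_ne_zero hσ t)
  refine ((integrable_inv_one_add_sq).const_mul (σ ^ (2 - s) * max 1 (1 / σ ^ 2))).mono'
    hcont.aestronglyMeasurable (Eventually.of_forall fun t => ?_)
  have hn : ‖(σ : ℂ) + t * I‖ ^ 2 = σ ^ 2 + t ^ 2 := by
    rw [← normSq_eq_norm_sq, normSq_apply]; simp; ring
  have hpos : 0 < ‖(σ : ℂ) + t * I‖ := norm_pos_iff.2 (add_mul_I_ne_zero hσ t)
  have hge : σ ≤ ‖(σ : ℂ) + t * I‖ := by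
    refine le_of_sq_le_sq ?_ hpos.le
    rw [hn]; nlinarith [sq_nonneg t]
  rw [Real.norm_of_nonneg (Real.rpow_nonneg (norm_nonneg _) _),
    show -s = (2 - s) + (-2) by ring, Real.rpow_add hpos, mul_assoc]
  refine mul_le_mul (Real.rpow_le_rpow_of_nonpos hσ hge (by linarith)) ?_
    (Real.rpow_nonneg (norm_nonneg _) _) (Real.rpow_nonneg hσ.le _)
  rw [Real.rpow_neg hpos.le, Real.rpow_two, hn, ← div_eq_mul_inv,
    le_div_iff₀ (by positivity), inv_mul_le_iff₀ (by positivity)]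
  have h1 := le_max_left 1 (1 / σ ^ 2)
  have h2 := le_max_right 1 (1 / σ ^ 2)
  rw [div_le_iff₀ (by positivity)] at h2
  nlinarith [sq_nonneg t]

theorem integrable_line_cpow {σ s : ℝ} (hσ : 0 < σ) (hs : 2 ≤ s) :
    Integrable fun t : ℝ => ((σ : ℂ) + t * I) ^ (-(s : ℂ)) := by
  refine (integrable_norm_line hσ hs).mono' (continuous_line_cpow hσ _).aestronglyMeasurable
    (Eventually.of_forall fun t => ?_)
  rw [norm_cpow_neg_line]

/-- The inverse Laplace transform of a power. -/
theorem integral_line_cpow_mul_exp {σ s x : ℝ} (hσ : 0 < σ) (hs : 2 ≤ s) (hx : 0 < x) :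
    ∫ t : ℝ, ((σ : ℂ) + t * I) ^ (-(s : ℂ)) * cexp (x * (σ + t * I)) =
      ((2 * π * (x ^ (s - 1) / Real.Gamma s) : ℝ) : ℂ) := by
  have hs0 : 0 < s := by linarith
  -- The Fourier transform of this function is Γ(s)(σ + 2πiξ)^(-s), integrable since s ≥ 2. Fourier
  -- inversion at the continuity point x, followed by t = 2πξ, gives the formula.
  set g : ℝ → ℂ := fun y => (Ioi (0 : ℝ)).indicator
    (fun y => ((y ^ (s - 1) * Real.exp (-(σ * y)) : ℝ) : ℂ)) y with hg
  have hgint : Integrable g := by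
    rw [hg]
    refine (integrable_indicator_iff measurableSet_Ioi).2 ?_
    exact (integrableOn_rpow_mul_exp hs0 hσ).ofReal
  have hF : ∀ ξ : ℝ, 𝓕 g ξ = (Real.Gamma s : ℂ) * ((σ : ℂ) + ((2 * π * ξ : ℝ) : ℂ) * I) ^
      (-(s : ℂ)) := by
    intro ξ
    rw [Real.fourier_real_eq_integral_exp_smul]
    rw [← integral_cpow_mul_exp_neg hs0 (z := (σ : ℂ) + ((2 * π * ξ : ℝ) : ℂ) * I)
      (by simpa using hσ), ← integral_indicator measurableSet_Ioi]
    refine integral_congr_ae (Eventually.of_forall fun y => ?_)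
    by_cases hy : y ∈ Ioi (0 : ℝ)
    · simp only [hg, indicator_of_mem hy, smul_eq_mul]
      push_cast
      rw [mul_left_comm, ← Complex.exp_add]
      congr 2
      ring
    · simp only [hg, indicator_of_notMem hy, smul_zero]
  have hFint : Integrable (𝓕 g) := by
    have h1 := ((integrable_line_cpow hσ hs).comp_mul_left' (R := 2 * π)
      (by positivity)).const_mul (Real.Gamma s : ℂ)
    refine h1.congr (Eventually.of_forall fun ξ => ?_)
    simp only [hF]
  have hcont : ContinuousAt g x := by
    have h1 : ContinuousAt (fun y : ℝ => ((y ^ (s - 1) * Real.exp (-(σ * y)) : ℝ) : ℂ)) x := by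
      refine continuous_ofReal.continuousAt.comp (ContinuousAt.mul ?_ (by fun_prop))
      exact Real.continuousAt_rpow_const _ _ (Or.inl hx.ne')
    refine h1.congr ?_
    filter_upwards [Ioi_mem_nhds hx] with y hy
    simp only [hg, indicator_of_mem hy]
  have hinv := hgint.fourierInv_fourier_eq hFint hcont
  rw [Real.fourierInv_eq'] at hinv
  have hgx : g x = ((x ^ (s - 1) * Real.exp (-(σ * x)) : ℝ) : ℂ) := by
    simp only [hg, indicator_of_mem (show x ∈ Ioi (0 : ℝ) from hx)]
  rw [hgx] at hinv
  have hΓ : (Real.Gamma s : ℂ) ≠ 0 := by exact_mod_cast (Real.Gamma_pos_of_pos hs0).ne'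
  have hsub := Measure.integral_comp_mul_left (fun t : ℝ => ((σ : ℂ) + t * I) ^ (-(s : ℂ)) *
    cexp (x * (σ + t * I))) (2 * π)
  have e : ∀ ξ : ℝ, cexp ((2 * π * inner ℝ ξ x : ℝ) * I) • 𝓕 g ξ =
      (Real.Gamma s * cexp (-(σ * x))) * (((σ : ℂ) + ((2 * π * ξ : ℝ) : ℂ) * I) ^ (-(s : ℂ)) *
        cexp (x * (σ + ((2 * π * ξ : ℝ) : ℂ) * I))) := by
    intro ξ
    have h1 : cexp ((2 * π * inner ℝ ξ x : ℝ) * I) =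
        cexp (-(σ * x)) * cexp (x * (σ + ((2 * π * ξ : ℝ) : ℂ) * I)) := by
      rw [← Complex.exp_add]
      congr 1
      simp
      ring
    rw [hF, h1, smul_eq_mul]
    ring
  simp only [e] at hinv
  rw [integral_const_mul, hsub, abs_of_pos (by positivity), real_smul] at hinv
  set J := ∫ t : ℝ, ((σ : ℂ) + t * I) ^ (-(s : ℂ)) * cexp (x * (σ + t * I))
  push_cast at hinv ⊢
  have hπ : (π : ℂ) ≠ 0 := by exact_mod_cast Real.pi_ne_zero
  have he := Complex.exp_ne_zero (-(σ * x : ℂ))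
  field_simp at hinv ⊢
  linear_combination hinv

end

end EtaQuotient

/-! ### The Bessel function as an integral over a line and over a segment. -/

namespace EtaQuotient

noncomputable section

open Complex MeasureTheory Set Filter Topology

/-- The integrand `u^(-s) exp(d u + c / u)` of the Bessel function integral. -/
def besselKernel (s c d : ℝ) (u : ℂ) : ℂ := u ^ (-(s : ℂ)) * cexp (d * u + c / u)

/-- The value `2π (d/c)^(v/2) I_v(2√(dc))` of the Bessel function integral. -/
def besselValue (v c d : ℝ) : ℝ :=
  2 * π * (d ^ (v / 2) * c ^ (-(v / 2)) * besselI v (2 * √(d * c)))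

/-- Once √(dc)^v has cancelled c^(-v/2), the m-th term is c^m/m! times 2π times the inverse Laplace
transform of u^(-(v+1+m)) at d, which is the form produced by termwise integration. -/
theorem besselValue_eq {v c d : ℝ} (hc : 0 < c) (hd : 0 < d) :
    besselValue v c d =
      ∑' m : ℕ, c ^ m / (m.factorial : ℝ) * (2 * π * (d ^ (v + m) / Real.Gamma (v + m + 1))) := by
  have hdc : 0 < d * c := mul_pos hd hc
  rw [besselValue, besselI, mul_div_cancel_left₀ _ (two_ne_zero), mul_pow, Real.sq_sqrt hdc.le,
    ← tsum_mul_left, ← tsum_mul_left, ← tsum_mul_left]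
  refine tsum_congr fun m => ?_
  have h1 : √(d * c) ^ v = d ^ (v / 2) * c ^ (v / 2) := by
    rw [Real.sqrt_eq_rpow, ← Real.rpow_mul hdc.le, Real.mul_rpow hd.le hc.le]
    ring_nf
  have h2 : c ^ (-(v / 2)) * c ^ (v / 2) = 1 := by
    rw [← Real.rpow_add hc]; simp
  have h3 : d ^ (v + m) = d ^ (v / 2) * d ^ (v / 2) * d ^ m := by
    rw [Real.rpow_add hd, Real.rpow_natCast, ← Real.rpow_add hd]; ring_nf
  rw [h1, h3, show (2 ^ 2 * (d * c) / 4 : ℝ) = d * c by ring, mul_pow]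
  linear_combination (2 * π * d ^ (v / 2) * d ^ (v / 2) * (d ^ m * c ^ m) /
    ((m.factorial : ℝ) * Real.Gamma (v + m + 1))) * h2

theorem norm_cexp_line (σ d t : ℝ) : ‖cexp (d * (σ + t * I))‖ = Real.exp (d * σ) := by
  rw [Complex.norm_exp]; simp

theorem le_norm_line (σ t : ℝ) : σ ≤ ‖(σ : ℂ) + t * I‖ := by
  have := re_le_norm ((σ : ℂ) + t * I)
  simpa using this

/-- Expand exp(c/u) and invert the Laplace transform of each power. On the line |c/u| ≤ c/σ, so the
norms are dominated by (c/σ)^m/m! and the interchange is legitimate. -/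
theorem integral_line_besselKernel {σ s c d : ℝ} (hσ : 0 < σ) (hs : 2 ≤ s) (hc : 0 < c)
    (hd : 0 < d) :
    ∫ t : ℝ, besselKernel s c d (σ + t * I) = (besselValue (s - 1) c d : ℂ) := by
  set F : ℕ → ℝ → ℂ := fun m t => ((c ^ m / (m.factorial : ℝ) : ℝ) : ℂ) *
    (((σ : ℂ) + t * I) ^ (-((s + m : ℝ) : ℂ)) * cexp (d * (σ + t * I))) with hF
  have hm2 : ∀ m : ℕ, 2 ≤ s + m := fun m => by
    have : (0 : ℝ) ≤ m := Nat.cast_nonneg m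
    linarith
  have hcexp : Continuous fun t : ℝ => cexp (d * ((σ : ℂ) + t * I)) := by fun_prop
  have hnorm : ∀ m t, ‖F m t‖ ≤ (c / σ) ^ m / (m.factorial : ℝ) * Real.exp (d * σ) *
      ‖(σ : ℂ) + t * I‖ ^ (-s) := by
    intro m t
    have hpos : 0 < ‖(σ : ℂ) + t * I‖ := norm_pos_iff.2 (add_mul_I_ne_zero hσ t)
    rw [hF]
    simp only [norm_mul]
    rw [norm_cpow_neg_line, norm_cexp_line, norm_real, Real.norm_of_nonneg (by positivity),
      neg_add, Real.rpow_add hpos, Real.rpow_neg hpos.le (m : ℝ), Real.rpow_natCast]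
    have h1 : (‖(σ : ℂ) + t * I‖ ^ m)⁻¹ ≤ (σ ^ m)⁻¹ := by
      gcongr
      exact le_norm_line σ t
    calc c ^ m / (m.factorial : ℝ) * (‖(σ : ℂ) + t * I‖ ^ (-s) * (‖(σ : ℂ) + t * I‖ ^ m)⁻¹ *
          Real.exp (d * σ)) ≤ c ^ m / (m.factorial : ℝ) * (‖(σ : ℂ) + t * I‖ ^ (-s) * (σ ^ m)⁻¹ *
          Real.exp (d * σ)) := by gcongr
      _ = _ := by rw [div_pow]; field_simp
  have hint : ∀ m, Integrable (F m) := by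
    intro m
    refine ((integrable_norm_line hσ hs).const_mul
      ((c / σ) ^ m / (m.factorial : ℝ) * Real.exp (d * σ))).mono' ?_ (Eventually.of_forall (hnorm m))
    exact (continuous_const.mul ((continuous_line_cpow hσ _).mul hcexp)).aestronglyMeasurable
  have hsum : Summable fun m => ∫ t, ‖F m t‖ := by
    refine Summable.of_nonneg_of_le (fun m => integral_nonneg fun t => norm_nonneg _)
      (fun m => (integral_mono (hint m).norm ((integrable_norm_line hσ hs).const_mul _)
        (hnorm m)).trans_eq (integral_const_mul _ _)) ?_
    exact ((Real.summable_pow_div_factorial (c / σ)).mul_right _).mul_right _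
  have hpt : ∀ t : ℝ, ∑' m, F m t = besselKernel s c d (σ + t * I) := by
    intro t
    have hu := add_mul_I_ne_zero hσ t
    set u : ℂ := (σ : ℂ) + t * I
    have h1 := NormedSpace.expSeries_div_hasSum_exp ((c : ℂ) / u)
    rw [← Complex.exp_eq_exp_ℂ] at h1
    have h2 := (h1.mul_left (u ^ (-(s : ℂ)) * cexp (d * u))).tsum_eq
    rw [besselKernel, Complex.exp_add, ← mul_assoc, ← h2]
    refine tsum_congr fun m => ?_
    change ((c ^ m / (m.factorial : ℝ) : ℝ) : ℂ) *
      (u ^ (-((s + m : ℝ) : ℂ)) * cexp (d * u)) = _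
    push_cast
    rw [neg_add, cpow_add _ _ hu, cpow_neg _ (m : ℂ), cpow_natCast, div_pow]
    field_simp
  have := hasSum_integral_of_summable_integral_norm hint hsum
  simp only [hpt] at this
  rw [← this.tsum_eq, besselValue_eq hc hd, ofReal_tsum]
  refine tsum_congr fun m => ?_
  simp only [hF]
  rw [integral_const_mul, integral_line_cpow_mul_exp hσ (hm2 m) hd, ← ofReal_mul]
  congr 4
  · ring_nf
  · ring_nf

theorem norm_besselKernel_le {σ s c d : ℝ} (hσ : 0 < σ) (hs : 0 ≤ s) (hc : 0 ≤ c) {t : ℝ}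
    (ht : t ≠ 0) :
    ‖besselKernel s c d (σ + t * I)‖ ≤ Real.exp (d * σ + c / σ) * |t| ^ (-s) := by
  have hpos : 0 < ‖(σ : ℂ) + t * I‖ := norm_pos_iff.2 (add_mul_I_ne_zero hσ t)
  have hre : ((d : ℂ) * (σ + t * I) + c / (σ + t * I)).re ≤ d * σ + c / σ := by
    rw [add_re, re_ofReal_mul, div_eq_mul_inv, re_ofReal_mul, inv_re]
    have h1 : normSq ((σ : ℂ) + t * I) = σ ^ 2 + t ^ 2 := by rw [normSq_apply]; simp; ring
    rw [h1]
    have h2 : ((σ : ℂ) + t * I).re = σ := by simp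
    rw [h2, div_eq_mul_inv c σ]
    gcongr
    rw [div_le_iff₀ (by positivity), inv_mul_eq_div, le_div_iff₀ hσ]
    nlinarith [sq_nonneg t]
  have him : |t| ≤ ‖(σ : ℂ) + t * I‖ := by
    have := abs_im_le_norm ((σ : ℂ) + t * I)
    simpa using this
  rw [besselKernel, norm_mul, norm_cpow_neg_line, Complex.norm_exp, mul_comm]
  exact mul_le_mul (Real.exp_le_exp.2 hre)
    (Real.rpow_le_rpow_of_nonpos (abs_pos.2 ht) him (by linarith))
    (Real.rpow_nonneg (norm_nonneg _) _) (Real.exp_pos _).le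

theorem continuous_besselKernel_line {σ : ℝ} (hσ : 0 < σ) (s c d : ℝ) :
    Continuous fun t : ℝ => besselKernel s c d (σ + t * I) := by
  refine (continuous_line_cpow hσ _).mul ?_
  have : ∀ t : ℝ, (σ : ℂ) + t * I ≠ 0 := add_mul_I_ne_zero hσ
  fun_prop (disch := exact this _)

theorem integrable_besselKernel_line {σ s c d : ℝ} (hσ : 0 < σ) (hs : 2 ≤ s) (hc : 0 ≤ c) :
    Integrable fun t : ℝ => besselKernel s c d (σ + t * I) := by
  refine ((integrable_norm_line hσ hs).const_mul (Real.exp (d * σ + c / σ))).mono'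
    (continuous_besselKernel_line hσ s c d).aestronglyMeasurable (Eventually.of_forall fun t => ?_)
  have hpos : 0 < ‖(σ : ℂ) + t * I‖ := norm_pos_iff.2 (add_mul_I_ne_zero hσ t)
  rw [besselKernel, norm_mul, norm_cpow_neg_line, Complex.norm_exp, mul_comm]
  gcongr
  rw [add_re, re_ofReal_mul, div_eq_mul_inv, re_ofReal_mul, inv_re]
  have h1 : normSq ((σ : ℂ) + t * I) = σ ^ 2 + t ^ 2 := by rw [normSq_apply]; simp; ring
  have h2 : ((σ : ℂ) + t * I).re = σ := by simp
  rw [h1, h2, div_eq_mul_inv c σ]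
  gcongr
  rw [div_le_iff₀ (by positivity), inv_mul_eq_div, le_div_iff₀ hσ]
  nlinarith [sq_nonneg t]

theorem norm_integral_line_sub_le {σ s c d T : ℝ} (hσ : 0 < σ) (hs : 2 ≤ s) (hc : 0 ≤ c)
    (hT : 0 < T) :
    ‖(∫ t in (-T)..T, besselKernel s c d (σ + t * I)) - ∫ t : ℝ, besselKernel s c d (σ + t * I)‖ ≤
      2 * Real.exp (d * σ + c / σ) * (T ^ (1 - s) / (s - 1)) := by
  have hint := integrable_besselKernel_line (d := d) hσ hs hc
  have hrpow : IntegrableOn (fun t : ℝ => t ^ (-s)) (Ioi T) :=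
    integrableOn_Ioi_rpow_of_lt (by linarith) hT
  have hval : ∫ t in Ioi T, t ^ (-s) = T ^ (1 - s) / (s - 1) := by
    rw [integral_Ioi_rpow_of_lt (by linarith) hT]
    rw [show -s + 1 = 1 - s by ring, neg_div, ← div_neg]
    ring_nf
  have hright : ‖∫ t in Ioi T, besselKernel s c d (σ + t * I)‖ ≤
      Real.exp (d * σ + c / σ) * (T ^ (1 - s) / (s - 1)) := by
    rw [← hval, ← integral_const_mul]
    refine norm_integral_le_of_norm_le (hrpow.const_mul _) ?_
    refine (ae_restrict_iff' measurableSet_Ioi).2 (Eventually.of_forall fun t ht => ?_)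
    have ht0 : 0 < t := hT.trans ht
    have := norm_besselKernel_le (d := d) hσ (by linarith : 0 ≤ s) hc ht0.ne'
    rwa [abs_of_pos ht0] at this
  have hleft : ‖∫ t in Iic (-T), besselKernel s c d (σ + t * I)‖ ≤
      Real.exp (d * σ + c / σ) * (T ^ (1 - s) / (s - 1)) := by
    have h1 := integral_comp_neg_Ioi T (fun t : ℝ => besselKernel s c d (σ + t * I))
    rw [← h1, ← hval, ← integral_const_mul]
    refine norm_integral_le_of_norm_le (hrpow.const_mul _) ?_
    refine (ae_restrict_iff' measurableSet_Ioi).2 (Eventually.of_forall fun t ht => ?_)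
    have ht0 : 0 < t := hT.trans ht
    have := norm_besselKernel_le (d := d) hσ (by linarith : 0 ≤ s) hc (neg_ne_zero.2 ht0.ne')
    rwa [abs_neg, abs_of_pos ht0] at this
  have h1 := intervalIntegral.integral_Iic_add_Ioi (b := T) hint.integrableOn hint.integrableOn
  have h2 := intervalIntegral.integral_Iic_sub_Iic (a := -T) (b := T)
    hint.integrableOn hint.integrableOn
  rw [← h1, ← h2]
  rw [show ∀ a b e : ℂ, a - b - (a + e) = -(b + e) by intros; ring, norm_neg]
  refine (norm_add_le _ _).trans ?_
  linarith

theorem differentiableAt_besselKernel (s c d : ℝ) {u : ℂ} (hu : 0 < u.re) :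
    DifferentiableAt ℂ (besselKernel s c d) u := by
  have hu0 : u ≠ 0 := by rintro rfl; simp at hu
  unfold besselKernel
  refine DifferentiableAt.mul (differentiableAt_id.cpow_const (Or.inl hu)) ?_
  fun_prop (disch := exact hu0)

/-- The disc touches the imaginary axis only at 0 and lies in the right half-plane, where the
principal power is holomorphic. A primitive there does the work of contour deformation: two paths in
the disc with the same endpoints give the same integral. -/
theorem exists_primitive_besselKernel (s c d : ℝ) (R : ℝ) :
    ∃ G : ℂ → ℂ, ∀ u ∈ Metric.ball (R : ℂ) R, HasDerivAt G (besselKernel s c d u) u := by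
  refine DifferentiableOn.isExactOn_ball fun u hu => ?_
  refine (differentiableAt_besselKernel s c d ?_).differentiableWithinAt
  have h1 := (abs_re_le_norm (u - R)).trans_lt (mem_ball_iff_norm.1 hu)
  rw [sub_re, ofReal_re] at h1
  linarith [(abs_lt.1 h1).1]

theorem mem_ball_of_re_pos {u : ℂ} {R : ℝ} (hR : 0 < R) (h : normSq u < 2 * R * u.re) :
    u ∈ Metric.ball (R : ℂ) R := by
  rw [mem_ball_iff_norm]
  refine lt_of_pow_lt_pow_left₀ 2 hR.le ?_
  rw [← normSq_eq_norm_sq, normSq_sub, normSq_ofReal]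
  simp
  linarith

/-- The integral over a horizontal segment in `τ` becomes an integral over a vertical segment in
the variable `u = 1/ζ`. -/
theorem integral_segment_eq {s c d y φ₀ : ℝ} (hy : 0 < y) (hφ : 0 < φ₀) :
    ∫ φ in (-φ₀)..φ₀, ((y : ℂ) - φ * I) ^ ((s - 2 : ℝ) : ℂ) *
      cexp (c * (y - φ * I) + d / (y - φ * I)) =
    ∫ t in (-(φ₀ / (y ^ 2 + φ₀ ^ 2)))..(φ₀ / (y ^ 2 + φ₀ ^ 2)),
      besselKernel s c d ((y / (y ^ 2 + φ₀ ^ 2) : ℝ) + t * I) := by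
  set σ : ℝ := y / (y ^ 2 + φ₀ ^ 2) with hσ
  set T : ℝ := φ₀ / (y ^ 2 + φ₀ ^ 2) with hT
  have hden : 0 < y ^ 2 + φ₀ ^ 2 := by positivity
  have hσ0 : 0 < σ := by positivity
  -- The disc is |u|² < 2R Re u. The image of the segment satisfies |u|² = Re u / y, while the chord
  -- has Re u = σ and |u|² ≤ σ² + T². The sum of the two requirements puts both paths in the disc.
  set R : ℝ := 1 / y + (σ ^ 2 + T ^ 2) / σ with hR
  have hR0 : 0 < R := by positivity
  obtain ⟨G, hG⟩ := exists_primitive_besselKernel s c d R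
  have hre : ∀ φ : ℝ, ((y : ℂ) - φ * I).re = y := by intro φ; simp
  have hne : ∀ φ : ℝ, (y : ℂ) - φ * I ≠ 0 := by
    intro φ h; have := congrArg Complex.re h; rw [hre] at this; simp at this; exact hy.ne' this
  have hnsq : ∀ φ : ℝ, normSq ((y : ℂ) - φ * I) = y ^ 2 + φ ^ 2 := by
    intro φ; rw [normSq_apply]; simp; ring
  have hinvre : ∀ φ : ℝ, (((y : ℂ) - φ * I)⁻¹).re = y / (y ^ 2 + φ ^ 2) := by
    intro φ; rw [inv_re, hre, hnsq]
  have hmem1 : ∀ φ : ℝ, ((y : ℂ) - φ * I)⁻¹ ∈ Metric.ball (R : ℂ) R := by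
    intro φ
    refine mem_ball_of_re_pos hR0 ?_
    have h0 : 0 < y ^ 2 + φ ^ 2 := by positivity
    rw [map_inv₀, hnsq, hinvre, inv_eq_one_div, ← mul_div_assoc, div_lt_div_iff_of_pos_right h0]
    have : 0 < (σ ^ 2 + T ^ 2) / σ := by positivity
    rw [hR, mul_assoc, add_mul, one_div_mul_cancel hy.ne']
    nlinarith [mul_pos this hy]
  have hmem2 : ∀ t ∈ uIcc (-T) T, (σ : ℂ) + t * I ∈ Metric.ball (R : ℂ) R := by
    intro t ht
    have hT0 : 0 < T := by positivity
    rw [uIcc_of_le (by linarith)] at ht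
    refine mem_ball_of_re_pos hR0 ?_
    have h1 : normSq ((σ : ℂ) + t * I) = σ ^ 2 + t ^ 2 := by rw [normSq_apply]; simp; ring
    have h2 : ((σ : ℂ) + t * I).re = σ := by simp
    have h3 : t ^ 2 ≤ T ^ 2 := sq_le_sq' ht.1 ht.2
    rw [h1, h2, hR, mul_assoc, add_mul, div_mul_cancel₀ _ hσ0.ne']
    have : 0 < 1 / y * σ := by positivity
    nlinarith [sq_nonneg t, sq_nonneg T, pow_pos hσ0 2]
  have hF1 : ∫ φ in (-φ₀)..φ₀, ((y : ℂ) - φ * I) ^ ((s - 2 : ℝ) : ℂ) *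
      cexp (c * (y - φ * I) + d / (y - φ * I)) =
      -I * G (((y : ℂ) - (φ₀ : ℝ) * I)⁻¹) - -I * G (((y : ℂ) - (-φ₀ : ℝ) * I)⁻¹) := by
    refine intervalIntegral.integral_eq_sub_of_hasDerivAt
      (f := fun φ : ℝ => -I * G (((y : ℂ) - φ * I)⁻¹)) (fun φ _ => ?_) ?_
    · have h1 : HasDerivAt (fun φ : ℝ => (y : ℂ) - φ * I) (-I) φ := by
        have := ((hasDerivAt_id (φ : ℂ)).comp_ofReal.mul_const I).const_sub (y : ℂ)
        simpa using this
      have h2 := h1.inv (hne φ)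
      have h3 := ((hG _ (hmem1 φ)).comp φ h2).const_mul (-I)
      refine h3.congr_deriv ?_
      rw [besselKernel, inv_cpow _ _ (by
        have := abs_lt.1 (abs_arg_lt_pi_div_two_iff.2 (Or.inl ((hre φ).symm ▸ hy)))
        linarith [Real.pi_pos]), ← cpow_neg, neg_neg, ofReal_sub, cpow_sub _ _ (hne φ)]
      rw [div_inv_eq_mul, ← div_eq_mul_inv, add_comm ((d : ℂ) / _)]
      push_cast
      rw [cpow_ofNat]
      have := hne φ
      field_simp
      rw [I_sq]
      ring
    · refine Continuous.intervalIntegrable ?_ _ _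
      refine Continuous.mul (Continuous.cpow (by fun_prop) continuous_const fun φ => Or.inl ?_) ?_
      · rw [hre]; exact hy
      · fun_prop (disch := exact hne _)
  have hF2 : ∫ t in (-T)..T, besselKernel s c d (σ + t * I) =
      -I * G ((σ : ℂ) + (T : ℝ) * I) - -I * G ((σ : ℂ) + (-T : ℝ) * I) := by
    refine intervalIntegral.integral_eq_sub_of_hasDerivAt
      (f := fun t : ℝ => -I * G ((σ : ℂ) + t * I)) (fun t ht => ?_) ?_
    · have h1 : HasDerivAt (fun t : ℝ => (σ : ℂ) + t * I) I t := by
        have := ((hasDerivAt_id (t : ℂ)).comp_ofReal.mul_const I).const_add (σ : ℂ)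
        simpa using this
      have h3 := ((hG _ (hmem2 t ht)).comp t h1).const_mul (-I)
      refine h3.congr_deriv ?_
      rw [mul_comm _ I, ← mul_assoc]
      simp
    · exact (continuous_besselKernel_line hσ0 s c d).intervalIntegrable _ _
  have hdC : (y : ℂ) ^ 2 + (φ₀ : ℂ) ^ 2 ≠ 0 := by exact_mod_cast hden.ne'
  have he1 : ((y : ℂ) - (φ₀ : ℝ) * I)⁻¹ = (σ : ℂ) + (T : ℝ) * I := by
    refine inv_eq_of_mul_eq_one_left ?_
    rw [hσ, hT]; push_cast; field_simp; ring_nf; rw [I_sq]; ring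
  have he2 : ((y : ℂ) - (-φ₀ : ℝ) * I)⁻¹ = (σ : ℂ) + (-T : ℝ) * I := by
    refine inv_eq_of_mul_eq_one_left ?_
    rw [hσ, hT]; push_cast; field_simp; ring_nf; rw [I_sq]; ring
  rw [hF1, hF2, he1, he2]

/-- For y = 1/N² and φ₀ = 1/(kN) the vertical line has abscissa σ = k²N²/(k²+N²), between 1/2 and
k², and the chord has half-height T ≥ kN/2. Hence exp(dσ + c/σ) ≤ exp(D + 2c), and the missing tails
are of order (kN)^(1-s). -/
theorem norm_integral_segment_sub_le {s c : ℝ} (hs : 2 ≤ s) (hc : 0 < c) {D : ℝ} (hD : 0 < D)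
    {k N : ℕ} (hk : 0 < k) (hkN : k ≤ N) :
    ‖(∫ φ in (-(1 / ((k : ℝ) * N)))..(1 / ((k : ℝ) * N)),
        (((1 / (N : ℝ) ^ 2 : ℝ) : ℂ) - φ * I) ^ ((s - 2 : ℝ) : ℂ) *
        cexp (c * ((1 / (N : ℝ) ^ 2 : ℝ) - φ * I) +
          (D / (k : ℝ) ^ 2 : ℝ) / ((1 / (N : ℝ) ^ 2 : ℝ) - φ * I))) -
      (besselValue (s - 1) c (D / (k : ℝ) ^ 2) : ℂ)‖ ≤
      2 * Real.exp (D + 2 * c) * (2 ^ (s - 1) / (s - 1)) * ((k : ℝ) * N) ^ (1 - s) := by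
  have hk0 : (0 : ℝ) < k := by exact_mod_cast hk
  have hN0 : (0 : ℝ) < N := by exact_mod_cast hk.trans_le hkN
  have hk1 : (1 : ℝ) ≤ k := by exact_mod_cast hk
  have hkN' : (k : ℝ) ≤ N := by exact_mod_cast hkN
  rw [integral_segment_eq (by positivity) (by positivity)]
  set y : ℝ := 1 / (N : ℝ) ^ 2
  set φ₀ : ℝ := 1 / ((k : ℝ) * N)
  have hσ : y / (y ^ 2 + φ₀ ^ 2) = k ^ 2 * N ^ 2 / (k ^ 2 + N ^ 2) := by
    simp only [y, φ₀]; field_simp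
  have hT : φ₀ / (y ^ 2 + φ₀ ^ 2) = k * N ^ 3 / (k ^ 2 + N ^ 2) := by
    simp only [y, φ₀]; field_simp
  rw [hσ, hT]
  set σ : ℝ := k ^ 2 * N ^ 2 / (k ^ 2 + N ^ 2) with hσdef
  set T : ℝ := k * N ^ 3 / (k ^ 2 + N ^ 2) with hTdef
  have hσ0 : 0 < σ := by positivity
  have hT0 : 0 < T := by positivity
  rw [← integral_line_besselKernel hσ0 hs hc (by positivity : 0 < D / (k : ℝ) ^ 2)]
  refine (norm_integral_line_sub_le hσ0 hs hc.le hT0).trans ?_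
  have hsq : (k : ℝ) ^ 2 ≤ N ^ 2 := by gcongr
  have h1 : D / (k : ℝ) ^ 2 * σ ≤ D := by
    rw [hσdef, div_mul_div_comm, div_le_iff₀ (by positivity)]
    have : 0 < D * ((k : ℝ) ^ 2 * k ^ 2) := by positivity
    nlinarith
  have h2 : c / σ ≤ 2 * c := by
    rw [div_le_iff₀ hσ0]
    have : 1 / 2 ≤ σ := by
      rw [hσdef, div_le_div_iff₀ (by positivity) (by positivity)]
      have hk2 : (1 : ℝ) ≤ k ^ 2 := one_le_pow₀ hk1
      have hN2 : (1 : ℝ) ≤ N ^ 2 := hk2.trans hsq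
      nlinarith
    nlinarith
  have h3 : T ^ (1 - s) ≤ 2 ^ (s - 1) * ((k : ℝ) * N) ^ (1 - s) := by
    have : (k : ℝ) * N / 2 ≤ T := by
      rw [hTdef, div_le_div_iff₀ (by positivity) (by positivity)]
      have : 0 < (k : ℝ) * N := by positivity
      nlinarith [mul_le_mul_of_nonneg_left hsq this.le]
    refine (Real.rpow_le_rpow_of_nonpos (by positivity) this (by linarith)).trans_eq ?_
    rw [Real.div_rpow (by positivity) (by positivity), show s - 1 = -(1 - s) by ring,
      Real.rpow_neg (by positivity)]
    field_simp
  have hs1 : 0 < s - 1 := by linarith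
  calc 2 * Real.exp (D / (k : ℝ) ^ 2 * σ + c / σ) * (T ^ (1 - s) / (s - 1))
      ≤ 2 * Real.exp (D + 2 * c) * (2 ^ (s - 1) * ((k : ℝ) * N) ^ (1 - s) / (s - 1)) := by
        gcongr
    _ = _ := by ring

end

end EtaQuotient

/-! ### Farey arcs and the dissection of a period. -/

namespace EtaQuotient

noncomputable section

open MeasureTheory Set

/-- The Farey arc of order `N` around `h/k`, as a set of displacements from `h/k`. -/
def fareyArc (N : ℕ) (h : ℤ) (k : ℕ) : Set ℝ :=
  {φ | (0 ≤ φ ∧ ∃ d : ℤ, (N : ℤ) - k < d ∧ d ≤ N ∧ (k : ℤ) ∣ h * d + 1 ∧ φ * (k * (k + d)) < 1) ∨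
    (φ < 0 ∧ ∃ d : ℤ, (N : ℤ) - k < d ∧ d ≤ N ∧ (k : ℤ) ∣ h * d - 1 ∧ -φ * (k * (k + d)) ≤ 1)}

/-- `a/b ≤ x < c/d` are consecutive Farey fractions of order `N`. -/
structure FareyNeighbors (N : ℕ) (x : ℝ) (a b c d : ℤ) : Prop where
  hb : 0 < b
  hd : 0 < d
  hbN : b ≤ N
  hdN : d ≤ N
  hbd : N < b + d
  det : b * c - a * d = 1
  left : (a : ℝ) ≤ b * x
  right : (d : ℝ) * x < c

/-- Induction on the order: the neighbours stay consecutive unless their mediant has denominator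
equal to the new order, and then x falls on one side of the mediant. -/
theorem exists_fareyNeighbors (x : ℝ) (N : ℕ) : ∃ a b c d : ℤ, FareyNeighbors (N + 1) x a b c d := by
  induction N with
  | zero =>
    refine ⟨⌊x⌋, 1, ⌊x⌋ + 1, 1, ⟨one_pos, one_pos, by simp, by simp, by simp, by ring, ?_, ?_⟩⟩
    · simpa using Int.floor_le x
    · simp
  | succ N ih =>
    obtain ⟨a, b, c, d, hb, hd, hbN, hdN, hbd, det, left, right⟩ := ih
    push_cast at hbN hdN hbd
    by_cases h1 : (N : ℤ) + 2 < b + d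
    · exact ⟨a, b, c, d, hb, hd, by push_cast; omega, by push_cast; omega, by push_cast; omega,
        det, left, right⟩
    · by_cases h2 : ((b + d : ℤ) : ℝ) * x < (a + c : ℤ)
      · exact ⟨a, b, a + c, b + d, hb, by omega, by push_cast; omega, by push_cast; omega,
          by push_cast; omega, by linear_combination det, left, h2⟩
      · exact ⟨a + c, b + d, c, d, by omega, hd, by push_cast; omega, by push_cast; omega,
          by push_cast; omega, by linear_combination det, not_lt.1 h2, right⟩

/-- Since a/b ≤ x < c'/d', the mixed determinants bc' - ad' and b'c - a'd are at least 1. If a/b and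
a'/b' differed, one of the identities `e1`, `e2` would make a denominator at least b + d or b' + d',
hence larger than N; the right neighbours are treated in the same way. -/
theorem FareyNeighbors.unique {N : ℕ} {x : ℝ} {a b c d a' b' c' d' : ℤ}
    (h : FareyNeighbors N x a b c d) (h' : FareyNeighbors N x a' b' c' d') :
    a = a' ∧ b = b' ∧ c = c' ∧ d = d' := by
  have hcross : ∀ {a b c d a' b' c' d' : ℤ}, FareyNeighbors N x a b c d →
      FareyNeighbors N x a' b' c' d' → 1 ≤ b * c' - a * d' := by
    intro a b c d a' b' c' d' h h'
    have h1 : (a : ℝ) * d' < b * c' := by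
      have hd' : (0 : ℝ) < d' := by exact_mod_cast h'.hd
      have hb : (0 : ℝ) < b := by exact_mod_cast h.hb
      nlinarith [mul_le_mul_of_nonneg_right h.left hd'.le, mul_lt_mul_of_pos_left h'.right hb]
    have h2 : a * d' < b * c' := by exact_mod_cast h1
    omega
  have c1 := hcross h h'
  have c2 := hcross h' h
  have hbpos := h.hb
  have hdpos := h.hd
  have hbpos' := h'.hb
  have hdpos' := h'.hd
  have e1 : b' = b * (b' * c - a' * d) + d * (a' * b - a * b') := by
    linear_combination (-b') * h.det
  have e2 : b = b' * (b * c' - a * d') + d' * (a * b' - a' * b) := by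
    linear_combination (-b) * h'.det
  have e3 : d' = d * (b * c' - a * d') + b * (c * d' - c' * d) := by
    linear_combination (-d') * h.det
  have e4 : d = d' * (b' * c - a' * d) + b' * (c' * d - c * d') := by
    linear_combination (-d) * h'.det
  have p0 : a' * b - a * b' = 0 := by
    rcases lt_trichotomy (a' * b - a * b') 0 with hp | hp | hp
    · have : 1 ≤ a * b' - a' * b := by omega
      have := h.hbN
      have := h'.hbd
      nlinarith
    · exact hp
    · have := h'.hbN
      have := h.hbd
      nlinarith
  have q0 : c * d' - c' * d = 0 := by
    rcases lt_trichotomy (c * d' - c' * d) 0 with hp | hp | hp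
    · have : 1 ≤ c' * d - c * d' := by omega
      have := h.hdN
      have := h'.hbd
      nlinarith
    · exact hp
    · have := h'.hdN
      have := h.hbd
      nlinarith
  have p0' : a * b' - a' * b = 0 := by omega
  have q0' : c' * d - c * d' = 0 := by omega
  rw [p0, mul_zero, add_zero] at e1
  rw [p0', mul_zero, add_zero] at e2
  rw [q0, mul_zero, add_zero] at e3
  rw [q0', mul_zero, add_zero] at e4
  have hbb : b = b' := by nlinarith
  have hdd : d = d' := by nlinarith
  subst hbb hdd
  refine ⟨?_, rfl, ?_, rfl⟩
  · have : (a' - a) * b = 0 := by linear_combination p0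
    rcases mul_eq_zero.1 this with h0 | h0 <;> omega
  · have : (c - c') * d = 0 := by linear_combination q0
    rcases mul_eq_zero.1 this with h0 | h0 <;> omega

/-- The d in the definition of the arc is the denominator of the adjacent Farey fraction: the
congruence fixes its class modulo k and the window (N - k, N] fixes it in the class. The bound on φ
says that x lies on the h/k side of the mediant. -/
theorem fareyNeighbors_of_mem {N : ℕ} {x : ℝ} {h : ℤ} {k : ℕ} (hk : 0 < k) (hkN : k ≤ N)
    (hx : x - h / k ∈ fareyArc N h k) :
    (∃ c d : ℤ, FareyNeighbors N x h k c d ∧ ((k + d : ℤ) : ℝ) * x < (h + c : ℤ)) ∨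
    (∃ a b : ℤ, FareyNeighbors N x a b h k ∧ ((a + h : ℤ) : ℝ) ≤ ((b + k : ℤ) : ℝ) * x) := by
  have hk0 : (0 : ℝ) < k := by exact_mod_cast hk
  rcases hx with ⟨h0, d, hd1, hd2, ⟨c, hc⟩, hlt⟩ | ⟨h0, d, hd1, hd2, ⟨c, hc⟩, hle⟩
  · left
    have hd0 : (0 : ℤ) < d := by omega
    have hd0' : (0 : ℝ) < d := by exact_mod_cast hd0
    have hcR : (h : ℝ) * d + 1 = k * c := by exact_mod_cast hc
    have hmul : (x - h / k) * k = k * x - h := by field_simp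
    have hkey : (k * x - h) * (k + d) < 1 := by rw [← hmul]; linarith
    have hmed : ((k + d : ℤ) : ℝ) * x < (h + c : ℤ) := by
      push_cast
      have : (k : ℝ) * ((k + d) * x) < k * (h + c) := by linarith
      exact lt_of_mul_lt_mul_left this hk0.le
    have hleft : (h : ℝ) ≤ k * x := by
      have := mul_nonneg h0 hk0.le
      rw [hmul] at this
      linarith
    refine ⟨c, d, ⟨by exact_mod_cast hk, hd0, by exact_mod_cast hkN, hd2, by omega,
      by linear_combination -hc, by exact_mod_cast hleft, ?_⟩, hmed⟩
    push_cast at hmed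
    linarith
  · right
    have hd0 : (0 : ℤ) < d := by omega
    have hd0' : (0 : ℝ) < d := by exact_mod_cast hd0
    have hcR : (h : ℝ) * d - 1 = k * c := by exact_mod_cast hc
    have hmul : (x - h / k) * k = k * x - h := by field_simp
    have hkey : (h - k * x) * (k + d) ≤ 1 := by
      have : -(x - h / k) * (k * (k + d)) = (h - k * x) * (k + d) := by
        linear_combination (-(k + d : ℝ)) * hmul
      linarith
    have hmed : ((c + h : ℤ) : ℝ) ≤ ((d + k : ℤ) : ℝ) * x := by
      push_cast
      have : (k : ℝ) * (c + h) ≤ k * ((d + k) * x) := by linarith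
      exact le_of_mul_le_mul_left this hk0
    have hright : (k : ℝ) * x < h := by
      have := mul_neg_of_neg_of_pos h0 hk0
      rw [hmul] at this
      linarith
    refine ⟨c, d, ⟨hd0, by exact_mod_cast hk, hd2, by exact_mod_cast hkN, by omega,
      by linear_combination hc, ?_, by exact_mod_cast hright⟩, hmed⟩
    push_cast at hmed
    linarith

/-- Each x has a unique pair of Farey neighbours, and the mediant decides to which of the two it
belongs. The strict and weak inequalities in `fareyArc` attach the mediant itself to the right
neighbour. -/
theorem existsUnique_fareyArc {N : ℕ} (hN : 0 < N) (x : ℝ) :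
    ∃! p : ℤ × ℕ, (0 < p.2 ∧ p.2 ≤ N) ∧ x - p.1 / p.2 ∈ fareyArc N p.1 p.2 := by
  obtain ⟨M, rfl⟩ : ∃ M, N = M + 1 := ⟨N - 1, by omega⟩
  obtain ⟨a, b, c, d, hn⟩ := exists_fareyNeighbors x M
  have hb := hn.hb
  have hd := hn.hd
  have hbN := hn.hbN
  have hdN := hn.hdN
  have hbd := hn.hbd
  lift b to ℕ using hb.le
  lift d to ℕ using hd.le
  have hb0 : (0 : ℝ) < b := by exact_mod_cast hb
  have hd0 : (0 : ℝ) < d := by exact_mod_cast hd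
  have hdet : (b : ℝ) * c - a * d = 1 := by exact_mod_cast hn.det
  have hleft := hn.left
  have hright := hn.right
  push_cast at hleft hright
  by_cases hm : (((b : ℤ) + d : ℤ) : ℝ) * x < (a + c : ℤ)
  · refine ⟨(a, b), ⟨⟨by exact_mod_cast hb, by exact_mod_cast hbN⟩, Or.inl ⟨?_, d, by omega, hdN,
      ⟨c, by linear_combination -hn.det⟩, ?_⟩⟩, ?_⟩
    · simp only [sub_nonneg]
      rw [div_le_iff₀ hb0]; linarith
    · simp only
      have : (x - a / b) * b = b * x - a := by field_simp
      push_cast at hm ⊢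
      rw [← mul_assoc, this]
      nlinarith
    · rintro ⟨h, k⟩ ⟨⟨hk, hkN⟩, hx⟩
      rcases fareyNeighbors_of_mem hk hkN hx with ⟨c', d', hn', _⟩ | ⟨a', b', hn', hm'⟩
      · obtain ⟨h1, h2, _, _⟩ := hn.unique hn'
        simp only [Prod.mk.injEq]
        exact ⟨h1.symm, by exact_mod_cast h2.symm⟩
      · obtain ⟨h1, h2, h3, h4⟩ := hn.unique hn'
        subst h1 h2 h3
        rw [← h4] at hm'
        linarith
  · refine ⟨(c, d), ⟨⟨by exact_mod_cast hd, by exact_mod_cast hdN⟩, Or.inr ⟨?_, b, by omega, hbN,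
      ⟨a, by linear_combination hn.det⟩, ?_⟩⟩, ?_⟩
    · simp only [sub_neg]
      rw [lt_div_iff₀ hd0]; linarith
    · simp only
      have : (x - c / d) * d = d * x - c := by field_simp
      have h2 : -(x - c / d) * (d * (d + ((b : ℤ) : ℝ))) = -(d * x - c) * (d + b) := by
        rw [← this]; push_cast; ring
      rw [h2]
      push_cast at hm
      nlinarith
    · rintro ⟨h, k⟩ ⟨⟨hk, hkN⟩, hx⟩
      rcases fareyNeighbors_of_mem hk hkN hx with ⟨c', d', hn', hm'⟩ | ⟨a', b', hn', _⟩
      · obtain ⟨h1, h2, h3, h4⟩ := hn.unique hn'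
        subst h1 h3 h4
        rw [← h2] at hm'
        exact absurd hm' hm
      · obtain ⟨_, _, h1, h2⟩ := hn.unique hn'
        simp only [Prod.mk.injEq]
        exact ⟨h1.symm, by exact_mod_cast h2.symm⟩

theorem fareyArc_congr {N k : ℕ} {h g : ℤ} (hg : (k : ℤ) ∣ h - g) :
    fareyArc N h k = fareyArc N g k := by
  have h1 : ∀ d : ℤ, (k : ℤ) ∣ h * d + 1 ↔ (k : ℤ) ∣ g * d + 1 := fun d => by
    rw [show h * d + 1 = (h - g) * d + (g * d + 1) by ring]
    exact dvd_add_right (hg.mul_right d)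
  have h2 : ∀ d : ℤ, (k : ℤ) ∣ h * d - 1 ↔ (k : ℤ) ∣ g * d - 1 := fun d => by
    rw [show h * d - 1 = (h - g) * d + (g * d - 1) by ring]
    exact dvd_add_right (hg.mul_right d)
  simp only [fareyArc, h1, h2]

theorem coprime_of_mem_fareyArc {N k h : ℕ} {φ : ℝ} (hφ : φ ∈ fareyArc N h k) : h.Coprime k := by
  rw [← Nat.isCoprime_iff_coprime]
  rcases hφ with ⟨_, d, _, _, ⟨c, hc⟩, _⟩ | ⟨_, d, _, _, ⟨c, hc⟩, _⟩
  · exact ⟨-d, c, by linear_combination -hc⟩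
  · exact ⟨d, -c, by linear_combination hc⟩

theorem abs_le_of_mem_fareyArc {N k : ℕ} {h : ℤ} {φ : ℝ} (hk : 0 < k) (hkN : k ≤ N)
    (hφ : φ ∈ fareyArc N h k) : |φ| ≤ 1 / ((k : ℝ) * N) := by
  have hk0 : (0 : ℝ) < k := by exact_mod_cast hk
  have hN0 : (0 : ℝ) < N := by exact_mod_cast hk.trans_le hkN
  rw [le_div_iff₀ (by positivity)]
  rcases hφ with ⟨h0, d, hd, _, _, hlt⟩ | ⟨h0, d, hd, _, _, hlt⟩
  · have : (N : ℝ) ≤ k + d := by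
      have : (N : ℤ) ≤ k + d := by omega
      exact_mod_cast this
    rw [abs_of_nonneg h0]
    refine le_trans ?_ hlt.le
    gcongr
  · have : (N : ℝ) ≤ k + d := by
      have : (N : ℤ) ≤ k + d := by omega
      exact_mod_cast this
    rw [abs_of_neg h0]
    refine le_trans ?_ hlt
    have : 0 ≤ -φ := by linarith
    gcongr

theorem exists_dvd_mem_Ioc {k : ℕ} (hk : 0 < k) {h : ℤ} (hc : IsCoprime h k) (e A : ℤ) :
    ∃ d : ℤ, A - k < d ∧ d ≤ A ∧ (k : ℤ) ∣ h * d + e := by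
  obtain ⟨u, v, huv⟩ := hc
  have hk' : (0 : ℤ) < k := by exact_mod_cast hk
  refine ⟨A - (A + e * u) % k, ?_, ?_, ?_⟩
  · have := Int.emod_lt_of_pos (A + e * u) hk'; omega
  · have := Int.emod_nonneg (A + e * u) hk'.ne'; omega
  · have h1 := Int.emod_add_mul_ediv (A + e * u) k
    refine ⟨h * ((A + e * u) / k) + e * v, ?_⟩
    linear_combination (-e) * huv - h * h1

/-- The adjacent denominator d is at most N, so each mediant is at distance 1/(k(k+d)) ≥ 1/(2kN).
Thus every arc contains the core |φ| < 1/(2kN), while `abs_le_of_mem_fareyArc` keeps it within |φ| ≤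
1/(kN). -/
theorem mem_fareyArc_of_abs_lt {N k : ℕ} {h : ℤ} {φ : ℝ} (hk : 0 < k) (hkN : k ≤ N)
    (hc : IsCoprime h k) (hφ : |φ| < 1 / (2 * k * N)) : φ ∈ fareyArc N h k := by
  have hk0 : (0 : ℝ) < k := by exact_mod_cast hk
  have hN0 : (0 : ℝ) < N := by exact_mod_cast hk.trans_le hkN
  have hkN' : (k : ℝ) ≤ N := by exact_mod_cast hkN
  rw [lt_div_iff₀ (by positivity)] at hφ
  rcases lt_or_ge φ 0 with h0 | h0
  · obtain ⟨d, hd1, hd2, hd3⟩ := exists_dvd_mem_Ioc hk hc (-1) N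
    refine Or.inr ⟨h0, d, hd1, hd2, by simpa [sub_eq_add_neg] using hd3, ?_⟩
    have hdN : (d : ℝ) ≤ N := by exact_mod_cast hd2
    rw [abs_of_neg h0] at hφ
    have h0' : 0 ≤ -φ := by linarith
    calc -φ * (k * (k + d)) ≤ -φ * (k * (N + N)) := by gcongr
      _ ≤ 1 := by linarith
  · obtain ⟨d, hd1, hd2, hd3⟩ := exists_dvd_mem_Ioc hk hc 1 N
    refine Or.inl ⟨h0, d, hd1, hd2, hd3, ?_⟩
    have hdN : (d : ℝ) ≤ N := by exact_mod_cast hd2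
    rw [abs_of_nonneg h0] at hφ
    calc φ * (k * (k + d)) ≤ φ * (k * (N + N)) := by gcongr
      _ < 1 := by linarith

theorem measurableSet_fareyArc (N : ℕ) (h : ℤ) (k : ℕ) : MeasurableSet (fareyArc N h k) := by
  have hc : ∀ (P : ℤ → Prop) (Q : ℝ → ℤ → Prop), (∀ d, MeasurableSet {φ | Q φ d}) →
      MeasurableSet {φ | ∃ d, P d ∧ Q φ d} := by
    intro P Q hQ
    have : {φ | ∃ d, P d ∧ Q φ d} = ⋃ d, ⋃ (_ : P d), {φ | Q φ d} := by ext; simp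
    rw [this]
    exact MeasurableSet.iUnion fun d => MeasurableSet.iUnion fun _ => hQ d
  have h1 := hc (fun d => (N : ℤ) - k < d ∧ d ≤ N ∧ (k : ℤ) ∣ h * d + 1)
    (fun φ d => φ * (k * (k + d)) < 1) (fun d => measurableSet_lt (by fun_prop) (by fun_prop))
  have h2 := hc (fun d => (N : ℤ) - k < d ∧ d ≤ N ∧ (k : ℤ) ∣ h * d - 1)
    (fun φ d => -φ * (k * (k + d)) ≤ 1) (fun d => measurableSet_le (by fun_prop) (by fun_prop))
  simp only [and_assoc] at h1 h2
  exact ((measurableSet_le measurable_const measurable_id).inter h1).union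
    ((measurableSet_lt measurable_id measurable_const).inter h2)

/-- The reduced fractions `h/k` in `[0, 1)` of denominator at most `N`. -/
def fareyIndex (N : ℕ) : Finset (Σ _ : ℕ, ℕ) :=
  (Finset.Icc 1 N).sigma fun k => (Finset.range k).filter fun h => h.Coprime k

theorem mem_fareyIndex {N : ℕ} {p : Σ _ : ℕ, ℕ} :
    p ∈ fareyIndex N ↔ (0 < p.1 ∧ p.1 ≤ N) ∧ p.2 < p.1 ∧ p.2.Coprime p.1 := by
  simp [fareyIndex, Nat.one_le_iff_ne_zero, Nat.pos_iff_ne_zero]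

/-- The arcs tile the line, and an arc depends only on h modulo k (`fareyArc_congr`), so those at
fractions in [0, 1) represent ℝ/ℤ exactly once. Using this domain avoids splitting the arc at 0. -/
theorem isAddFundamentalDomain_farey {N : ℕ} (hN : 0 < N) :
    IsAddFundamentalDomain (AddSubgroup.zmultiples (1 : ℝ))
      (⋃ p ∈ fareyIndex N, {x : ℝ | x - p.2 / p.1 ∈ fareyArc N p.2 p.1}) volume := by
  refine IsAddFundamentalDomain.mk' ?_ fun x => ?_
  · refine MeasurableSet.nullMeasurableSet ?_
    exact Finset.measurableSet_biUnion _ fun p _ =>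
      (measurableSet_fareyArc N p.2 p.1).preimage (by fun_prop : Measurable fun x : ℝ => x - p.2 / p.1)
  · obtain ⟨⟨h, k⟩, ⟨⟨hk, hkN⟩, hx⟩, huniq⟩ := existsUnique_fareyArc hN x
    simp only at hk hkN hx huniq
    have hk' : (0 : ℤ) < k := by exact_mod_cast hk
    have hkR : (k : ℝ) ≠ 0 := by positivity
    have hdm := Int.emod_add_mul_ediv h k
    have hmod0 := Int.emod_nonneg h hk'.ne'
    have hmodlt := Int.emod_lt_of_pos h hk'
    obtain ⟨g, hg⟩ := Int.eq_ofNat_of_zero_le hmod0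
    rw [hg] at hdm hmodlt
    have hdmR : (g : ℝ) + k * (h / (k : ℤ) : ℤ) = h := by exact_mod_cast hdm
    have hmem : x + (-(h / (k : ℤ) : ℤ) : ℝ) - g / k ∈ fareyArc N g k := by
      rw [fareyArc_congr (g := h) ⟨-(h / (k : ℤ)), by linear_combination hdm⟩]
      convert hx using 1
      field_simp
      linear_combination -hdmR
    refine ⟨⟨((-(h / (k : ℤ)) : ℤ) : ℝ), AddSubgroup.mem_zmultiples_iff.2 ⟨-(h / (k : ℤ)), by simp⟩⟩, ?_, ?_⟩
    · simp only [AddSubgroup.vadd_def, vadd_eq_add, mem_iUnion]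
      refine ⟨⟨k, g⟩, mem_fareyIndex.2 ⟨⟨hk, hkN⟩, by exact_mod_cast hmodlt,
        coprime_of_mem_fareyArc hmem⟩, ?_⟩
      simp only [mem_ofPred_eq]
      convert hmem using 2
      push_cast
      ring
    · rintro ⟨m, hm⟩ hmS
      obtain ⟨m, rfl⟩ := AddSubgroup.mem_zmultiples_iff.1 hm
      simp only [AddSubgroup.vadd_def, vadd_eq_add, mem_iUnion] at hmS
      obtain ⟨⟨k', g'⟩, hp, hmem'⟩ := hmS
      obtain ⟨⟨hk1, hk2⟩, hlt, _⟩ := mem_fareyIndex.1 hp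
      simp only [mem_ofPred_eq] at hmem' hk1 hk2 hlt
      have hk1R : (k' : ℝ) ≠ 0 := by positivity
      have := huniq ((g' : ℤ) - m * k', k') ⟨⟨hk1, hk2⟩, by
        simp only
        rw [fareyArc_congr (g := (g' : ℤ)) ⟨-m, by ring⟩]
        convert hmem' using 1
        push_cast
        simp
        field_simp
        ring⟩
      simp only [Prod.mk.injEq] at this
      obtain ⟨h1, rfl⟩ := this
      have : h / (k' : ℤ) = -m := by
        rw [← h1, sub_eq_add_neg, ← neg_mul, Int.add_mul_ediv_right _ _ hk'.ne',
          Int.ediv_eq_zero_of_lt (by positivity) (by exact_mod_cast hlt), zero_add]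
      simp [this]

theorem farey_dissection {N : ℕ} (hN : 0 < N) {f : ℝ → ℂ} (hf : Continuous f)
    (hper : Function.Periodic f 1) :
    ∫ x in (0 : ℝ)..1, f x = ∑ k ∈ Finset.Icc 1 N,
      ∑ h ∈ (Finset.range k).filter (fun h => h.Coprime k),
        ∫ φ in fareyArc N h k, f ((h : ℝ) / k + φ) := by
  have hdom := isAddFundamentalDomain_farey hN
  have hIoc := isAddFundamentalDomain_Ioc (T := (1 : ℝ)) one_pos 0
  rw [intervalIntegral.integral_of_le zero_le_one]
  rw [zero_add] at hIoc
  rw [hIoc.setIntegral_eq hdom (f := f)]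
  · rw [integral_biUnion_finset, fareyIndex, Finset.sum_sigma]
    · refine Finset.sum_congr rfl fun k _ => Finset.sum_congr rfl fun h _ => ?_
      have e := (measurePreserving_add_left (volume : Measure ℝ) ((h : ℝ) / k)).setIntegral_preimage_emb
        (measurableEmbedding_addLeft ((h : ℝ) / k)) f {x : ℝ | x - h / k ∈ fareyArc N h k}
      rw [← e]
      congr 2
      ext φ
      simp
    · exact fun p _ => (measurableSet_fareyArc N p.2 p.1).preimage
        (by fun_prop : Measurable fun x : ℝ => x - p.2 / p.1)
    · intro p hp q hq hpq
      refine Set.disjoint_left.2 fun x hx hx' => hpq ?_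
      obtain ⟨r, _, huniq⟩ := existsUnique_fareyArc hN x
      have h1 := huniq ((p.2 : ℤ), p.1) ⟨(mem_fareyIndex.1 hp).1, by simpa using hx⟩
      have h2 := huniq ((q.2 : ℤ), q.1) ⟨(mem_fareyIndex.1 hq).1, by simpa using hx'⟩
      have h3 := h1.trans h2.symm
      simp only [Prod.mk.injEq, Nat.cast_inj] at h3
      obtain ⟨p1, p2⟩ := p
      obtain ⟨q1, q2⟩ := q
      simp_all
    · intro p hp
      obtain ⟨⟨hk1, hk2⟩, _⟩ := mem_fareyIndex.1 hp
      refine (hf.integrableOn_Icc (a := (p.2 : ℝ) / p.1 - 1 / ((p.1 : ℝ) * N))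
        (b := (p.2 : ℝ) / p.1 + 1 / ((p.1 : ℝ) * N))).mono_set fun x hx => ?_
      have := abs_le.1 (abs_le_of_mem_fareyArc hk1 hk2 hx)
      exact ⟨by linarith [this.1], by linarith [this.2]⟩
  · rintro ⟨m, hm⟩ x
    obtain ⟨m, rfl⟩ := AddSubgroup.mem_zmultiples_iff.1 hm
    simp only [AddSubgroup.vadd_def, vadd_eq_add]
    rw [add_comm, (hper.zsmul m) x]

end

end EtaQuotient

/-! ### Arcs at a fixed displacement, and the size of the Bessel values. -/

namespace EtaQuotient

noncomputable section

open Complex MeasureTheory Set Filter Topology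

/-- Applied to the mediant inequality, which is monotone in d, on the window (N - k, N]: the
adjacent denominators whose arc reaches φ form an initial segment. -/
theorem exists_cut (P : ℤ → Prop) (hP : ∀ d e, d ≤ e → P e → P d) (A : ℤ) (n : ℕ) :
    ∃ B, A ≤ B ∧ B ≤ A + n ∧ ∀ d, A < d → d ≤ A + n → (P d ↔ d ≤ B) := by
  induction n with
  | zero => exact ⟨A, le_rfl, by simp, fun d h1 h2 => by simp at h2; omega⟩
  | succ n ih =>
    obtain ⟨B, h1, h2, h3⟩ := ih
    by_cases h : P (A + n + 1)
    · refine ⟨A + n + 1, by omega, by push_cast; omega, fun d hd1 hd2 => ?_⟩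
      push_cast at hd2
      exact ⟨fun _ => by omega, fun hd => hP _ _ hd h⟩
    · refine ⟨B, h1, by push_cast; omega, fun d hd1 hd2 => ?_⟩
      push_cast at hd2
      rcases eq_or_lt_of_le hd2 with rfl | hlt
      · constructor
        · intro hd; exact absurd (by rwa [add_assoc]) h
        · intro hd; omega
      · exact h3 d hd1 (by omega)

/-- For a fixed displacement `φ`, the fractions `h/k` whose Farey arc contains `φ` are those
for which `-1/h` lies in an interval modulo `k`. -/
theorem exists_interval_of_fareyArc (N k : ℕ) (φ : ℝ) :
    ∃ A B : ℤ, A ≤ B ∧ B ≤ A + k ∧ ∀ h : ℤ, φ ∈ fareyArc N h k ↔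
      ∃ d : ℤ, A < d ∧ d ≤ B ∧ (k : ℤ) ∣ h * d + 1 := by
  have hk0 : (0 : ℝ) ≤ k := Nat.cast_nonneg k
  rcases lt_or_ge φ 0 with h0 | h0
  · obtain ⟨B, h1, h2, h3⟩ := exists_cut (fun d : ℤ => -φ * (k * (k + d)) ≤ 1)
      (fun d e hde he => by
        refine le_trans ?_ he
        have : (d : ℝ) ≤ e := by exact_mod_cast hde
        have h0' : 0 ≤ -φ := by linarith
        gcongr) (N - k) k
    -- For φ < 0 the congruence is hd ≡ 1, so -1/h is -d. The interval (N - k, B] reflects to [-B, k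
    -- - N), written half-open on the left as (-B - 1, k - N - 1].
    refine ⟨-B - 1, -(N - k) - 1, by omega, by omega, fun h => ?_⟩
    constructor
    · rintro (⟨h0', _⟩ | ⟨_, d, hd1, hd2, hd3, hd4⟩)
      · linarith
      · refine ⟨-d, ?_, by omega, ?_⟩
        · have := (h3 d hd1 (by omega)).1 hd4; omega
        · rw [show h * -d + 1 = -(h * d - 1) by ring]; exact (dvd_neg).2 hd3
    · rintro ⟨d, hd1, hd2, hd3⟩
      refine Or.inr ⟨h0, -d, by omega, by omega, ?_, (h3 (-d) (by omega) (by omega)).2 (by omega)⟩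
      rw [show h * -d - 1 = -(h * d + 1) by ring]; exact (dvd_neg).2 hd3
  · obtain ⟨B, h1, h2, h3⟩ := exists_cut (fun d : ℤ => φ * (k * (k + d)) < 1)
      (fun d e hde he => by
        refine lt_of_le_of_lt ?_ he
        have : (d : ℝ) ≤ e := by exact_mod_cast hde
        gcongr) (N - k) k
    refine ⟨N - k, B, h1, h2, fun h => ?_⟩
    constructor
    · rintro (⟨_, d, hd1, hd2, hd3, hd4⟩ | ⟨h0', _⟩)
      · exact ⟨d, hd1, (h3 d hd1 (by omega)).1 hd4, hd3⟩
      · linarith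
    · rintro ⟨d, hd1, hd2, hd3⟩
      exact Or.inl ⟨h0, d, hd1, by omega, hd3, (h3 d hd1 (by omega)).2 hd2⟩

/-- The reduced residues modulo `k`, as natural numbers below `k`. -/
def units (k : ℕ) : Finset ℕ := (Finset.range k).filter fun h => h.Coprime k

theorem re_one_div_segment {k : ℕ} (y φ : ℝ) :
    (1 / ((k : ℂ) ^ 2 * (y - φ * I))).re = y / (k ^ 2 * (y ^ 2 + φ ^ 2)) := by
  rw [one_div, inv_re, ← ofReal_natCast, ← ofReal_pow, re_ofReal_mul, map_mul, normSq_ofReal]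
  have h1 : normSq ((y : ℂ) - φ * I) = y ^ 2 + φ ^ 2 := by rw [normSq_apply]; simp; ring
  have h2 : ((y : ℂ) - φ * I).re = y := by simp
  rw [h1, h2]
  by_cases hk : (k : ℝ) = 0
  · simp [hk]
  · rw [mul_assoc, mul_div_mul_left _ _ (by positivity)]

theorem norm_cexp_segment {k : ℕ} (c D y φ : ℝ) :
    ‖cexp (c * (y - φ * I) + D / ((k : ℂ) ^ 2 * (y - φ * I)))‖ =
      Real.exp (c * y + D * (y / (k ^ 2 * (y ^ 2 + φ ^ 2)))) := by
  rw [Complex.norm_exp, add_re, div_eq_mul_one_div (D : ℂ), re_ofReal_mul, re_ofReal_mul,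
    re_one_div_segment]
  simp

theorem norm_segment_le {y φ : ℝ} (hy : 0 ≤ y) : ‖(y : ℂ) - φ * I‖ ≤ y + |φ| := by
  refine (norm_sub_le _ _).trans ?_
  simp [abs_of_nonneg hy]

theorem norm_segment_cpow_le {k N : ℕ} {s φ : ℝ} (hs : 2 ≤ s) (hk : 0 < k) (hkN : k ≤ N)
    (hφ : |φ| ≤ 1 / ((k : ℝ) * N)) :
    ‖((k : ℂ) * ((1 / (N : ℝ) ^ 2 : ℝ) - φ * I)) ^ ((s - 2 : ℝ) : ℂ)‖ ≤
      2 ^ (s - 2) * (N : ℝ) ^ (2 - s) := by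
  have hk0 : (0 : ℝ) < k := by exact_mod_cast hk
  have hN0 : (0 : ℝ) < N := by exact_mod_cast hk.trans_le hkN
  have hkN' : (k : ℝ) ≤ N := by exact_mod_cast hkN
  rw [norm_cpow_real, norm_mul, norm_natCast]
  have h1 : (k : ℝ) * ‖((1 / (N : ℝ) ^ 2 : ℝ) : ℂ) - φ * I‖ ≤ 2 / N := by
    calc (k : ℝ) * ‖((1 / (N : ℝ) ^ 2 : ℝ) : ℂ) - φ * I‖
        ≤ k * (1 / (N : ℝ) ^ 2 + 1 / ((k : ℝ) * N)) := by
          gcongr; exact (norm_segment_le (by positivity)).trans (by gcongr)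
      _ = (k / N) / N + 1 / N := by field_simp
      _ ≤ 1 / N + 1 / N := by gcongr; exact (div_le_one hN0).2 hkN'
      _ = 2 / N := by ring
  refine (Real.rpow_le_rpow (by positivity) h1 (by linarith)).trans_eq ?_
  rw [Real.div_rpow (by norm_num) hN0.le, show 2 - s = -(s - 2) by ring, Real.rpow_neg hN0.le,
    div_eq_mul_inv]

/-- No Bessel asymptotics are used: compare with the segment integral at N = k. The segment has
length 2/k² and the integrand is at most (2/k²)^(s-2) exp(c+D), so both this integral and the
comparison error are O(k^(2-2s)). -/
theorem norm_besselValue_le {s c : ℝ} (hs : 2 ≤ s) (hc : 0 < c) {D : ℝ} (hD : 0 < D) {k : ℕ}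
    (hk : 0 < k) :
    |besselValue (s - 1) c (D / (k : ℝ) ^ 2)| ≤
      (2 * Real.exp (D + 2 * c) * (2 ^ (s - 1) / (s - 1)) + 2 * 2 ^ (s - 2) * Real.exp (c + D)) *
        (k : ℝ) ^ (2 - 2 * s) := by
  have hk0 : (0 : ℝ) < k := by exact_mod_cast hk
  have hk1 : (1 : ℝ) ≤ k := by exact_mod_cast hk
  have h1 := norm_integral_segment_sub_le hs hc hD hk le_rfl
  set Jint := ∫ φ in (-(1 / ((k : ℝ) * k)))..(1 / ((k : ℝ) * k)),
        (((1 / (k : ℝ) ^ 2 : ℝ) : ℂ) - φ * I) ^ ((s - 2 : ℝ) : ℂ) *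
        cexp (c * ((1 / (k : ℝ) ^ 2 : ℝ) - φ * I) +
          (D / (k : ℝ) ^ 2 : ℝ) / ((1 / (k : ℝ) ^ 2 : ℝ) - φ * I)) with hJ
  have hkk : ((k : ℝ) * k) ^ (1 - s) = (k : ℝ) ^ (2 - 2 * s) := by
    rw [← sq, ← Real.rpow_natCast, ← Real.rpow_mul hk0.le]
    congr 1; push_cast; ring
  have h2 : ‖Jint‖ ≤ 2 * 2 ^ (s - 2) * Real.exp (c + D) * (k : ℝ) ^ (2 - 2 * s) := by
    have hle : -(1 / ((k : ℝ) * k)) ≤ 1 / ((k : ℝ) * k) := by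
      have : 0 < 1 / ((k : ℝ) * k) := by positivity
      linarith
    have hb := intervalIntegral.norm_integral_le_of_norm_le_const
      (a := -(1 / ((k : ℝ) * k))) (b := 1 / ((k : ℝ) * k))
      (f := fun φ : ℝ => (((1 / (k : ℝ) ^ 2 : ℝ) : ℂ) - φ * I) ^ ((s - 2 : ℝ) : ℂ) *
        cexp (c * ((1 / (k : ℝ) ^ 2 : ℝ) - φ * I) +
          (D / (k : ℝ) ^ 2 : ℝ) / ((1 / (k : ℝ) ^ 2 : ℝ) - φ * I)))
      (C := (2 / (k : ℝ) ^ 2) ^ (s - 2) * Real.exp (c + D)) (fun φ hφ => ?_)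
    · refine hb.trans_eq ?_
      rw [show (1 / ((k : ℝ) * k) - -(1 / ((k : ℝ) * k))) = 2 * ((k : ℝ) ^ 2)⁻¹ by field_simp; ring,
        abs_of_pos (by positivity), Real.div_rpow (by norm_num) (by positivity),
        ← Real.rpow_natCast, ← Real.rpow_mul hk0.le, ← Real.rpow_neg hk0.le, div_eq_mul_inv,
        ← Real.rpow_neg hk0.le]
      have : (k : ℝ) ^ (2 - 2 * s) = (k : ℝ) ^ (-((2 : ℕ) * (s - 2))) * (k : ℝ) ^ (-((2 : ℕ) : ℝ)) := by
        rw [← Real.rpow_add hk0]; congr 1; push_cast; ring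
      rw [this]; ring
    · rw [uIoc_of_le hle] at hφ
      have habs : |φ| ≤ 1 / ((k : ℝ) * k) := abs_le.2 ⟨hφ.1.le, hφ.2⟩
      rw [norm_mul, norm_cpow_real]
      refine mul_le_mul ?_ ?_ (norm_nonneg _) (by positivity)
      · refine Real.rpow_le_rpow (norm_nonneg _) ?_ (by linarith)
        refine (norm_segment_le (by positivity)).trans ?_
        rw [sq, show (2 : ℝ) / (k * k) = 1 / (k * k) + 1 / (k * k) by ring]
        gcongr
      · have := norm_cexp_segment (k := 1) c (D / (k : ℝ) ^ 2) (1 / (k : ℝ) ^ 2) φ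
        simp only [Nat.cast_one, one_pow, one_mul] at this
        rw [this]
        refine Real.exp_le_exp.2 (add_le_add ?_ ?_)
        · have : 1 / (k : ℝ) ^ 2 ≤ 1 := by
            rw [div_le_one (by positivity)]; exact one_le_pow₀ hk1
          nlinarith
        · have h3 : 1 / (k : ℝ) ^ 2 / ((1 / (k : ℝ) ^ 2) ^ 2 + φ ^ 2) ≤ (k : ℝ) ^ 2 := by
            rw [div_le_iff₀ (by positivity), mul_add]
            have : (k : ℝ) ^ 2 * (1 / (k : ℝ) ^ 2) ^ 2 = 1 / (k : ℝ) ^ 2 := by field_simp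
            rw [this]
            have : 0 ≤ (k : ℝ) ^ 2 * φ ^ 2 := by positivity
            linarith
          calc D / (k : ℝ) ^ 2 * _ ≤ D / (k : ℝ) ^ 2 * (k : ℝ) ^ 2 := by gcongr
            _ = D := by field_simp
  have h3 : ‖(besselValue (s - 1) c (D / (k : ℝ) ^ 2) : ℂ)‖ ≤
      ‖Jint - (besselValue (s - 1) c (D / (k : ℝ) ^ 2) : ℂ)‖ + ‖Jint‖ := by
    have := norm_sub_le Jint (Jint - (besselValue (s - 1) c (D / (k : ℝ) ^ 2) : ℂ))
    rw [sub_sub_cancel] at this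
    linarith
  rw [norm_real, Real.norm_eq_abs] at h3
  rw [hkk] at h1
  linarith

end

end EtaQuotient

/-! ### Summing over h first: the pointwise error on the arcs. -/

namespace EtaQuotient

noncomputable section

open Complex MeasureTheory Set Filter Topology

/-- The integrand attached to the term of index `j` of the expansion at a cusp of denominator
`k`, as a function of the displacement `φ` along the segment of height `1/N²`. -/
def cuspIntegrand (s c : ℝ) (k N : ℕ) (D : ℝ) (φ : ℝ) : ℂ :=
  ((k : ℂ) * ((1 / (N : ℝ) ^ 2 : ℝ) - φ * I)) ^ ((s - 2 : ℝ) : ℂ) *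
    cexp (c * ((1 / (N : ℝ) ^ 2 : ℝ) - φ * I) +
      D / ((k : ℂ) ^ 2 * ((1 / (N : ℝ) ^ 2 : ℝ) - φ * I)))

open Classical in
/-- The `h` among the reduced residues modulo `k` for which `-1/h` lies in `(A, B]` modulo `k`. -/
def unitsIn (k : ℕ) (A B : ℤ) : Finset ℕ :=
  (units k).filter fun h => ∃ d : ℤ, A < d ∧ d ≤ B ∧ (k : ℤ) ∣ h * d + 1

section pointwise

variable {s c : ℝ} {k N : ℕ}

theorem norm_cuspIntegrand_le (hs : 2 ≤ s) (hc : 0 < c) (hk : 0 < k) (hkN : k ≤ N) {φ : ℝ}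
    (hφ : |φ| ≤ 1 / ((k : ℝ) * N)) {D R : ℝ}
    (hR : D * ((1 / (N : ℝ) ^ 2) / (k ^ 2 * ((1 / (N : ℝ) ^ 2) ^ 2 + φ ^ 2))) ≤ R) :
    ‖cuspIntegrand s c k N D φ‖ ≤ 2 ^ (s - 2) * (N : ℝ) ^ (2 - s) * Real.exp (c + R) := by
  have hN1 : (1 : ℝ) ≤ N := by exact_mod_cast hk.trans_le hkN
  rw [cuspIntegrand, norm_mul, norm_cexp_segment]
  refine mul_le_mul (norm_segment_cpow_le hs hk hkN hφ) (Real.exp_le_exp.2 ?_)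
    (Real.exp_pos _).le (by positivity)
  have : 1 / (N : ℝ) ^ 2 ≤ 1 := by
    rw [div_le_one (by positivity)]; exact one_le_pow₀ hN1
  nlinarith

/-- The right side is Re(1/(k²ζ)). The lower bound holds on every arc and makes the terms with D ≤ 0
decay at least like exp(D/2). -/
theorem half_le_re (hk : 0 < k) (hkN : k ≤ N) {φ : ℝ} (hφ : |φ| ≤ 1 / ((k : ℝ) * N)) :
    1 / 2 ≤ (1 / (N : ℝ) ^ 2) / (k ^ 2 * ((1 / (N : ℝ) ^ 2) ^ 2 + φ ^ 2)) := by
  have hk0 : (0 : ℝ) < k := by exact_mod_cast hk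
  have hN0 : (0 : ℝ) < N := by exact_mod_cast hk.trans_le hkN
  have hkN' : (k : ℝ) ≤ N := by exact_mod_cast hkN
  rw [le_div_iff₀ (by positivity)]
  have h1 : φ ^ 2 ≤ (1 / ((k : ℝ) * N)) ^ 2 := sq_le_sq.2 (hφ.trans (le_abs_self _))
  have h2 : (k : ℝ) ^ 2 * (1 / (N : ℝ) ^ 2) ^ 2 ≤ 1 / (N : ℝ) ^ 2 := by
    calc (k : ℝ) ^ 2 * (1 / (N : ℝ) ^ 2) ^ 2 ≤ (N : ℝ) ^ 2 * (1 / (N : ℝ) ^ 2) ^ 2 := by gcongr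
      _ = _ := by field_simp
  have h3 : (k : ℝ) ^ 2 * φ ^ 2 ≤ 1 / (N : ℝ) ^ 2 := by
    calc (k : ℝ) ^ 2 * φ ^ 2 ≤ (k : ℝ) ^ 2 * (1 / ((k : ℝ) * N)) ^ 2 := by gcongr
      _ = _ := by field_simp
  linarith

/-- Away from the core of the arc, Re(1/(k²ζ)) is bounded, so even the polar terms are bounded
there. -/
theorem re_le_four (hk : 0 < k) (hkN : k ≤ N) {φ : ℝ} (hφ : 1 / (2 * (k : ℝ) * N) ≤ |φ|) :
    (1 / (N : ℝ) ^ 2) / (k ^ 2 * ((1 / (N : ℝ) ^ 2) ^ 2 + φ ^ 2)) ≤ 4 := by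
  have hk0 : (0 : ℝ) < k := by exact_mod_cast hk
  have hN0 : (0 : ℝ) < N := by exact_mod_cast hk.trans_le hkN
  rw [div_le_iff₀ (by positivity)]
  have h1 : (1 / (2 * (k : ℝ) * N)) ^ 2 ≤ φ ^ 2 :=
    sq_le_sq.2 ((le_of_eq (abs_of_pos (by positivity))).trans hφ)
  have h3 : 1 / (N : ℝ) ^ 2 ≤ 4 * ((k : ℝ) ^ 2 * φ ^ 2) := by
    calc 1 / (N : ℝ) ^ 2 = 4 * ((k : ℝ) ^ 2 * (1 / (2 * (k : ℝ) * N)) ^ 2) := by field_simp; norm_num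
      _ ≤ _ := by gcongr
  have h4 : 0 ≤ (k : ℝ) ^ 2 * (1 / (N : ℝ) ^ 2) ^ 2 := by positivity
  linarith

theorem mem_units {h : ℕ} : h ∈ units k ↔ h < k ∧ h.Coprime k := by simp [units]

/-- Full sums over the reduced residues are particular incomplete sums. -/
theorem norm_sum_units_le (hk : 0 < k) (θ : ℕ → ℂ) {W : ℝ}
    (hW : ∀ A B : ℤ, A ≤ B → B ≤ A + k →
      ‖∑ h ∈ unitsIn k A B, θ h‖ ≤ W) :
    ‖∑ h ∈ units k, θ h‖ ≤ W := by
  have := hW 0 k (by omega) (by omega)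
  have he : unitsIn k 0 k = units k := by
    classical
    unfold unitsIn
    refine Finset.filter_true_of_mem fun h hh => ?_
    obtain ⟨d, h1, h2, h3⟩ := exists_dvd_mem_Ioc hk
      (Nat.isCoprime_iff_coprime.2 (mem_units.1 hh).2) 1 (k : ℤ)
    exact ⟨d, by omega, h2, h3⟩
  rwa [he] at this

variable {J : ℕ} {D : ℕ → ℝ} {b : ℕ → ℂ} {θ : ℕ → ℕ → ℂ} {Dmax M W : ℝ}

-- Exchange the sums over h and j at fixed φ. For a polar j there are two cases: on the core |φ| <
-- 1/(2kN) all arcs contain φ and the difference is zero, while outside it the integrand is bounded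
-- and the incomplete and the complete sum are each at most W. For the other j only the incomplete
-- sum occurs, and the decay exp(D_j/2) makes the series converge.
open Classical in
theorem norm_arcSum_sub_le (hs : 2 ≤ s) (hc : 0 < c) (hk : 0 < k) (hkN : k ≤ N)
    (hJ : ∀ j, j < J ↔ 0 < D j) (hDmax : ∀ j, D j ≤ Dmax)
    (hb : Summable fun j => ‖b j‖ * Real.exp (D j / 2))
    (hM : ∑' j, ‖b j‖ * Real.exp (D j / 2) ≤ M)
    (hW : ∀ (j : ℕ) (A B : ℤ), A ≤ B → B ≤ A + k →
      ‖∑ h ∈ unitsIn k A B, θ h j‖ ≤ W)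
    {F : ℕ → ℂ} {φ : ℝ} (hφ : |φ| ≤ 1 / ((k : ℝ) * N))
    (hF : ∀ h ∈ units k, HasSum (fun j => θ h j * (b j * cuspIntegrand s c k N (D j) φ)) (F h)) :
    ‖(∑ h ∈ units k, if φ ∈ fareyArc N h k then F h else 0) -
      ∑ j ∈ Finset.range J, (∑ h ∈ units k, θ h j) * (b j * cuspIntegrand s c k N (D j) φ)‖ ≤
      2 * W * (2 ^ (s - 2) * (N : ℝ) ^ (2 - s) * Real.exp (c + 4 * |Dmax|)) * M := by
  have hW0 : 0 ≤ W := (norm_nonneg _).trans (hW 0 0 0 le_rfl (by simp))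
  set g : ℕ → ℂ := fun j => b j * cuspIntegrand s c k N (D j) φ with hg
  obtain ⟨A, B, hAB, hBA, hint⟩ := exists_interval_of_fareyArc N k φ
  have hWφ : ∀ j, ‖∑ h ∈ (units k).filter (fun h : ℕ => φ ∈ fareyArc N h k), θ h j‖ ≤ W := by
    intro j
    have := hW j A B hAB hBA
    rwa [unitsIn, Finset.filter_congr (q := fun h : ℕ => φ ∈ fareyArc N h k)
      (fun h _ => (hint h).symm)] at this
  have hfull : ∀ j, ‖∑ h ∈ units k, θ h j‖ ≤ W := fun j => norm_sum_units_le hk _ (hW j)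
  have h1 : HasSum (fun j => (∑ h ∈ (units k).filter (fun h : ℕ => φ ∈ fareyArc N h k), θ h j) * g j)
      (∑ h ∈ units k, if φ ∈ fareyArc N h k then F h else 0) := by
    rw [← Finset.sum_filter]
    simp_rw [Finset.sum_mul]
    exact hasSum_sum fun h hh => hF h (Finset.mem_filter.1 hh).1
  have h2 : HasSum (fun j => if j < J then (∑ h ∈ units k, θ h j) * g j else 0)
      (∑ j ∈ Finset.range J, (∑ h ∈ units k, θ h j) * g j) := by
    have := hasSum_sum_of_ne_finset_zero (f := fun j => if j < J then (∑ h ∈ units k, θ h j) * g j else 0)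
      (s := Finset.range J) (L := SummationFilter.unconditional ℕ)
      (fun j hj => if_neg (by simpa using hj))
    convert this using 1
    exact Finset.sum_congr rfl fun j hj => (if_pos (Finset.mem_range.1 hj)).symm
  set C := 2 ^ (s - 2) * (N : ℝ) ^ (2 - s) * Real.exp (c + 4 * |Dmax|) with hC
  have hC0 : 0 ≤ C := by positivity
  have hterm : ∀ j, ‖(∑ h ∈ (units k).filter (fun h : ℕ => φ ∈ fareyArc N h k), θ h j) * g j -
      (if j < J then (∑ h ∈ units k, θ h j) * g j else 0)‖ ≤
      2 * W * C * (‖b j‖ * Real.exp (D j / 2)) := by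
    intro j
    by_cases hj : j < J
    · rw [if_pos hj, ← sub_mul]
      have hD := (hJ j).1 hj
      have hDm : 0 < Dmax := hD.trans_le (hDmax j)
      rcases lt_or_ge |φ| (1 / (2 * (k : ℝ) * N)) with hlt | hge
      · rw [Finset.filter_true_of_mem, sub_self, zero_mul, norm_zero]
        · positivity
        · intro h hh
          exact mem_fareyArc_of_abs_lt hk hkN (Nat.isCoprime_iff_coprime.2 (mem_units.1 hh).2) hlt
      · have hr := re_le_four hk hkN hge
        have hn : ‖cuspIntegrand s c k N (D j) φ‖ ≤ C := by
          refine norm_cuspIntegrand_le hs hc hk hkN hφ ?_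
          rw [abs_of_pos hDm, mul_comm 4]
          exact mul_le_mul (hDmax j) hr (by positivity) hDm.le
        rw [norm_mul]
        calc _ ≤ (2 * W) * (‖b j‖ * C) := by
              refine mul_le_mul ?_ ?_ (norm_nonneg _) (by positivity)
              · exact (norm_sub_le _ _).trans (by linarith [hWφ j, hfull j])
              · rw [hg, norm_mul]; gcongr
          _ = 2 * W * C * (‖b j‖ * 1) := by ring
          _ ≤ _ := by
              gcongr
              exact Real.one_le_exp (by linarith)
    · rw [if_neg hj, sub_zero, norm_mul]
      have hD : D j ≤ 0 := not_lt.1 fun h => hj ((hJ j).2 h)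
      have hr := half_le_re hk hkN hφ
      have hn : ‖cuspIntegrand s c k N (D j) φ‖ ≤ C * Real.exp (D j / 2) := by
        refine (norm_cuspIntegrand_le hs hc hk hkN hφ (R := D j / 2) (by nlinarith)).trans ?_
        rw [hC, mul_assoc (2 ^ (s - 2) * (N : ℝ) ^ (2 - s)), ← Real.exp_add]
        gcongr
        linarith [abs_nonneg Dmax]
      calc _ ≤ W * (‖b j‖ * (C * Real.exp (D j / 2))) := by
            refine mul_le_mul (hWφ j) ?_ (norm_nonneg _) hW0
            rw [hg, norm_mul]; gcongr
        _ ≤ (2 * W) * (‖b j‖ * (C * Real.exp (D j / 2))) := by gcongr; linarith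
        _ = _ := by ring
  have h3 := (h1.sub h2).norm_le_of_bounded (hb.hasSum.mul_left (2 * W * C)) hterm
  refine h3.trans ?_
  gcongr

end pointwise

end

end EtaQuotient

/-! ### The circle method for general multipliers. -/

namespace EtaQuotient

noncomputable section

open Complex MeasureTheory Set Filter Topology

theorem continuous_cuspIntegrand {s c : ℝ} {k N : ℕ} (hk : 0 < k) (hN : 0 < N) (D : ℝ) :
    Continuous (cuspIntegrand s c k N D) := by
  have hk0 : (0 : ℝ) < k := by exact_mod_cast hk
  have hN0 : (0 : ℝ) < N := by exact_mod_cast hN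
  have hkc : (k : ℂ) ≠ 0 := by exact_mod_cast hk.ne'
  have hre : ∀ φ : ℝ, 0 < (((1 / (N : ℝ) ^ 2 : ℝ) : ℂ) - φ * I).re := fun φ => by
    simp only [sub_re, ofReal_re, mul_re, I_re, mul_zero, ofReal_im, I_im, zero_mul, sub_zero]
    positivity
  have hne : ∀ φ : ℝ, ((1 / (N : ℝ) ^ 2 : ℝ) : ℂ) - φ * I ≠ 0 := fun φ h => by
    have := hre φ; rw [h] at this; simp at this
  unfold cuspIntegrand
  refine Continuous.mul ?_ (Complex.continuous_exp.comp (Continuous.add (by fun_prop) ?_))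
  · refine Continuous.cpow (by fun_prop) continuous_const fun φ => Or.inl ?_
    rw [← ofReal_natCast, re_ofReal_mul]
    exact mul_pos hk0 (hre φ)
  · exact Continuous.div continuous_const (by fun_prop) fun φ =>
      mul_ne_zero (pow_ne_zero _ hkc) (hne φ)

theorem cuspIntegrand_eq {s c : ℝ} {k N : ℕ} (hk : 0 < k) (hN : 0 < N) (D φ : ℝ) :
    cuspIntegrand s c k N D φ = ((k : ℝ) ^ (s - 2) : ℝ) *
      ((((1 / (N : ℝ) ^ 2 : ℝ) : ℂ) - φ * I) ^ ((s - 2 : ℝ) : ℂ) *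
        cexp (c * ((1 / (N : ℝ) ^ 2 : ℝ) - φ * I) +
          (D / (k : ℝ) ^ 2 : ℝ) / ((1 / (N : ℝ) ^ 2 : ℝ) - φ * I))) := by
  have hk0 : (0 : ℝ) < k := by exact_mod_cast hk
  have hN0 : (0 : ℝ) < N := by exact_mod_cast hN
  have hre : 0 < (((1 / (N : ℝ) ^ 2 : ℝ) : ℂ) - φ * I).re := by
    simp only [sub_re, ofReal_re, mul_re, I_re, mul_zero, ofReal_im, I_im, zero_mul, sub_zero]
    positivity
  rw [cuspIntegrand, mul_cpow_of_re_pos (by simpa using hk) hre, ofReal_cpow hk0.le, ofReal_natCast,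
    mul_assoc, ofReal_div D, ofReal_pow (k : ℝ), ofReal_natCast, div_div]

/-- The contribution of the cusps of denominator `k` to the exact formula. -/
def cuspTerm (s c : ℝ) (k J : ℕ) (D : ℕ → ℝ) (b : ℕ → ℂ) (θ : ℕ → ℕ → ℂ) : ℂ :=
  ∑ j ∈ Finset.range J, (∑ h ∈ units k, θ h j) * (b j * (((k : ℝ) ^ (s - 2) *
    besselValue (s - 1) c (D j / (k : ℝ) ^ 2) : ℝ) : ℂ))

section

variable {s c : ℝ} {k N : ℕ} {J : ℕ} {D : ℕ → ℝ} {b : ℕ → ℂ} {θ : ℕ → ℕ → ℂ} {Dmax M W : ℝ}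

theorem sum_range_norm_le (hJ : ∀ j, j < J ↔ 0 < D j)
    (hb : Summable fun j => ‖b j‖ * Real.exp (D j / 2))
    (hM : ∑' j, ‖b j‖ * Real.exp (D j / 2) ≤ M) : ∑ j ∈ Finset.range J, ‖b j‖ ≤ M := by
  refine le_trans (Finset.sum_le_sum fun j hj => ?_)
    ((hb.sum_le_tsum (Finset.range J) fun j _ => by positivity).trans hM)
  have := (hJ j).1 (Finset.mem_range.1 hj)
  exact le_mul_of_one_le_right (norm_nonneg _) (Real.one_le_exp (by linarith))

/-- The factor k^(s-2) and the bound k^(2-2s) for the Bessel value combine to k^(-s), the weight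
against which W must be summable. -/
theorem norm_polarTerm_le (hs : 2 ≤ s) (hc : 0 < c) (hk : 0 < k) {D : ℝ} (hD : 0 < D)
    (hDmax : D ≤ Dmax) {z b : ℂ} (hz : ‖z‖ ≤ W) :
    ‖z * (b * (((k : ℝ) ^ (s - 2) * besselValue (s - 1) c (D / (k : ℝ) ^ 2) : ℝ) : ℂ))‖ ≤
      (2 * Real.exp (Dmax + 2 * c) * (2 ^ (s - 1) / (s - 1)) +
      2 * 2 ^ (s - 2) * Real.exp (c + Dmax)) * (W * (k : ℝ) ^ (-s)) * ‖b‖ := by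
  have hk0 : (0 : ℝ) < k := by exact_mod_cast hk
  have hW0 : 0 ≤ W := (norm_nonneg _).trans hz
  have hs1 : 0 < s - 1 := by linarith
  set C := 2 * Real.exp (Dmax + 2 * c) * (2 ^ (s - 1) / (s - 1)) +
      2 * 2 ^ (s - 2) * Real.exp (c + Dmax) with hC
  have hC0 : 0 ≤ C := by positivity
  have hB := norm_besselValue_le hs hc hD hk
  have hB' : |besselValue (s - 1) c (D / (k : ℝ) ^ 2)| ≤ C * (k : ℝ) ^ (2 - 2 * s) := by
    refine hB.trans ?_
    rw [hC]
    gcongr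
  rw [norm_mul, norm_mul, norm_real, norm_mul,
    Real.norm_of_nonneg (by positivity : (0:ℝ) ≤ (k : ℝ) ^ (s - 2)), Real.norm_eq_abs]
  calc _ ≤ W * (‖b‖ * ((k : ℝ) ^ (s - 2) * (C * (k : ℝ) ^ (2 - 2 * s)))) := by gcongr
    _ = C * (W * ((k : ℝ) ^ (s - 2) * (k : ℝ) ^ (2 - 2 * s))) * ‖b‖ := by ring
    _ = _ := by rw [← Real.rpow_add hk0]; ring_nf

theorem norm_cuspTerm_le (hs : 2 ≤ s) (hc : 0 < c) (hk : 0 < k)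
    (hJ : ∀ j, j < J ↔ 0 < D j) (hDmax : ∀ j, D j ≤ Dmax)
    (hb : Summable fun j => ‖b j‖ * Real.exp (D j / 2))
    (hM : ∑' j, ‖b j‖ * Real.exp (D j / 2) ≤ M)
    (hW : ∀ (j : ℕ) (A B : ℤ), A ≤ B → B ≤ A + k → ‖∑ h ∈ unitsIn k A B, θ h j‖ ≤ W) :
    ‖cuspTerm s c k J D b θ‖ ≤ (2 * Real.exp (Dmax + 2 * c) * (2 ^ (s - 1) / (s - 1)) +
      2 * 2 ^ (s - 2) * Real.exp (c + Dmax)) * M * (W * (k : ℝ) ^ (-s)) := by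
  have hW0 : 0 ≤ W := (norm_nonneg _).trans (hW 0 0 0 le_rfl (by simp))
  have hs1 : 0 < s - 1 := by linarith
  set C := 2 * Real.exp (Dmax + 2 * c) * (2 ^ (s - 1) / (s - 1)) +
      2 * 2 ^ (s - 2) * Real.exp (c + Dmax) with hC
  have hC0 : 0 ≤ C := by positivity
  refine (norm_sum_le _ _).trans ?_
  calc _ ≤ ∑ j ∈ Finset.range J, C * (W * (k : ℝ) ^ (-s)) * ‖b j‖ :=
      Finset.sum_le_sum fun j hj => norm_polarTerm_le hs hc hk ((hJ j).1 (Finset.mem_range.1 hj))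
        (hDmax j) (norm_sum_units_le hk _ (hW j))
    _ = C * (W * (k : ℝ) ^ (-s)) * ∑ j ∈ Finset.range J, ‖b j‖ := by rw [Finset.mul_sum]
    _ ≤ C * (W * (k : ℝ) ^ (-s)) * M := by gcongr; exact sum_range_norm_le hJ hb hM
    _ = _ := by ring

/-- There are two errors of the same order. Replacing arcs by the whole segment costs W N^(2-s)
times its length 2/(kN); replacing segment integrals by Bessel values costs W k^(s-2) (kN)^(1-s).
Both equal W k⁻¹ N^(1-s) up to constants. -/
theorem norm_arcIntegral_sub_le (hs : 2 ≤ s) (hc : 0 < c) (hk : 0 < k) (hkN : k ≤ N)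
    (hJ : ∀ j, j < J ↔ 0 < D j) (hDmax : ∀ j, D j ≤ Dmax)
    (hb : Summable fun j => ‖b j‖ * Real.exp (D j / 2))
    (hM : ∑' j, ‖b j‖ * Real.exp (D j / 2) ≤ M)
    (hW : ∀ (j : ℕ) (A B : ℤ), A ≤ B → B ≤ A + k → ‖∑ h ∈ unitsIn k A B, θ h j‖ ≤ W)
    {f : ℝ → ℂ} (hf : Continuous f)
    (hF : ∀ h ∈ units k, ∀ φ : ℝ,
      HasSum (fun j => θ h j * (b j * cuspIntegrand s c k N (D j) φ)) (f ((h : ℝ) / k + φ))) :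
    ‖(∑ h ∈ units k, ∫ φ in fareyArc N h k, f ((h : ℝ) / k + φ)) - cuspTerm s c k J D b θ‖ ≤
      (4 * 2 ^ (s - 2) * Real.exp (c + 4 * |Dmax|) +
        2 * Real.exp (Dmax + 2 * c) * (2 ^ (s - 1) / (s - 1))) * M *
        (W * (k : ℝ)⁻¹ * (N : ℝ) ^ (1 - s)) := by
  classical
  have hk0 : (0 : ℝ) < k := by exact_mod_cast hk
  have hN : 0 < N := hk.trans_le hkN
  have hN0 : (0 : ℝ) < N := by exact_mod_cast hN
  have hW0 : 0 ≤ W := (norm_nonneg _).trans (hW 0 0 0 le_rfl (by simp))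
  have hs1 : 0 < s - 1 := by linarith
  set r := 1 / ((k : ℝ) * N) with hr
  have hr0 : 0 < r := by positivity
  have hsub : ∀ h : ℕ, fareyArc N h k ⊆ Icc (-r) r := fun h φ hφ =>
    abs_le.1 (abs_le_of_mem_fareyArc hk hkN hφ)
  have hcont : ∀ h : ℕ, Continuous fun φ : ℝ => f ((h : ℝ) / k + φ) := fun h => by fun_prop
  have hint : ∀ h : ℕ, Integrable (fun φ => if φ ∈ fareyArc N h k then f ((h : ℝ) / k + φ) else 0)
      (volume.restrict (Icc (-r) r)) := fun h => by
    have : (fun φ => if φ ∈ fareyArc N h k then f ((h : ℝ) / k + φ) else 0) =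
        (fareyArc N h k).indicator fun φ => f ((h : ℝ) / k + φ) := by
      ext φ; simp [indicator_apply]
    rw [this]
    exact ((hcont h).continuousOn.integrableOn_compact isCompact_Icc).integrable.indicator
      (measurableSet_fareyArc N h k)
  have h1 : (∑ h ∈ units k, ∫ φ in fareyArc N h k, f ((h : ℝ) / k + φ)) =
      ∫ φ in Icc (-r) r, ∑ h ∈ units k,
        if φ ∈ fareyArc N h k then f ((h : ℝ) / k + φ) else 0 := by
    rw [integral_finsetSum _ fun h _ => hint h]
    refine Finset.sum_congr rfl fun h _ => ?_
    have : (fun φ => if φ ∈ fareyArc N h k then f ((h : ℝ) / k + φ) else 0) =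
        (fareyArc N h k).indicator fun φ => f ((h : ℝ) / k + φ) := by
      ext φ; simp [indicator_apply]
    rw [this, setIntegral_indicator (measurableSet_fareyArc N h k),
      inter_eq_self_of_subset_right (hsub h)]
  set G : ℝ → ℂ := fun φ => ∑ j ∈ Finset.range J, (∑ h ∈ units k, θ h j) *
    (b j * cuspIntegrand s c k N (D j) φ) with hG
  have hGj : ∀ j, Continuous fun φ => (∑ h ∈ units k, θ h j) *
    (b j * cuspIntegrand s c k N (D j) φ) := fun j =>
      continuous_const.mul (continuous_const.mul (continuous_cuspIntegrand hk hN _))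
  have hGint : IntegrableOn G (Icc (-r) r) :=
    (continuous_finsetSum _ fun j _ => hGj j).continuousOn.integrableOn_compact isCompact_Icc
  have h2 : ‖(∑ h ∈ units k, ∫ φ in fareyArc N h k, f ((h : ℝ) / k + φ)) -
      ∫ φ in Icc (-r) r, G φ‖ ≤
      2 * W * (2 ^ (s - 2) * (N : ℝ) ^ (2 - s) * Real.exp (c + 4 * |Dmax|)) * M * (2 * r) := by
    rw [h1, ← integral_sub (integrable_finsetSum _ fun h _ => hint h) hGint]
    refine (norm_setIntegral_le_of_norm_le_const (s := Icc (-r) r) (by simp) fun φ hφ =>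
      norm_arcSum_sub_le hs hc hk hkN hJ hDmax hb hM hW (abs_le.2 (mem_Icc.1 hφ))
        fun h hh => hF h hh φ).trans_eq ?_
    rw [Real.volume_real_Icc_of_le (by linarith)]
    ring
  have h3 : ∫ φ in Icc (-r) r, G φ = ∑ j ∈ Finset.range J, (∑ h ∈ units k, θ h j) *
      (b j * (((k : ℝ) ^ (s - 2) : ℝ) * ∫ φ in (-r)..r,
        ((((1 / (N : ℝ) ^ 2 : ℝ) : ℂ) - φ * I) ^ ((s - 2 : ℝ) : ℂ) *
        cexp (c * ((1 / (N : ℝ) ^ 2 : ℝ) - φ * I) +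
          (D j / (k : ℝ) ^ 2 : ℝ) / ((1 / (N : ℝ) ^ 2 : ℝ) - φ * I))))) := by
    rw [integral_Icc_eq_integral_Ioc, ← intervalIntegral.integral_of_le (by linarith), hG,
      intervalIntegral.integral_finsetSum fun j _ => (hGj j).intervalIntegrable _ _]
    refine Finset.sum_congr rfl fun j _ => ?_
    simp_rw [cuspIntegrand_eq hk hN]
    rw [intervalIntegral.integral_const_mul, intervalIntegral.integral_const_mul,
      intervalIntegral.integral_const_mul]
  have h4 : ‖(∫ φ in Icc (-r) r, G φ) - cuspTerm s c k J D b θ‖ ≤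
      2 * Real.exp (Dmax + 2 * c) * (2 ^ (s - 1) / (s - 1)) * M *
        (W * (k : ℝ)⁻¹ * (N : ℝ) ^ (1 - s)) := by
    rw [h3, cuspTerm, ← Finset.sum_sub_distrib]
    set C := 2 * Real.exp (Dmax + 2 * c) * (2 ^ (s - 1) / (s - 1)) with hC
    have hC0 : 0 ≤ C := by positivity
    refine (norm_sum_le _ _).trans ?_
    calc _ ≤ ∑ j ∈ Finset.range J, C * (W * (k : ℝ)⁻¹ * (N : ℝ) ^ (1 - s)) * ‖b j‖ := ?_
      _ = C * (W * (k : ℝ)⁻¹ * (N : ℝ) ^ (1 - s)) * ∑ j ∈ Finset.range J, ‖b j‖ := by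
          rw [Finset.mul_sum]
      _ ≤ C * (W * (k : ℝ)⁻¹ * (N : ℝ) ^ (1 - s)) * M := by
          gcongr; exact sum_range_norm_le hJ hb hM
      _ = _ := by ring
    refine Finset.sum_le_sum fun j hj => ?_
    have hD := (hJ j).1 (Finset.mem_range.1 hj)
    have hB := norm_integral_segment_sub_le hs hc hD hk hkN
    rw [← mul_sub, ← mul_sub, ofReal_mul, ← mul_sub, norm_mul, norm_mul, norm_mul, norm_real,
      Real.norm_of_nonneg (by positivity : (0:ℝ) ≤ (k : ℝ) ^ (s - 2))]
    calc _ ≤ W * (‖b j‖ * ((k : ℝ) ^ (s - 2) * (C * ((k : ℝ) * N) ^ (1 - s)))) := by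
          gcongr
          · exact norm_sum_units_le hk _ (hW j)
          · refine hB.trans ?_
            rw [hC]
            gcongr
            exact hDmax j
      _ = C * (W * ((k : ℝ) ^ (s - 2) * (k : ℝ) ^ (1 - s)) * (N : ℝ) ^ (1 - s)) * ‖b j‖ := by
          rw [Real.mul_rpow hk0.le hN0.le]; ring
      _ = _ := by
          rw [← Real.rpow_add hk0, show s - 2 + (1 - s) = -1 by ring, Real.rpow_neg_one]
  have h5 : (N : ℝ) ^ (2 - s) * r = (k : ℝ)⁻¹ * (N : ℝ) ^ (1 - s) := by
    rw [hr, show 2 - s = (1 - s) + 1 by ring, Real.rpow_add hN0, Real.rpow_one]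
    field_simp
  refine (norm_sub_le_norm_sub_add_norm_sub _ (∫ φ in Icc (-r) r, G φ) _).trans
    ((add_le_add h2 h4).trans_eq ?_)
  linear_combination 4 * W * 2 ^ (s - 2) * Real.exp (c + 4 * |Dmax|) * M * h5

end

/-- The circle method: a function whose horizontal integrals do not depend on the height, and
whose expansions at all rational points have the same shape, has an exact formula in terms of the
polar parts of these expansions, provided that the multipliers have enough cancellation. -/
theorem hasSum_cuspTerm {s c : ℝ} (hs : 2 ≤ s) (hc : 0 < c)
    {J : ℕ → ℕ} {D : ℕ → ℕ → ℝ} {b : ℕ → ℕ → ℂ} {θ : ℕ → ℕ → ℕ → ℂ} {Dmax M : ℝ} {W : ℕ → ℝ}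
    (hJ : ∀ k j, j < J k ↔ 0 < D k j) (hDmax : ∀ k j, D k j ≤ Dmax)
    (hb : ∀ k, Summable fun j => ‖b k j‖ * Real.exp (D k j / 2))
    (hM : ∀ k, ∑' j, ‖b k j‖ * Real.exp (D k j / 2) ≤ M)
    (hW : ∀ k : ℕ, 0 < k → ∀ (j : ℕ) (A B : ℤ), A ≤ B → B ≤ A + k →
      ‖∑ h ∈ unitsIn k A B, θ k h j‖ ≤ W k)
    (hWsum : Summable fun k => W k * (k : ℝ) ^ (-s))
    {f : ℝ → ℝ → ℂ} {value : ℂ} (hf : ∀ y, 0 < y → Continuous (f y))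
    (hper : ∀ y, 0 < y → Function.Periodic (f y) 1)
    (hval : ∀ y, 0 < y → value = ∫ x in (0 : ℝ)..1, f y x)
    (hF : ∀ N k, 0 < k → 0 < N → ∀ h ∈ units k, ∀ φ : ℝ,
      HasSum (fun j => θ k h j * (b k j * cuspIntegrand s c k N (D k j) φ))
        (f (1 / (N : ℝ) ^ 2) ((h : ℝ) / k + φ))) :
    HasSum (fun i => cuspTerm s c (i + 1) (J (i + 1)) (D (i + 1)) (b (i + 1)) (θ (i + 1))) value := by
  have hM0 : 0 ≤ M := (tsum_nonneg fun j => by positivity).trans (hM 0)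
  have hs1 : 0 < s - 1 := by linarith
  have hW0 : ∀ k, 0 < k → 0 ≤ W k := fun k hk => (norm_nonneg _).trans (hW k hk 0 0 0 le_rfl (by simp))
  have hWs : Summable fun i => W (i + 1) * ((i + 1 : ℕ) : ℝ) ^ (-s) :=
    (summable_nat_add_iff (f := fun k => W k * (k : ℝ) ^ (-s)) 1).2 hWsum
  set T : ℕ → ℂ := fun i => cuspTerm s c (i + 1) (J (i + 1)) (D (i + 1)) (b (i + 1)) (θ (i + 1))
    with hT
  have hTsum : Summable T :=
    Summable.of_norm_bounded (hWs.mul_left _) fun i =>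
      norm_cuspTerm_le hs hc i.succ_pos (hJ _) (hDmax _) (hb _) (hM _) (hW _ i.succ_pos)
  set K := (4 * 2 ^ (s - 2) * Real.exp (c + 4 * |Dmax|) +
        2 * Real.exp (Dmax + 2 * c) * (2 ^ (s - 1) / (s - 1))) * M with hK
  have hK0 : 0 ≤ K := by positivity
  set E : ℕ → ℕ → ℝ := fun N i =>
    if i < N then W (i + 1) * ((i + 1 : ℕ) : ℝ)⁻¹ * (N : ℝ) ^ (1 - s) else 0 with hE
  have hE0 : Tendsto (fun N => ∑' i, E N i) atTop (𝓝 0) := by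
    have := tendsto_tsum_of_dominated_convergence (f := E) (g := fun _ => (0 : ℝ)) (𝓕 := atTop) hWs
      (fun i => ?_) (Eventually.of_forall fun N i => ?_)
    · simpa using this
    · have h1 : Tendsto (fun N : ℕ => (N : ℝ) ^ (1 - s)) atTop (𝓝 0) := by
        rw [show 1 - s = -(s - 1) by ring]
        exact (tendsto_rpow_neg_atTop hs1).comp tendsto_natCast_atTop_atTop
      have h2 := h1.const_mul (W (i + 1) * ((i + 1 : ℕ) : ℝ)⁻¹)
      rw [mul_zero] at h2
      refine h2.congr' ?_
      filter_upwards [eventually_gt_atTop i] with N hN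
      simp [hE, hN]
    · have hi0 : (0 : ℝ) < ((i + 1 : ℕ) : ℝ) := by positivity
      have hWi := hW0 (i + 1) i.succ_pos
      by_cases hiN : i < N
      · simp only [hE, if_pos hiN]
        rw [Real.norm_of_nonneg (by positivity), mul_assoc]
        gcongr
        rw [show -s = -1 + (1 - s) by ring, Real.rpow_add hi0, Real.rpow_neg_one]
        gcongr ?_ * ?_
        exact Real.rpow_le_rpow_of_nonpos hi0 (by exact_mod_cast hiN) (by linarith)
      · simp only [hE, if_neg hiN, norm_zero]
        positivity
  have hmain : ∀ N : ℕ, 0 < N → ‖value - ∑ i ∈ Finset.range N, T i‖ ≤ K * ∑' i, E N i := by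
    intro N hN
    have hy : 0 < 1 / (N : ℝ) ^ 2 := by positivity
    have hEs : ∑' i, E N i = ∑ i ∈ Finset.range N, W (i + 1) * ((i + 1 : ℕ) : ℝ)⁻¹ * (N : ℝ) ^ (1 - s) := by
      rw [tsum_eq_sum (s := Finset.range N) fun i hi => if_neg (by simpa using hi)]
      exact Finset.sum_congr rfl fun i hi => if_pos (Finset.mem_range.1 hi)
    rw [hval _ hy, farey_dissection hN (hf _ hy) (hper _ hy), hEs, Finset.range_eq_Ico,
      Finset.sum_Ico_add' (fun k => cuspTerm s c k (J k) (D k) (b k) (θ k)) 0 N 1,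
      Finset.sum_Ico_add' (fun k => W k * (k : ℝ)⁻¹ * (N : ℝ) ^ (1 - s)) 0 N 1, zero_add,
      Finset.Ico_add_one_right_eq_Icc, ← Finset.sum_sub_distrib, Finset.mul_sum]
    refine (norm_sum_le _ _).trans (Finset.sum_le_sum fun k hk => ?_)
    rw [Finset.mem_Icc] at hk
    exact norm_arcIntegral_sub_le hs hc hk.1 hk.2 (hJ _) (hDmax _) (hb _) (hM _) (hW _ hk.1)
      (hf _ hy) (hF N k hk.1 hN)
  have hlim : Tendsto (fun N => ∑ i ∈ Finset.range N, T i) atTop (𝓝 value) := by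
    rw [tendsto_iff_norm_sub_tendsto_zero]
    refine squeeze_zero' (g := fun N => K * ∑' i, E N i) (Eventually.of_forall fun _ => norm_nonneg _) ?_
      (by simpa using hE0.const_mul K)
    filter_upwards [eventually_gt_atTop 0] with N hN
    rw [norm_sub_rev]
    exact hmain N hN
  have := tendsto_nhds_unique hlim hTsum.hasSum.tendsto_sum_nat
  rw [this]
  exact hTsum.hasSum

end

end EtaQuotient

/-! ### The circle method applied to H, and the case of negative weight. -/

namespace EtaQuotient

noncomputable section

open Complex MeasureTheory Set Filter Topology

/-- The number `D` such that the term of index `j` of the expansion at a cusp of denominator `k`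
grows like `exp(D / (k²ζ))` as `ζ → 0`. -/
def polarOrder (α β : ℤ) (k j : ℕ) : ℝ :=
  if Even k then -((α : ℝ) + 2 * β) * (π / 12) - 2 * π * j
  else -(2 * (α : ℝ) + β) * (π / 24) - π * j

/-- The number of polar terms in the expansion at a cusp of denominator `k`. -/
def polarCount (α β : ℤ) (k : ℕ) : ℕ :=
  if Even k then ⌈-((α : ℝ) + 2 * β) / 24⌉₊ else ⌈-(2 * (α : ℝ) + β) / 24⌉₊

/-- The coefficients of the expansion at the cusps of denominator `k`. -/
def cuspCoeff (α β : ℤ) (k j : ℕ) : ℂ :=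
  if Even k then a α β j else (2 : ℂ) ^ (-((β : ℂ) / 2)) * a β α j

/-- The summand of the Kloosterman sums. -/
def multiplier (α β : ℤ) (n k h j : ℕ) : ℂ :=
  omega α β h k * cexp (-(2 * π * I * n * h / k) + (if Even k then 2 else 1) * π * I * hPrime h k * j / k)

theorem sum_multiplier_even (α β : ℤ) (n : ℕ) {k : ℕ} (hk : Even k) (j : ℕ) :
    ∑ h ∈ units k, multiplier α β n k h j = A k α β j n := by
  simp only [multiplier, if_pos hk]; rfl

theorem sum_multiplier_odd (α β : ℤ) (n : ℕ) {k : ℕ} (hk : Odd k) (j : ℕ) :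
    ∑ h ∈ units k, multiplier α β n k h j = B k α β j n := by
  simp only [multiplier, if_neg (Nat.not_even_iff_odd.2 hk), one_mul]; rfl

theorem lt_polarCount_iff (α β : ℤ) (k j : ℕ) : j < polarCount α β k ↔ 0 < polarOrder α β k j := by
  have hpi := Real.pi_pos
  unfold polarCount polarOrder
  split_ifs
  · rw [Nat.lt_ceil, show -((α : ℝ) + 2 * β) * (π / 12) - 2 * π * j =
      (2 * π) * (-((α : ℝ) + 2 * β) / 24 - j) by ring, mul_pos_iff_of_pos_left (by positivity), sub_pos]
  · rw [Nat.lt_ceil, show -(2 * (α : ℝ) + β) * (π / 24) - π * j =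
      π * (-(2 * (α : ℝ) + β) / 24 - j) by ring, mul_pos_iff_of_pos_left (by positivity), sub_pos]

/-- Apply the transformation law at τ = h/k + iζ and expand at the image point. The factor
exp(-2πinτ) contributes exp(2πnζ), completing the coefficient of ζ to `wCoeff`, and the j-th power
of the new q contributes both the phase in h' and the shift of `polarOrder` by j. -/
theorem hasSum_expansion (α β : ℤ) (n : ℕ) {N k : ℕ} (hk : 0 < k) (hN : 0 < N) {h : ℕ}
    (hh : h ∈ units k) (φ : ℝ) :
    HasSum (fun j => multiplier α β n k h j * (cuspCoeff α β k j *
        cuspIntegrand (2 - ((α : ℝ) + β) / 2) (wCoeff α β n) k N (polarOrder α β k j) φ))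
      (cexp (-(2 * π * I * n * (((h : ℝ) / k + φ : ℝ) + (1 / (N : ℝ) ^ 2 : ℝ) * I))) *
        HFun α β (((h : ℝ) / k + φ : ℝ) + (1 / (N : ℝ) ^ 2 : ℝ) * I)) := by
  have hcop := (mem_units.1 hh).2
  have : NeZero k := ⟨hk.ne'⟩
  have hkc : (k : ℂ) ≠ 0 := by exact_mod_cast hk.ne'
  set y : ℝ := 1 / (N : ℝ) ^ 2 with hy
  have hy0 : 0 < y := by positivity
  set ζ : ℂ := (y : ℂ) - φ * I with hζ
  have hre : 0 < ζ.re := by simpa [hζ] using hy0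
  have hζ0 : ζ ≠ 0 := fun h => by rw [h] at hre; simp at hre
  have harg : ((((h : ℝ) / k + φ : ℝ) : ℂ) + (y : ℂ) * I) = h / k + I * ζ := by
    rw [hζ]; push_cast; linear_combination (φ : ℂ) * I_sq
  have hdvd : (k : ℤ) ∣ h * (hPrime h k : ℤ) + 1 := by
    have := (hPrime_modEq h k hcop).symm.dvd
    simpa using this
  have hs : ((2 - ((α : ℝ) + β) / 2 - 2 : ℝ) : ℂ) = -(((α : ℂ) + β) / 2) := by push_cast; ring
  have hinv : 0 < (1 / ((k : ℂ) ^ 2 * ζ)).re := by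
    rw [hζ, re_one_div_segment]
    have : 0 < y ^ 2 + φ ^ 2 := by positivity
    positivity
  rw [harg]
  rcases Nat.even_or_odd k with he | ho
  · have him : 0 < ((hPrime h k : ℂ) / k + I / ((k : ℂ) ^ 2 * ζ)).im := by
      rw [div_eq_mul_one_div I, add_im, I_mul_im, ← ofReal_natCast, ← ofReal_natCast, ← ofReal_div, ofReal_im,
        zero_add]
      exact_mod_cast hinv
    have hsum := HFun_hasSum α β him
    rw [HFun_transform_even α β hk he hcop (hPrime h k) hdvd hre]
    have key := hsum.mul_left (cexp (-(2 * π * I * n * (h / k + I * ζ))) * (omega α β h k *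
      ((k : ℂ) * ζ) ^ (-(((α : ℂ) + β) / 2)) *
      cexp (((α : ℂ) + 2 * β) * (π / 12) * ζ -
        ((α : ℂ) + 2 * β) * (π / 12) / ((k : ℂ) ^ 2 * ζ))))
    rw [mul_assoc (cexp _)] at key
    rw [Int.cast_natCast]
    refine key.congr_fun fun j => ?_
    · rw [multiplier, cuspCoeff, cuspIntegrand, hs, if_pos he, if_pos he, polarOrder, if_pos he, ← hζ]
      have hexp : cexp (-(2 * π * I * n * h / k) + 2 * π * I * hPrime h k * j / k) *
          cexp ((wCoeff α β n : ℝ) * ζ + ((-((α : ℝ) + 2 * β) * (π / 12) - 2 * π * j : ℝ) : ℂ) /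
            ((k : ℂ) ^ 2 * ζ)) =
          cexp (-(2 * π * I * n * (h / k + I * ζ))) * cexp (((α : ℂ) + 2 * β) * (π / 12) * ζ -
            ((α : ℂ) + 2 * β) * (π / 12) / ((k : ℂ) ^ 2 * ζ)) *
            cexp (2 * π * I * j * ((hPrime h k : ℂ) / k + I / ((k : ℂ) ^ 2 * ζ))) := by
        rw [← Complex.exp_add, ← Complex.exp_add, ← Complex.exp_add]
        congr 1
        unfold wCoeff
        push_cast
        linear_combination (2 * π * n * ζ - 2 * π * j / ((k : ℂ) ^ 2 * ζ)) * I_sq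
      linear_combination (omega α β h k * a α β j * ((k : ℂ) * ζ) ^ (-(((α : ℂ) + β) / 2))) * hexp
  · have hne : ¬ Even k := Nat.not_even_iff_odd.2 ho
    have him : 0 < (((hPrime h k : ℂ) / k + I / ((k : ℂ) ^ 2 * ζ)) / 2).im := by
      rw [div_eq_mul_one_div I, div_ofNat_im, add_im, I_mul_im, ← ofReal_natCast, ← ofReal_natCast, ← ofReal_div, ofReal_im,
        zero_add]
      exact div_pos (by exact_mod_cast hinv) (by norm_num)
    have hsum := HFun_hasSum β α him
    have heven : Even ((hPrime h k : ℕ) : ℤ) := by exact_mod_cast hPrime_even h k ho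
    rw [HFun_transform_odd α β ho hcop (hPrime h k) hdvd heven hre]
    have key := hsum.mul_left (cexp (-(2 * π * I * n * (h / k + I * ζ))) * (omega α β h k *
      (2 : ℂ) ^ (-((β : ℂ) / 2)) *
      ((k : ℂ) * ζ) ^ (-(((α : ℂ) + β) / 2)) *
      cexp (((α : ℂ) + 2 * β) * (π / 12) * ζ -
        (2 * (α : ℂ) + β) * (π / 24) / ((k : ℂ) ^ 2 * ζ))))
    rw [mul_assoc (cexp _)] at key
    rw [Int.cast_natCast]
    refine key.congr_fun fun j => ?_
    · rw [multiplier, cuspCoeff, cuspIntegrand, hs, if_neg hne, if_neg hne, polarOrder, if_neg hne, ← hζ]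
      have hexp : cexp (-(2 * π * I * n * h / k) + 1 * π * I * hPrime h k * j / k) *
          cexp ((wCoeff α β n : ℝ) * ζ + ((-(2 * (α : ℝ) + β) * (π / 24) - π * j : ℝ) : ℂ) /
            ((k : ℂ) ^ 2 * ζ)) =
          cexp (-(2 * π * I * n * (h / k + I * ζ))) * cexp (((α : ℂ) + 2 * β) * (π / 12) * ζ -
            (2 * (α : ℂ) + β) * (π / 24) / ((k : ℂ) ^ 2 * ζ)) *
            cexp (2 * π * I * j * (((hPrime h k : ℂ) / k + I / ((k : ℂ) ^ 2 * ζ)) / 2)) := by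
        rw [← Complex.exp_add, ← Complex.exp_add, ← Complex.exp_add]
        congr 1
        unfold wCoeff
        push_cast
        linear_combination (2 * π * n * ζ - π * j / ((k : ℂ) ^ 2 * ζ)) * I_sq
      linear_combination (omega α β h k * (2 : ℂ) ^ (-((β : ℂ) / 2)) * a β α j *
        ((k : ℂ) * ζ) ^ (-(((α : ℂ) + β) / 2))) * hexp

theorem polarOrder_le (α β : ℤ) (k j : ℕ) :
    polarOrder α β k j ≤ |((α : ℝ) + 2 * β) * (π / 12)| + |(2 * (α : ℝ) + β) * (π / 24)| := by
  have hpi := Real.pi_pos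
  have hj : (0 : ℝ) ≤ j := Nat.cast_nonneg j
  have h1 := neg_abs_le (((α : ℝ) + 2 * β) * (π / 12))
  have h2 := neg_abs_le ((2 * (α : ℝ) + β) * (π / 24))
  have h3 := abs_nonneg (((α : ℝ) + 2 * β) * (π / 12))
  have h4 := abs_nonneg ((2 * (α : ℝ) + β) * (π / 24))
  have h5 : 0 ≤ π * j := by positivity
  unfold polarOrder
  split_ifs <;> linarith

/-- Up to constants the weights are exp(-πj) for even k and exp(-πj/2) for odd k, so the q-series
converge absolutely. Only the parity of k matters, and k = 0 and k = 1 represent the two cases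
uniformly. -/
theorem exists_summable_cuspCoeff (α β : ℤ) :
    (∀ k, Summable fun j => ‖cuspCoeff α β k j‖ * Real.exp (polarOrder α β k j / 2)) ∧
    ∃ M, ∀ k, ∑' j, ‖cuspCoeff α β k j‖ * Real.exp (polarOrder α β k j / 2) ≤ M := by
  have hpi := Real.pi_pos
  have h0 : Summable fun j => ‖cuspCoeff α β 0 j‖ * Real.exp (polarOrder α β 0 j / 2) := by
    refine ((summable_norm_a α β hpi).mul_left
      (Real.exp (-((α : ℝ) + 2 * β) * (π / 12) / 2))).congr fun j => ?_
    rw [cuspCoeff, polarOrder, if_pos (by simp), if_pos (by simp), mul_left_comm, ← Real.exp_add]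
    ring_nf
  have h1 : Summable fun j => ‖cuspCoeff α β 1 j‖ * Real.exp (polarOrder α β 1 j / 2) := by
    refine ((summable_norm_a β α (half_pos hpi)).mul_left
      (‖(2 : ℂ) ^ (-((β : ℂ) / 2))‖ * Real.exp (-(2 * (α : ℝ) + β) * (π / 24) / 2))).congr fun j => ?_
    rw [cuspCoeff, polarOrder, if_neg (by simp), if_neg (by simp), norm_mul, mul_mul_mul_comm,
      mul_assoc ‖(2 : ℂ) ^ (-((β : ℂ) / 2))‖ ‖a β α j‖, mul_assoc,
      ← Real.exp_add]
    ring_nf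
  have hk : ∀ k, (fun j => ‖cuspCoeff α β k j‖ * Real.exp (polarOrder α β k j / 2)) =
        (fun j => ‖cuspCoeff α β 0 j‖ * Real.exp (polarOrder α β 0 j / 2)) ∨
      (fun j => ‖cuspCoeff α β k j‖ * Real.exp (polarOrder α β k j / 2)) =
        (fun j => ‖cuspCoeff α β 1 j‖ * Real.exp (polarOrder α β 1 j / 2)) := by
    intro k
    by_cases hk : Even k
    · left; funext j; simp [cuspCoeff, polarOrder, hk]
    · right; funext j; simp [cuspCoeff, polarOrder, hk]
  refine ⟨fun k => ?_, max (∑' j, ‖cuspCoeff α β 0 j‖ * Real.exp (polarOrder α β 0 j / 2))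
    (∑' j, ‖cuspCoeff α β 1 j‖ * Real.exp (polarOrder α β 1 j / 2)), fun k => ?_⟩
  · rcases hk k with h | h <;> rw [h] <;> assumption
  · rcases hk k with h | h <;> rw [h]
    · exact le_max_left _ _
    · exact le_max_right _ _

theorem wCoeff_pos {α β : ℤ} {n : ℕ} (hn : -((α : ℝ) + 2 * β) / 24 < (n : ℝ)) : 0 < wCoeff α β n := by
  have hpi := Real.pi_pos
  have : wCoeff α β n = 2 * π * (n - -((α : ℝ) + 2 * β) / 24) := by unfold wCoeff; ring
  rw [this]
  have := sub_pos.2 hn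
  positivity

theorem continuous_HFun_line (α β : ℤ) (n : ℕ) {y : ℝ} (hy : 0 < y) :
    Continuous fun x : ℝ => cexp (-(2 * π * I * n * ((x : ℂ) + y * I))) * HFun α β ((x : ℂ) + y * I) := by
  simp_rw [HFun_eq_HDisc]
  refine Continuous.mul (by fun_prop) (continuous_iff_continuousAt.2 fun x => ?_)
  have him : 0 < ((x : ℂ) + y * I).im := by simpa using hy
  exact ContinuousAt.comp (f := fun x : ℝ => cexp (2 * π * I * ((x : ℂ) + y * I)))
    (differentiableAt_HDisc α β (norm_cexp_lt_one him)).continuousAt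
    (by fun_prop)

theorem periodic_HFun_line (α β : ℤ) (n : ℕ) (y : ℝ) :
    Function.Periodic (fun x : ℝ => cexp (-(2 * π * I * n * ((x : ℂ) + y * I))) *
      HFun α β ((x : ℂ) + y * I)) 1 := by
  intro x
  simp only [HFun_eq_HDisc]
  have h1 : cexp (-(2 * π * I * n * (((x + 1 : ℝ) : ℂ) + y * I))) =
      cexp (-(2 * π * I * n * ((x : ℂ) + y * I))) :=
    Complex.exp_eq_exp_iff_exists_int.2 ⟨-n, by push_cast; ring⟩
  have h2 : cexp (2 * π * I * (((x + 1 : ℝ) : ℂ) + y * I)) = cexp (2 * π * I * ((x : ℂ) + y * I)) :=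
    Complex.exp_eq_exp_iff_exists_int.2 ⟨1, by push_cast; ring⟩
  rw [h1, h2]

/-- The exact formula, as a series over all denominators, given bounds for the incomplete
Kloosterman sums. -/
theorem hasSum_a {α β : ℤ} (hαβ : α + β ≤ 0) {n : ℕ} (hn : -((α : ℝ) + 2 * β) / 24 < (n : ℝ))
    {W : ℕ → ℝ} (hW : ∀ k : ℕ, 0 < k → ∀ (j : ℕ) (A B : ℤ), A ≤ B → B ≤ A + k →
      ‖∑ h ∈ unitsIn k A B, multiplier α β n k h j‖ ≤ W k)
    (hWsum : Summable fun k => W k * (k : ℝ) ^ (-(2 - ((α : ℝ) + β) / 2))) :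
    HasSum (fun i => cuspTerm (2 - ((α : ℝ) + β) / 2) (wCoeff α β n) (i + 1) (polarCount α β (i + 1))
      (polarOrder α β (i + 1)) (cuspCoeff α β (i + 1)) (multiplier α β n (i + 1))) (a α β n) := by
  have hs : (2 : ℝ) ≤ 2 - ((α : ℝ) + β) / 2 := by
    have : (α : ℝ) + β ≤ 0 := by exact_mod_cast hαβ
    linarith
  obtain ⟨h1, M, hM⟩ := exists_summable_cuspCoeff α β
  exact hasSum_cuspTerm hs (wCoeff_pos hn) (f := fun y x =>
    cexp (-(2 * π * I * n * ((x : ℂ) + y * I))) * HFun α β ((x : ℂ) + y * I))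
    (lt_polarCount_iff α β) (polarOrder_le α β) h1 hM hW hWsum
    (fun y hy => continuous_HFun_line α β n hy) (fun y _ => periodic_HFun_line α β n y)
    (fun y hy => by simp_rw [HFun_eq_HDisc]; exact a_eq_integral α β n hy)
    (fun N k hk hN h hh φ => hasSum_expansion α β n hk hN hh φ)

theorem polarTerm_eq_evenTerm (α β : ℤ) (n j : ℕ) {k : ℕ} (hk0 : 0 < k) (hk : Even k) :
    (∑ h ∈ units k, multiplier α β n k h j) * (cuspCoeff α β k j *
      (((k : ℝ) ^ (2 - ((α : ℝ) + β) / 2 - 2) *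
        besselValue (2 - ((α : ℝ) + β) / 2 - 1) (wCoeff α β n) (polarOrder α β k j / (k : ℝ) ^ 2) : ℝ) : ℂ)) =
      2 * π * evenTerm α β n j k := by
  have hkr : (0 : ℝ) < k := by exact_mod_cast hk0
  have hd : polarOrder α β k j / (k : ℝ) ^ 2 = invCoeff0 α β j k := by
    rw [polarOrder, if_pos hk, invCoeff0]; field_simp
  have hv : 2 - ((α : ℝ) + β) / 2 - 1 = order α β := by rw [order]; ring
  have e1 : order α β / 2 = 1 / 2 - ((α : ℝ) + β) / 4 := by rw [order]; ring
  have e2 : -(order α β / 2) = -(1 / 2) + ((α : ℝ) + β) / 4 := by rw [order]; ring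
  rw [sum_multiplier_even α β n hk, cuspCoeff, if_pos hk, evenTerm, hd, hv, besselValue, e2, e1, ← L0,
    show 2 - ((α : ℝ) + β) / 2 - 2 = -(((α : ℝ) + β) / 2) by ring, Real.rpow_neg hkr.le]
  push_cast
  ring

theorem polarTerm_eq_oddTerm (α β : ℤ) (n j : ℕ) {k : ℕ} (hk : Odd k) :
    (∑ h ∈ units k, multiplier α β n k h j) * (cuspCoeff α β k j *
      (((k : ℝ) ^ (2 - ((α : ℝ) + β) / 2 - 2) *
        besselValue (2 - ((α : ℝ) + β) / 2 - 1) (wCoeff α β n) (polarOrder α β k j / (k : ℝ) ^ 2) : ℝ) : ℂ)) =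
      2 * π * oddTerm α β n j k := by
  have hne : ¬ Even k := Nat.not_even_iff_odd.2 hk
  have hkr : (0 : ℝ) < k := by exact_mod_cast hk.pos
  have hd : polarOrder α β k j / (k : ℝ) ^ 2 = invCoeff1 α β j k := by
    rw [polarOrder, if_neg hne, invCoeff1]; field_simp
  have hv : 2 - ((α : ℝ) + β) / 2 - 1 = order α β := by rw [order]; ring
  have e1 : order α β / 2 = 1 / 2 - ((α : ℝ) + β) / 4 := by rw [order]; ring
  have e2 : -(order α β / 2) = -(1 / 2) + ((α : ℝ) + β) / 4 := by rw [order]; ring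
  have h2 : (2 : ℂ) ^ (-((β : ℂ) / 2)) = (((2 : ℝ) ^ ((β : ℝ) / 2) : ℝ) : ℂ)⁻¹ := by
    rw [ofReal_cpow (by norm_num), cpow_neg]; push_cast; rfl
  rw [sum_multiplier_odd α β n hk, cuspCoeff, if_neg hne, oddTerm, hd, hv, besselValue, e2, e1, ← L1,
    show 2 - ((α : ℝ) + β) / 2 - 2 = -(((α : ℝ) + β) / 2) by ring, Real.rpow_neg hkr.le, h2]
  push_cast
  ring

/-- Separate the parities of k in the single series of `hasSum_a`. The sums over j are finite, so
they may be taken outside once each series over k is summable, which `norm_polarTerm_le` gives for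
each j separately. -/
theorem exact_formula {α β : ℤ} (hαβ : α + β ≤ 0) {n : ℕ} (hn : -((α : ℝ) + 2 * β) / 24 < (n : ℝ))
    {W : ℕ → ℝ} (hW : ∀ k : ℕ, 0 < k → ∀ (j : ℕ) (A B : ℤ), A ≤ B → B ≤ A + k →
      ‖∑ h ∈ unitsIn k A B, multiplier α β n k h j‖ ≤ W k)
    (hWsum : Summable fun k => W k * (k : ℝ) ^ (-(2 - ((α : ℝ) + β) / 2))) :
    (∀ j : ℕ, (j : ℝ) < -((α : ℝ) + 2 * β) / 24 →
      Summable fun m : ℕ => evenTerm α β n j (2 * m + 2)) ∧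
    (∀ j : ℕ, (j : ℝ) < -(2 * (α : ℝ) + β) / 24 →
      Summable fun m : ℕ => oddTerm α β n j (2 * m + 1)) ∧
    a α β n =
      2 * (π : ℂ) * ∑ j ∈ Finset.range ⌈-((α : ℝ) + 2 * β) / 24⌉₊,
        ∑' m : ℕ, evenTerm α β n j (2 * m + 2) +
      2 * (π : ℂ) * ∑ j ∈ Finset.range ⌈-(2 * (α : ℝ) + β) / 24⌉₊,
        ∑' m : ℕ, oddTerm α β n j (2 * m + 1) := by
  have hs : (2 : ℝ) ≤ 2 - ((α : ℝ) + β) / 2 := by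
    have : (α : ℝ) + β ≤ 0 := by exact_mod_cast hαβ
    linarith
  have hpi : (2 * π : ℂ) ≠ 0 := by exact_mod_cast (mul_pos two_pos Real.pi_pos).ne'
  have hc := wCoeff_pos hn
  set Dm := |((α : ℝ) + 2 * β) * (π / 12)| + |(2 * (α : ℝ) + β) * (π / 24)| with hDm
  set s := 2 - ((α : ℝ) + β) / 2 with hs'
  set C := 2 * Real.exp (Dm + 2 * wCoeff α β n) * (2 ^ (s - 1) / (s - 1)) +
      2 * 2 ^ (s - 2) * Real.exp (wCoeff α β n + Dm) with hC
  have hev : ∀ m : ℕ, Even (2 * m + 2) := fun m => ⟨m + 1, by ring⟩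
  have hod : ∀ m : ℕ, Odd (2 * m + 1) := fun m => ⟨m, rfl⟩
  have hE : ∀ j : ℕ, (j : ℝ) < -((α : ℝ) + 2 * β) / 24 →
      Summable fun m : ℕ => evenTerm α β n j (2 * m + 2) := by
    intro j hj
    have hb : ∀ m : ℕ, cuspCoeff α β (2 * m + 2) j = a α β j := fun m => if_pos (hev m)
    have hsW := ((hWsum.comp_injective (i := fun m : ℕ => 2 * m + 2)
      (fun x y h => by simpa using h)).mul_left C).mul_right ‖a α β j‖
    refine (summable_mul_left_iff hpi).1 (Summable.of_norm_bounded hsW fun m => ?_)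
    rw [← polarTerm_eq_evenTerm α β n j (by omega) (hev m), ← hb m]
    refine norm_polarTerm_le hs hc (by omega) ((lt_polarCount_iff _ _ _ _).1 ?_) (polarOrder_le α β _ j)
      (norm_sum_units_le (by omega) _ (hW _ (by omega) j))
    rw [polarCount, if_pos (hev m)]
    exact Nat.lt_ceil.2 hj
  have hO : ∀ j : ℕ, (j : ℝ) < -(2 * (α : ℝ) + β) / 24 →
      Summable fun m : ℕ => oddTerm α β n j (2 * m + 1) := by
    intro j hj
    have hb : ∀ m : ℕ, cuspCoeff α β (2 * m + 1) j = (2 : ℂ) ^ (-((β : ℂ) / 2)) * a β α j :=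
      fun m => if_neg (Nat.not_even_iff_odd.2 (hod m))
    have hsW := ((hWsum.comp_injective (i := fun m : ℕ => 2 * m + 1)
      (fun x y h => by simpa using h)).mul_left C).mul_right ‖(2 : ℂ) ^ (-((β : ℂ) / 2)) * a β α j‖
    refine (summable_mul_left_iff hpi).1 (Summable.of_norm_bounded hsW fun m => ?_)
    rw [← polarTerm_eq_oddTerm α β n j (hod m), ← hb m]
    refine norm_polarTerm_le hs hc (by omega) ((lt_polarCount_iff _ _ _ _).1 ?_) (polarOrder_le α β _ j)
      (norm_sum_units_le (by omega) _ (hW _ (by omega) j))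
    rw [polarCount, if_neg (Nat.not_even_iff_odd.2 (hod m))]
    exact Nat.lt_ceil.2 hj
  refine ⟨hE, hO, ?_⟩
  have hsum := hasSum_a hαβ hn hW hWsum
  set T : ℕ → ℂ := fun i => cuspTerm (2 - ((α : ℝ) + β) / 2) (wCoeff α β n) (i + 1) (polarCount α β (i + 1))
      (polarOrder α β (i + 1)) (cuspCoeff α β (i + 1)) (multiplier α β n (i + 1)) with hT
  -- The series is indexed by i = k - 1, so odd indices carry the even denominators.
  have hTe : ∀ m, T (2 * m + 1) = ∑ j ∈ Finset.range ⌈-((α : ℝ) + 2 * β) / 24⌉₊,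
      2 * π * evenTerm α β n j (2 * m + 2) := by
    intro m
    rw [hT]
    simp only [cuspTerm]
    rw [polarCount, if_pos (hev m)]
    exact Finset.sum_congr rfl fun j _ => polarTerm_eq_evenTerm α β n j (by omega) (hev m)
  have hTo : ∀ m, T (2 * m) = ∑ j ∈ Finset.range ⌈-(2 * (α : ℝ) + β) / 24⌉₊,
      2 * π * oddTerm α β n j (2 * m + 1) := by
    intro m
    rw [hT]
    simp only [cuspTerm]
    rw [polarCount, if_neg (Nat.not_even_iff_odd.2 (hod m))]
    exact Finset.sum_congr rfl fun j _ => polarTerm_eq_oddTerm α β n j (hod m)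
  have h1 := tsum_even_add_odd
    (hsum.summable.comp_injective (i := fun m : ℕ => 2 * m) (fun x y h => by simpa using h))
    (hsum.summable.comp_injective (i := fun m : ℕ => 2 * m + 1) (fun x y h => by simpa using h))
  rw [← hsum.tsum_eq, ← h1, add_comm]
  simp_rw [hTe, hTo]
  rw [Summable.tsum_finsetSum fun j hj => (hE j (Nat.lt_ceil.1 (Finset.mem_range.1 hj))).mul_left _,
    Summable.tsum_finsetSum fun j hj => (hO j (Nat.lt_ceil.1 (Finset.mem_range.1 hj))).mul_left _]
  simp_rw [tsum_mul_left]
  rw [← Finset.mul_sum, ← Finset.mul_sum]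

theorem norm_multiplier (α β : ℤ) (n k h j : ℕ) : ‖multiplier α β n k h j‖ = 1 := by
  rw [multiplier, omega, ← Complex.exp_add, Complex.norm_exp, Real.exp_eq_one_iff]
  have h1 : (-(2 * π * I * n * h / k) + (if Even k then 2 else 1) * π * I * hPrime h k * j / k : ℂ) =
      ((-(2 * π * n * h / k) + (if Even k then 2 else 1) * π * hPrime h k * j / k : ℝ) : ℂ) * I := by
    split_ifs <;> push_cast <;> ring
  rw [h1]
  generalize (-(2 * π * n * h / k) + (if Even k then 2 else 1) * π * hPrime h k * j / k : ℝ) = x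
  simp [-ofReal_add, -ofReal_mul]

theorem card_unitsIn_le (k : ℕ) (A B : ℤ) : (unitsIn k A B).card ≤ k := by
  classical
  unfold unitsIn units
  exact (Finset.card_filter_le _ _).trans ((Finset.card_filter_le _ _).trans (by simp))

/-- In negative weight the trivial bound for the incomplete Kloosterman sums suffices. -/
theorem exact_formula_of_neg {α β : ℤ} (hαβ : α + β < 0) {n : ℕ}
    (hn : -((α : ℝ) + 2 * β) / 24 < (n : ℝ)) :
    (∀ j : ℕ, (j : ℝ) < -((α : ℝ) + 2 * β) / 24 →
      Summable fun m : ℕ => evenTerm α β n j (2 * m + 2)) ∧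
    (∀ j : ℕ, (j : ℝ) < -(2 * (α : ℝ) + β) / 24 →
      Summable fun m : ℕ => oddTerm α β n j (2 * m + 1)) ∧
    a α β n =
      2 * (π : ℂ) * ∑ j ∈ Finset.range ⌈-((α : ℝ) + 2 * β) / 24⌉₊,
        ∑' m : ℕ, evenTerm α β n j (2 * m + 2) +
      2 * (π : ℂ) * ∑ j ∈ Finset.range ⌈-(2 * (α : ℝ) + β) / 24⌉₊,
        ∑' m : ℕ, oddTerm α β n j (2 * m + 1) := by
  refine exact_formula hαβ.le hn (W := fun k => k) (fun k _ j A B _ _ => ?_) ?_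
  · refine (norm_sum_le _ _).trans ?_
    simp_rw [norm_multiplier]
    simpa using card_unitsIn_le k A B
  -- With W(k) = k the series is ∑ k^(1-s), and 1 - s is this exponent.
  · have hs : ((α : ℝ) + β) / 2 - 1 < -1 := by
      have : (α : ℝ) + β < 0 := by exact_mod_cast hαβ
      linarith
    refine ((summable_nat_add_iff 1).1 (((summable_nat_add_iff 1).2 (Real.summable_nat_rpow.2 hs)).congr fun k => ?_))
    have hk : (0 : ℝ) < ((k + 1 : ℕ) : ℝ) := by positivity
    rw [← Real.rpow_one_add' hk.le (by linarith)]
    ring_nf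

end

end EtaQuotient

/-! ### The multiplier of η(τ)/η(2τ) on Γ₀(2). -/

namespace EtaQuotient

noncomputable section

open Complex

/-- The eta quotient `η(τ)/η(2τ)`, of weight zero. -/
def etaRatio (τ : ℂ) : ℂ := cexp (-(2 * π * I * τ / 24)) * HFun 1 (-1) τ

theorem etaRatio_ne_zero {τ : ℂ} (hτ : 0 < τ.im) : etaRatio τ ≠ 0 := by
  have h2 : 0 < (2 * τ).im := by simpa using hτ
  exact mul_ne_zero (Complex.exp_ne_zero _) (mul_ne_zero (zpow_ne_zero _ (eulerFun_ne_zero hτ))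
    (zpow_ne_zero _ (eulerFun_ne_zero h2)))

theorem etaRatio_add_int (τ : ℂ) (m : ℤ) :
    etaRatio (τ + m) = cexp (-(2 * π * I * m / 24)) * etaRatio τ := by
  rw [etaRatio, etaRatio, HFun, HFun, eulerFun_congr m rfl,
    eulerFun_congr (τ := 2 * (τ + m)) (τ' := 2 * τ) (2 * m) (by push_cast; ring),
    show -(2 * π * I * (τ + m) / 24) = -(2 * π * I * m / 24) + -(2 * π * I * τ / 24) by ring,
    Complex.exp_add]
  ring

theorem etaRatio_transform_even {k h : ℕ} (hk : 0 < k) (hk2 : Even k) (hc : h.Coprime k)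
    {h' : ℤ} (hd : (k : ℤ) ∣ h * h' + 1) {ζ : ℂ} (hζ : 0 < ζ.re) :
    etaRatio (h / k + I * ζ) = omega 1 (-1) h k * cexp (2 * π * I * (h' - h) / (24 * k)) *
      etaRatio (h' / k + I / (k ^ 2 * ζ)) := by
  have hkc : (k : ℂ) ≠ 0 := by exact_mod_cast hk.ne'
  have hz : ζ ≠ 0 := fun h => by rw [h] at hζ; simp at hζ
  rw [etaRatio, HFun_transform_even 1 (-1) hk hk2 hc h' hd hζ, etaRatio]
  have h0 : (-((((1 : ℤ) : ℂ) + ((-1 : ℤ) : ℂ)) / 2)) = 0 := by norm_num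
  have he : cexp (-(2 * π * I * (h / k + I * ζ) / 24)) *
      cexp (((((1 : ℤ) : ℂ)) + 2 * ((-1 : ℤ) : ℂ)) * (π / 12) * ζ -
        (((1 : ℤ) : ℂ) + 2 * ((-1 : ℤ) : ℂ)) * (π / 12) / (k ^ 2 * ζ)) =
      cexp (2 * π * I * (h' - h) / (24 * k)) * cexp (-(2 * π * I * (h' / k + I / (k ^ 2 * ζ)) / 24)) := by
    rw [← Complex.exp_add, ← Complex.exp_add]
    congr 1
    field_simp
    push_cast
    ring_nf
    simp only [I_sq]
    ring
  rw [h0, cpow_zero]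
  linear_combination (omega 1 (-1) h k * HFun 1 (-1) (h' / k + I / (k ^ 2 * ζ))) * he

theorem HFun_neg (α β : ℤ) (τ : ℂ) : HFun (-α) (-β) τ = (HFun α β τ)⁻¹ := by
  rw [HFun, HFun, zpow_neg, zpow_neg, mul_inv]

/-- The expansion at an odd denominator involves H_{-1,1} = 1/H_{1,-1}, so in weight zero the law
becomes a product with constant value. -/
theorem etaRatio_transform_odd {k h : ℕ} (hk2 : Odd k) (hc : h.Coprime k)
    {h' : ℤ} (hd : (k : ℤ) ∣ h * h' + 1) (he : Even h') {ζ : ℂ} (hζ : 0 < ζ.re) :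
    etaRatio (h / k + I * ζ) * etaRatio ((h' / k + I / (k ^ 2 * ζ)) / 2) =
      omega 1 (-1) h k * 2 ^ (1 / 2 : ℂ) * cexp (-(2 * π * I * (2 * h + h') / (48 * k))) := by
  have hkc : (k : ℂ) ≠ 0 := by exact_mod_cast hk2.pos.ne'
  have hz : ζ ≠ 0 := fun h => by rw [h] at hζ; simp at hζ
  have hinv : 0 < (1 / ((k : ℂ) ^ 2 * ζ)).re := by
    rw [one_div, inv_re, ← ofReal_natCast, ← ofReal_pow, re_ofReal_mul]
    have hk0 : (0 : ℝ) < k := by exact_mod_cast hk2.pos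
    have : 0 < normSq (((k ^ 2 : ℝ) : ℂ) * ζ) := normSq_pos.2 (mul_ne_zero (by exact_mod_cast (pow_pos hk0 2).ne') hz)
    push_cast at this ⊢
    positivity
  have him : 0 < (((h' : ℂ) / k + I / ((k : ℂ) ^ 2 * ζ)) / 2).im := by
    rw [div_eq_mul_one_div I, div_ofNat_im, add_im, I_mul_im, ← ofReal_natCast, ← ofReal_intCast, ← ofReal_div, ofReal_im,
      zero_add]
    exact div_pos (by exact_mod_cast hinv) (by norm_num)
  have hne : HFun 1 (-1) (((h' : ℂ) / k + I / ((k : ℂ) ^ 2 * ζ)) / 2) ≠ 0 := fun h0 =>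
    etaRatio_ne_zero him (by rw [etaRatio, h0, mul_zero])
  rw [etaRatio, HFun_transform_odd 1 (-1) hk2 hc h' hd he hζ, etaRatio]
  have h0 : (-((((1 : ℤ) : ℂ) + ((-1 : ℤ) : ℂ)) / 2)) = 0 := by norm_num
  have h1 : (-(((-1 : ℤ) : ℂ) / 2)) = 1 / 2 := by push_cast; ring
  have hinv' := HFun_neg 1 (-1) (((h' : ℂ) / k + I / ((k : ℂ) ^ 2 * ζ)) / 2)
  rw [neg_neg] at hinv'
  have he : cexp (-(2 * π * I * (h / k + I * ζ) / 24)) *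
      cexp (((((1 : ℤ) : ℂ)) + 2 * ((-1 : ℤ) : ℂ)) * (π / 12) * ζ -
        (2 * ((1 : ℤ) : ℂ) + ((-1 : ℤ) : ℂ)) * (π / 24) / (k ^ 2 * ζ)) *
      cexp (-(2 * π * I * ((h' / k + I / (k ^ 2 * ζ)) / 2) / 24)) =
      cexp (-(2 * π * I * (2 * h + h') / (48 * k))) := by
    rw [← Complex.exp_add, ← Complex.exp_add]
    congr 1
    field_simp
    push_cast
    ring_nf
    simp only [I_sq]
    ring
  rw [h0, cpow_zero, h1, hinv', ← he]
  generalize HFun 1 (-1) (((h' : ℂ) / k + I / ((k : ℂ) ^ 2 * ζ)) / 2) = z at hne ⊢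
  have hz1 := mul_inv_cancel₀ hne
  linear_combination (cexp (-(2 * π * I * (h / k + I * ζ) / 24)) * omega 1 (-1) h k *
    2 ^ (1 / 2 : ℂ) * cexp (((((1 : ℤ) : ℂ)) + 2 * ((-1 : ℤ) : ℂ)) * (π / 12) * ζ -
        (2 * ((1 : ℤ) : ℂ) + ((-1 : ℤ) : ℂ)) * (π / 24) / (k ^ 2 * ζ)) *
      cexp (-(2 * π * I * ((h' / k + I / (k ^ 2 * ζ)) / 2) / 24))) * hz1

theorem dedekindSum_one (h : ℕ) : dedekindSum h 1 = 0 := by simp [dedekindSum]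

theorem omega_one (α β : ℤ) (h : ℕ) : omega α β h 1 = 1 := by
  simp [omega, dedekindSum_one]

theorem dedekindSum_one_two : dedekindSum 1 2 = 0 := by
  norm_num [dedekindSum, Finset.sum_Ico_succ_top, sawtooth]

theorem dedekindSum_two_two : dedekindSum 2 2 = 0 := by
  norm_num [dedekindSum, Finset.sum_Ico_succ_top, sawtooth]

theorem etaRatio_mul_fricke {τ : ℂ} (hτ : 0 < τ.im) :
    etaRatio (-1 / τ) * etaRatio (τ / 2) = 2 ^ (1 / 2 : ℂ) := by
  have hτ0 : τ ≠ 0 := fun h => by rw [h] at hτ; simp at hτ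
  have hζ : 0 < (I / τ).re := by
    rw [div_eq_mul_inv, I_mul_re, inv_im, neg_div, neg_neg]
    exact div_pos hτ (normSq_pos.2 hτ0)
  have := etaRatio_transform_odd (k := 1) (h := 0) odd_one (by simp) (h' := 0) (by simp) (by simp) hζ
  rw [omega_one] at this
  have e1 : ((0 : ℕ) : ℂ) / ((1 : ℕ) : ℂ) + I * (I / τ) = -1 / τ := by
    push_cast; field_simp; simp [I_sq]
  have e2 : (((0 : ℤ) : ℂ) / ((1 : ℕ) : ℂ) + I / (((1 : ℕ) : ℂ) ^ 2 * (I / τ))) / 2 = τ / 2 := by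
    push_cast; field_simp; simp
  rw [e1, e2] at this
  simpa using this

/-- The cusp 1/2: both s(1,2) and s(2,2) vanish, so ω = 1 and only the elementary exponential
remains. -/
theorem etaRatio_lower {τ : ℂ} (hτ : 0 < τ.im) :
    etaRatio (τ / (2 * τ + 1)) = cexp (-(2 * π * I / 24)) * etaRatio τ := by
  have him : 0 < (2 * τ + 1).im := by simpa using hτ
  have hne : 2 * τ + 1 ≠ 0 := fun h => by rw [h] at him; simp at him
  set ζ : ℂ := I / (2 * (2 * τ + 1)) with hζ
  have hre : 0 < ζ.re := by
    rw [hζ, div_eq_mul_inv, I_mul_re, inv_im, neg_div, neg_neg]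
    refine div_pos (by simpa using hτ) (normSq_pos.2 (mul_ne_zero two_ne_zero hne))
  have := etaRatio_transform_even (k := 2) (h := 1) two_pos even_two (by simp) (h' := 1) (by norm_num) hre
  have ho : omega 1 (-1) 1 2 = 1 := by simp [omega, dedekindSum_one_two, dedekindSum_two_two]
  have e1 : ((1 : ℕ) : ℂ) / ((2 : ℕ) : ℂ) + I * ζ = τ / (2 * τ + 1) := by
    rw [hζ]; push_cast; field_simp; rw [I_sq]; ring
  have e2 : ((1 : ℤ) : ℂ) / ((2 : ℕ) : ℂ) + I / (((2 : ℕ) : ℂ) ^ 2 * ζ) = τ + (1 : ℤ) := by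
    rw [hζ]; push_cast; field_simp; ring
  rw [e1, e2, ho, etaRatio_add_int] at this
  rw [this]
  simp

/-- The exponent of the multiplier of `η(τ)/η(2τ)` on the matrix with rows `(a, b)`, `(c, d)`. -/
def ratioPhase (a b c d : ℤ) : ℤ := (a + d) * c - b * d * (c ^ 2 + 2) - 3 * c * d + 3 * (d ^ 2 - 1)

theorem cexp_congr_phase {P Q : ℤ} (h : (48 : ℤ) ∣ P - Q) :
    cexp (2 * π * I * P / 48) = cexp (2 * π * I * Q / 48) := by
  obtain ⟨m, hm⟩ := h
  rw [Complex.exp_eq_exp_iff_exists_int]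
  refine ⟨m, ?_⟩
  have : (P : ℂ) - Q = 48 * m := by exact_mod_cast hm
  linear_combination (2 * π * I / 48) * this

/-- With c = 2e the difference is, modulo the determinant relation, -4 times the displayed product
with factor e. Its divisibility by 12 is a finite check modulo 3 and, using the determinant, modulo
4. -/
theorem ratioPhase_translate {a b c d : ℤ} (hc : Even c) (h : a * d - b * c = 1) :
    (48 : ℤ) ∣ ratioPhase a (a + b) c (d + c) - (ratioPhase a b c d - 2) := by
  obtain ⟨e, rfl⟩ := hc
  have h3 : (3 : ℤ) ∣ e * ((2 * e ^ 2 + 1) * (a + 2 * b) - 3 * d) := by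
    refine (ZMod.intCast_zmod_eq_zero_iff_dvd _ 3).1 ?_
    push_cast
    generalize (e : ZMod 3) = e'
    generalize (a : ZMod 3) = a'
    generalize (b : ZMod 3) = b'
    generalize (d : ZMod 3) = d'
    decide +revert
  have h4 : (4 : ℤ) ∣ e * ((2 * e ^ 2 + 1) * (a + 2 * b) - 3 * d) := by
    refine (ZMod.intCast_zmod_eq_zero_iff_dvd _ 4).1 ?_
    have h' : (a : ZMod 4) * d - b * (e + e) = 1 := by exact_mod_cast congrArg (Int.cast : ℤ → ZMod 4) h
    push_cast
    generalize (e : ZMod 4) = e' at *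
    generalize (a : ZMod 4) = a' at *
    generalize (b : ZMod 4) = b' at *
    generalize (d : ZMod 4) = d' at *
    clear h h3
    decide +revert
  have h12 : (12 : ℤ) ∣ e * ((2 * e ^ 2 + 1) * (a + 2 * b) - 3 * d) := by omega
  obtain ⟨m, hm⟩ := h12
  refine ⟨-m, ?_⟩
  unfold ratioPhase
  linear_combination (-4) * hm - (4 * e ^ 2 + 2) * h

theorem dvd_odd_cube {d : ℤ} (hd : Odd d) : (24 : ℤ) ∣ d * (1 - d ^ 2) := by
  have h3 : (3 : ℤ) ∣ d * (1 - d ^ 2) := by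
    refine (ZMod.intCast_zmod_eq_zero_iff_dvd _ 3).1 ?_
    push_cast
    generalize (d : ZMod 3) = d'
    decide +revert
  have h8 : (8 : ℤ) ∣ d * (1 - d ^ 2) := by
    have := Int.eight_dvd_sq_sub_one_of_odd hd
    have h := (dvd_neg.2 this).mul_left d
    rwa [neg_sub] at h
  omega

theorem ratioPhase_lower {a b c d : ℤ} (hd : Odd d) (h : a * d - b * c = 1) :
    (48 : ℤ) ∣ ratioPhase (a + 2 * b) b (c + 2 * d) d - (ratioPhase a b c d - 2) := by
  obtain ⟨m, hm⟩ := dvd_odd_cube hd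
  refine ⟨2 * m * (a + b), ?_⟩
  unfold ratioPhase
  linear_combination 4 * (a + b) * hm + (4 * d ^ 2 - 2) * h

theorem im_moebius_pos {a b c d : ℤ} (h : a * d - b * c = 1) {τ : ℂ} (hτ : 0 < τ.im) :
    0 < ((a * τ + b) / (c * τ + d) : ℂ).im := by
  have hne : (c : ℂ) * τ + d ≠ 0 := fun h0 => by
    have hi := congrArg Complex.im h0
    simp only [add_im, mul_im, intCast_re, intCast_im, zero_mul, add_zero, zero_im] at hi
    have hc : c = 0 := by
      rcases mul_eq_zero.1 hi with h1 | h1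
      · exact_mod_cast h1
      · exact absurd h1 hτ.ne'
    subst hc
    have : d = 0 := by simpa using h0
    simp [this] at h
  have hr : (a : ℝ) * d - b * c = 1 := by exact_mod_cast h
  have : ((a * τ + b) / (c * τ + d) : ℂ).im = τ.im / normSq (c * τ + d) := by
    rw [div_im, ← sub_div]
    congr 1
    simp only [add_re, add_im, mul_re, mul_im, intCast_re, intCast_im]
    linear_combination τ.im * hr
  rw [this]
  exact div_pos hτ (normSq_pos.2 hne)

theorem denom_ne_zero {a b c d : ℤ} (h : a * d - b * c = 1) {τ : ℂ} (hτ : 0 < τ.im) :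
    (c : ℂ) * τ + d ≠ 0 := fun h0 => by
  have := im_moebius_pos h hτ
  rw [h0] at this
  simp at this

/-- The transformation law of `η(τ)/η(2τ)` under the matrix with rows `(a, b)`, `(c, d)`. -/
def RatioLaw (a b c d : ℤ) : Prop :=
  ∀ τ : ℂ, 0 < τ.im → etaRatio ((a * τ + b) / (c * τ + d)) =
    cexp (2 * π * I * ratioPhase a b c d / 48) * etaRatio τ

theorem cexp_phase_sub_two (P : ℤ) : cexp (2 * π * I * (P - 2 : ℤ) / 48) =
    cexp (2 * π * I * P / 48) * cexp (-(2 * π * I / 24)) := by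
  rw [← Complex.exp_add]; congr 1; push_cast; ring

theorem ratioLaw_translate {a b c d : ℤ} (hc : Even c) (h : a * d - b * c = 1) :
    RatioLaw a b c d ↔ RatioLaw a (a + b) c (d + c) := by
  have key : ∀ τ : ℂ, (a * (τ + 1) + b) / (c * (τ + 1) + d) =
      (a * τ + (a + b : ℤ)) / (c * τ + (d + c : ℤ)) := fun τ => by push_cast; ring_nf
  have hT : ∀ τ, etaRatio (τ + 1) = cexp (-(2 * π * I / 24)) * etaRatio τ := fun τ => by
    have := etaRatio_add_int τ 1
    simpa using this
  have hP : cexp (2 * π * I * ratioPhase a (a + b) c (d + c) / 48) =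
      cexp (2 * π * I * ratioPhase a b c d / 48) * cexp (-(2 * π * I / 24)) := by
    rw [cexp_congr_phase (ratioPhase_translate hc h), cexp_phase_sub_two]
  constructor
  · intro H τ hτ
    rw [← key, H (τ + 1) (by simpa using hτ), hT, hP]
    ring
  · intro H τ hτ
    have h1 := H (τ - 1) (by simpa using hτ)
    rw [← key, sub_add_cancel] at h1
    rw [h1, hP, mul_assoc, ← hT, sub_add_cancel]

theorem ratioLaw_lower {a b c d : ℤ} (hd : Odd d) (h : a * d - b * c = 1) :
    RatioLaw a b c d ↔ RatioLaw (a + 2 * b) b (c + 2 * d) d := by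
  have hP : cexp (2 * π * I * ratioPhase (a + 2 * b) b (c + 2 * d) d / 48) =
      cexp (2 * π * I * ratioPhase a b c d / 48) * cexp (-(2 * π * I / 24)) := by
    rw [cexp_congr_phase (ratioPhase_lower hd h), cexp_phase_sub_two]
  have him : ∀ τ : ℂ, 0 < τ.im → 0 < (τ / (2 * τ + 1)).im := fun τ hτ => by
    have := im_moebius_pos (a := 1) (b := 0) (c := 2) (d := 1) (by norm_num) hτ
    simpa using this
  have hne : ∀ τ : ℂ, 0 < τ.im → 2 * τ + 1 ≠ 0 := fun τ hτ => by
    have := denom_ne_zero (a := 1) (b := 0) (c := 2) (d := 1) (by norm_num) hτ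
    simpa using this
  have key : ∀ τ : ℂ, 0 < τ.im → (a * (τ / (2 * τ + 1)) + b) / (c * (τ / (2 * τ + 1)) + d) =
      ((a + 2 * b : ℤ) * τ + b) / ((c + 2 * d : ℤ) * τ + d) := fun τ hτ => by
    have h1 := hne τ hτ
    have h3 := div_mul_cancel₀ τ h1
    rw [← mul_div_mul_right _ _ h1]
    congr 1
    · push_cast; linear_combination a * h3
    · push_cast; linear_combination c * h3
  constructor
  · intro H τ hτ
    rw [← key τ hτ, H _ (him τ hτ), etaRatio_lower hτ, hP]
    ring
  · intro H τ hτ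
    have him' : 0 < (τ / (-2 * τ + 1)).im := by
      have := im_moebius_pos (a := 1) (b := 0) (c := -2) (d := 1) (by norm_num) hτ
      simpa using this
    have hne' : -2 * τ + 1 ≠ 0 := by
      have := denom_ne_zero (a := 1) (b := 0) (c := -2) (d := 1) (by norm_num) hτ
      simpa using this
    have hinv : τ / (-2 * τ + 1) / (2 * (τ / (-2 * τ + 1)) + 1) = τ := by
      have h2 := hne _ him'
      have h3 := div_mul_cancel₀ τ hne'
      rw [div_eq_iff h2]
      linear_combination h3
    have h1 := H _ him'
    rw [← key _ him', hinv] at h1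
    have h2 := etaRatio_lower him'
    rw [hinv] at h2
    rw [h1, hP, mul_assoc, ← h2]

/-- Γ₀(2) is reached from ± translations by the two moves of `ratioLaw_translate` and
`ratioLaw_lower`. As c is even and d odd, |c| ≠ |d|; subtracting or adding c to d when |c| < |d|,
and 2d to c otherwise, lowers |c| + |d| until c = 0. -/
theorem ratioLaw (a b c d : ℤ) (hc : Even c) (h : a * d - b * c = 1) : RatioLaw a b c d := by
  have hd : Odd d := by
    by_contra hd
    rw [Int.not_odd_iff_even] at hd
    have : Even (a * d - b * c) := (hd.mul_left a).sub (hc.mul_left b)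
    rw [h] at this
    exact absurd this (by decide)
  induction hm : c.natAbs + d.natAbs using Nat.strong_induction_on generalizing a b c d with
  | _ m ih =>
    rcases eq_or_ne c 0 with rfl | hc0
    · have had : a * d = 1 := by linarith
      rcases Int.eq_one_or_neg_one_of_mul_eq_one had with rfl | rfl
      · obtain rfl : d = 1 := by linarith
        intro τ _
        have := etaRatio_add_int τ b
        simp only [Int.cast_one, one_mul, Int.cast_zero, zero_mul, zero_add, div_one]
        rw [this]
        congr 2
        simp [ratioPhase]; ring
      · obtain rfl : d = -1 := by linarith
        intro τ _
        have := etaRatio_add_int τ (-b)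
        have e : (((-1 : ℤ) : ℂ) * τ + b) / (((0 : ℤ) : ℂ) * τ + ((-1 : ℤ) : ℂ)) = τ + (-b : ℤ) := by
          push_cast; ring
        rw [e, this]
        congr 2
        simp [ratioPhase]; ring
    · rcases lt_trichotomy c.natAbs d.natAbs with hlt | heq | hgt
      · rcases lt_or_ge 0 (c * d) with hs | hs
        · have hnew := ih (c.natAbs + (d - c).natAbs) (by
            rcases pos_and_pos_or_neg_and_neg_of_mul_pos hs with h | h <;> omega)
            a (b - a) c (d - c) hc (by linear_combination h) (hd.sub_even hc) rfl
          have := (ratioLaw_translate hc (a := a) (b := b - a) (d := d - c) (by linear_combination h)).1 hnew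
          simpa using this
        · have hnew := ih (c.natAbs + (d + c).natAbs) (by
            rcases mul_nonpos_iff.1 hs with h | h <;> omega)
            a (a + b) c (d + c) hc (by linear_combination h) (hd.add_even hc) rfl
          exact (ratioLaw_translate hc h).2 hnew
      · exfalso
        obtain ⟨x, hx⟩ := hc
        obtain ⟨y, hy⟩ := hd
        omega
      · have hd0 : d ≠ 0 := by rintro rfl; simp at hd
        rcases lt_or_ge 0 (c * d) with hs | hs
        · have hnew := ih ((c - 2 * d).natAbs + d.natAbs) (by
            rcases pos_and_pos_or_neg_and_neg_of_mul_pos hs with h | h <;> omega)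
            (a - 2 * b) b (c - 2 * d) d (hc.sub (even_two_mul d)) (by linear_combination h) hd rfl
          have := (ratioLaw_lower hd (a := a - 2 * b) (b := b) (c := c - 2 * d) (by linear_combination h)).1 hnew
          simpa using this
        · have hnew := ih ((c + 2 * d).natAbs + d.natAbs) (by
            rcases mul_nonpos_iff.1 hs with h | h <;> omega)
            (a + 2 * b) b (c + 2 * d) d (hc.add (even_two_mul d)) (by linear_combination h) hd rfl
          exact (ratioLaw_lower hd h).2 hnew

/-- The matrix with rows (h', b), (k, -h) lies in Γ₀(2) and sends h/k + i to the image point of the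
cusp expansion. Comparing its law with that expansion and cancelling the nonzero value removes the
Dedekind sums from ω. -/
theorem omega_even {k h : ℕ} (hk : 0 < k) (hk2 : Even k) (hc : h.Coprime k)
    {h' b : ℤ} (hd : h * h' + b * k = -1) :
    omega 1 (-1) h k = cexp (2 * π * I * (h - h') / (24 * k)) *
      cexp (-(2 * π * I * ratioPhase h' b k (-h) / 48)) := by
  have hkc : (k : ℂ) ≠ 0 := by exact_mod_cast hk.ne'
  have hdc : (h : ℂ) * h' + b * k = -1 := by exact_mod_cast hd
  set τ : ℂ := h / k + I * 1 with hτ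
  have him : 0 < τ.im := by
    rw [hτ, ← ofReal_natCast, ← ofReal_natCast, ← ofReal_div, add_im, ofReal_im]; simp
  have h1 := etaRatio_transform_even hk hk2 hc (h' := h') ⟨-b, by linear_combination hd⟩ (ζ := 1) (by simp)
  have h2 := ratioLaw h' b k (-h) (by exact_mod_cast hk2) (by linear_combination -hd) τ him
  have e : ((h' : ℂ) * τ + b) / (((k : ℤ) : ℂ) * τ + (-h : ℤ)) = h' / k + I / (k ^ 2 * 1) := by
    have hden : (((k : ℤ) : ℂ) * τ + (-h : ℤ)) = k * I := by
      rw [hτ]; push_cast; field_simp; ring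
    rw [hden, hτ]
    field_simp
    linear_combination hdc - I_sq
  rw [e] at h2
  rw [← hτ, h2] at h1
  have hne := etaRatio_ne_zero him
  have h3 : omega 1 (-1) h k * cexp (2 * π * I * (h' - h) / (24 * k)) *
      cexp (2 * π * I * ratioPhase h' b k (-h) / 48) = 1 :=
    mul_right_cancel₀ hne (by rw [one_mul]; nth_rewrite 2 [h1]; ring)
  rw [show (2 * π * I * (h - h') / (24 * k) : ℂ) = -(2 * π * I * (h' - h) / (24 * k)) by ring,
    Complex.exp_neg, Complex.exp_neg, ← mul_inv]
  exact eq_inv_of_mul_eq_one_left (by rw [← h3]; ring)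

/-- The same comparison with the matrix (-b, h), (h', k), which lies in Γ₀(2) because h' is even.
The Fricke relation `etaRatio_mul_fricke` connects the two sides, and its constant √2 cancels. -/
theorem omega_odd {k h : ℕ} (hk2 : Odd k) (hc : h.Coprime k)
    {h' b : ℤ} (hd : h * h' + b * k = -1) (he : Even h') :
    omega 1 (-1) h k = cexp (2 * π * I * (2 * h + h') / (48 * k)) *
      cexp (2 * π * I * ratioPhase (-b) h h' k / 48) := by
  have hkc : (k : ℂ) ≠ 0 := by exact_mod_cast hk2.pos.ne'
  have hdc : (h : ℂ) * h' + b * k = -1 := by exact_mod_cast hd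
  set τ : ℂ := h / k + I * 1 with hτ
  have him : 0 < τ.im := by
    rw [hτ, ← ofReal_natCast, ← ofReal_natCast, ← ofReal_div, add_im, ofReal_im]; simp
  have h1 := etaRatio_transform_odd hk2 hc (h' := h') ⟨-b, by linear_combination hd⟩ he (ζ := 1) (by simp)
  set σ : ℂ := h' / k + I / (k ^ 2 * 1) with hσ
  have hσim : 0 < σ.im := by
    have : σ = ((h' / k : ℝ) : ℂ) + ((1 / k ^ 2 : ℝ) : ℂ) * I := by rw [hσ]; push_cast; ring
    have hk0 : (0 : ℝ) < k := by exact_mod_cast hk2.pos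
    rw [this, add_im, ofReal_im, im_ofReal_mul, I_im]
    positivity
  have hσ0 : σ ≠ 0 := fun h => by rw [h] at hσim; simp at hσim
  have hw : 0 < (-1 / σ).im := by
    have := im_moebius_pos (a := 0) (b := -1) (c := 1) (d := 0) (by norm_num) hσim
    simpa using this
  have h2 := ratioLaw (-b) h h' k he (by linear_combination -hd) (-1 / σ) hw
  have e : (((-b : ℤ) : ℂ) * (-1 / σ) + (h : ℤ)) / ((h' : ℂ) * (-1 / σ) + (k : ℤ)) = τ := by
    have hnum : (((-b : ℤ) : ℂ) * (-1 / σ) + (h : ℤ)) = (b + h * σ) / σ := by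
      push_cast; field_simp
    have hden : ((h' : ℂ) * (-1 / σ) + (k : ℤ)) = (k * σ - h') / σ := by
      push_cast; field_simp; ring
    have hks : (k : ℂ) * σ - h' = I / k := by rw [hσ]; field_simp; ring
    rw [hnum, hden, div_div_div_cancel_right₀ hσ0, hks, hτ, hσ,
      div_eq_iff (div_ne_zero I_ne_zero hkc)]
    have hb : (b : ℂ) = (-1 - h * h') / k := by rw [eq_div_iff hkc]; linear_combination hdc
    linear_combination hb - (1 / (k : ℂ)) * I_sq
  rw [e] at h2
  have h3 := etaRatio_mul_fricke hσim
  have hS : (2 : ℂ) ^ (1 / 2 : ℂ) ≠ 0 := by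
    rw [← h3]
    refine mul_ne_zero (etaRatio_ne_zero hw) (etaRatio_ne_zero ?_)
    simpa using hσim
  have h4 : cexp (2 * π * I * ratioPhase (-b) h h' k / 48) =
      omega 1 (-1) h k * cexp (-(2 * π * I * (2 * h + h') / (48 * k))) := by
    refine mul_right_cancel₀ hS ?_
    calc _ = (cexp (2 * π * I * ratioPhase (-b) h h' k / 48) * etaRatio (-1 / σ)) * etaRatio (σ / 2) := by
          rw [← h3]; ring
      _ = _ := by rw [← h2, hτ, h1]; ring
  rw [h4, mul_left_comm, ← Complex.exp_add, add_neg_cancel, Complex.exp_zero, mul_one]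

theorem omega_neg_eq_zpow (α : ℤ) (h k : ℕ) : omega α (-α) h k = omega 1 (-1) h k ^ α := by
  rw [omega, omega, ← Complex.exp_int_mul]
  congr 1
  push_cast
  ring

end

end EtaQuotient

/-! ### Kloosterman sums: fourth moment and squarefree moduli. -/

namespace EtaQuotient

noncomputable section

/-- The Kloosterman sum of parameters `a, b` over a finite ring, for the additive character `ψ`. -/
def kloosterman {R : Type*} [CommRing R] [Fintype Rˣ] (ψ : AddChar R ℂ) (a b : R) : ℂ :=
  ∑ x : Rˣ, ψ (a * x + b * (x⁻¹ : Rˣ))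

section field

variable {F : Type*} [Field F] [Fintype F] [DecidableEq F]

/-- If x + y = 0 then z + w = 0. Otherwise equality of the sums and of the sums of inverses forces
xy = zw, so {x, y} = {z, w}. Each of the three families has two free parameters. -/
theorem card_equal_sums_le :
    (Finset.univ.filter fun w : (Fˣ × Fˣ) × (Fˣ × Fˣ) =>
      (w.1.1 : F) + w.1.2 - (w.2.1 + w.2.2) = 0 ∧
      ((w.1.1⁻¹ : Fˣ) : F) + (w.1.2⁻¹ : Fˣ) - ((w.2.1⁻¹ : Fˣ) + (w.2.2⁻¹ : Fˣ)) = 0).card ≤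
      3 * Fintype.card Fˣ ^ 2 := by
  set f₁ : Fˣ × Fˣ → (Fˣ × Fˣ) × (Fˣ × Fˣ) := fun p => (p, p)
  set f₂ : Fˣ × Fˣ → (Fˣ × Fˣ) × (Fˣ × Fˣ) := fun p => (p, p.swap)
  set f₃ : Fˣ × Fˣ → (Fˣ × Fˣ) × (Fˣ × Fˣ) := fun p => ((p.1, -p.1), (p.2, -p.2))
  have hsub : (Finset.univ.filter fun w : (Fˣ × Fˣ) × (Fˣ × Fˣ) =>
      (w.1.1 : F) + w.1.2 - (w.2.1 + w.2.2) = 0 ∧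
      ((w.1.1⁻¹ : Fˣ) : F) + (w.1.2⁻¹ : Fˣ) - ((w.2.1⁻¹ : Fˣ) + (w.2.2⁻¹ : Fˣ)) = 0) ⊆
      (Finset.univ.image f₁ ∪ Finset.univ.image f₂) ∪ Finset.univ.image f₃ := by
    rintro ⟨⟨x, y⟩, z, w⟩ h
    simp only [Finset.mem_filter, Finset.mem_univ, true_and] at h
    obtain ⟨h1, h2⟩ := h
    have hx := x.ne_zero
    have hy := y.ne_zero
    have hz := z.ne_zero
    have hw := w.ne_zero
    simp only [Finset.mem_union, Finset.mem_image, Finset.mem_univ, true_and, f₁, f₂, f₃, Prod.exists,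
      Prod.mk.injEq, Prod.swap_prod_mk]
    by_cases hs : (x : F) + y = 0
    · right
      refine ⟨x, z, ⟨rfl, ?_⟩, rfl, ?_⟩
      · ext; push_cast; linear_combination -hs
      · ext; push_cast; linear_combination h1 - hs
    · left
      have hprod : (x : F) * y = z * w := by
        have h3 : ((x : F) + y) * (z * w - x * y) = 0 := by
          simp only [Units.val_inv_eq_inv_val] at h2
          field_simp at h2
          linear_combination h2 - (x : F) * y * h1
        have := (mul_eq_zero.1 h3).resolve_left hs
        linear_combination -this
      have h4 : ((x : F) - z) * (x - w) = 0 := by linear_combination (x : F) * h1 - hprod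
      rcases mul_eq_zero.1 h4 with h5 | h5
      · left
        refine ⟨x, y, ⟨rfl, rfl⟩, ?_, ?_⟩
        · ext; linear_combination h5
        · ext; linear_combination h1 - h5
      · right
        refine ⟨x, y, ⟨rfl, rfl⟩, ?_, ?_⟩
        · ext; linear_combination h1 - h5
        · ext; linear_combination h5
  have hi : ∀ f : Fˣ × Fˣ → (Fˣ × Fˣ) × (Fˣ × Fˣ), (Finset.univ.image f).card ≤ Fintype.card Fˣ ^ 2 :=
    fun f => Finset.card_image_le.trans (by rw [Finset.card_univ, Fintype.card_prod, sq])
  calc _ ≤ _ := Finset.card_le_card hsub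
    _ ≤ Fintype.card Fˣ ^ 2 + Fintype.card Fˣ ^ 2 + Fintype.card Fˣ ^ 2 :=
        (Finset.card_union_le _ _).trans (add_le_add ((Finset.card_union_le _ _).trans
          (add_le_add (hi _) (hi _))) (hi _))
    _ = _ := by ring

/-- The fourth moment of the Kloosterman sums over a finite field. -/
theorem sum_norm_kloosterman_pow_four_le {ψ : AddChar F ℂ} (hψ : ψ.IsPrimitive) :
    ∑ a : F, ∑ b : F, ‖kloosterman ψ a b‖ ^ 4 ≤
      3 * (Fintype.card F : ℝ) ^ 2 * (Fintype.card Fˣ : ℝ) ^ 2 := by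
  set σ : Fˣ × Fˣ → F := fun p => p.1 + p.2 with hσ
  set ρ : Fˣ × Fˣ → F := fun p => (p.1⁻¹ : Fˣ) + (p.2⁻¹ : Fˣ) with hρ
  have hsq : ∀ a b : F, kloosterman ψ a b ^ 2 = ∑ p : Fˣ × Fˣ, ψ (a * σ p + b * ρ p) := by
    intro a b
    rw [sq, kloosterman, Fintype.sum_mul_sum, Fintype.sum_prod_type]
    refine Finset.sum_congr rfl fun x _ => Finset.sum_congr rfl fun y _ => ?_
    rw [← AddChar.map_add_eq_mul]
    congr 1
    simp only [hσ, hρ]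
    ring
  have hfour : ∀ a b : F, ((‖kloosterman ψ a b‖ ^ 4 : ℝ) : ℂ) =
      ∑ w : (Fˣ × Fˣ) × (Fˣ × Fˣ), ψ (a * (σ w.1 - σ w.2)) * ψ (b * (ρ w.1 - ρ w.2)) := by
    intro a b
    have h1 : ((‖kloosterman ψ a b‖ ^ 4 : ℝ) : ℂ) =
        kloosterman ψ a b ^ 2 * (starRingEnd ℂ) (kloosterman ψ a b ^ 2) := by
      rw [Complex.mul_conj', norm_pow]; push_cast; ring
    rw [h1, hsq, map_sum, Fintype.sum_mul_sum]
    conv_rhs => rw [Fintype.sum_prod_type]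
    refine Finset.sum_congr rfl fun p _ => Finset.sum_congr rfl fun q _ => ?_
    rw [← AddChar.map_neg_eq_conj, ← AddChar.map_add_eq_mul, ← AddChar.map_add_eq_mul]
    congr 1
    ring
  have hC : ((∑ a : F, ∑ b : F, ‖kloosterman ψ a b‖ ^ 4 : ℝ) : ℂ) =
      ((((Finset.univ.filter fun w : (Fˣ × Fˣ) × (Fˣ × Fˣ) =>
        σ w.1 - σ w.2 = 0 ∧ ρ w.1 - ρ w.2 = 0).card : ℝ) * (Fintype.card F : ℝ) ^ 2 : ℝ) : ℂ) := by
    rw [Complex.ofReal_sum]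
    simp_rw [Complex.ofReal_sum, hfour]
    push_cast
    have : ∀ a : F, ∑ b : F, ∑ w : (Fˣ × Fˣ) × (Fˣ × Fˣ),
        ψ (a * (σ w.1 - σ w.2)) * ψ (b * (ρ w.1 - ρ w.2)) =
        ∑ w : (Fˣ × Fˣ) × (Fˣ × Fˣ), ψ (a * (σ w.1 - σ w.2)) * ∑ b : F, ψ (b * (ρ w.1 - ρ w.2)) := by
      intro a
      rw [Finset.sum_comm]
      exact Finset.sum_congr rfl fun w _ => by rw [Finset.mul_sum]
    simp_rw [this]
    rw [Finset.sum_comm]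
    -- Orthogonality in a and in b leaves only the quadruples counted by `card_equal_sums_le`.
    simp_rw [← Finset.sum_mul, AddChar.sum_mulShift _ hψ]
    rw [Finset.card_filter, Nat.cast_sum, Finset.sum_mul]
    refine Finset.sum_congr rfl fun w _ => ?_
    by_cases h1 : σ w.1 - σ w.2 = 0 <;> by_cases h2 : ρ w.1 - ρ w.2 = 0 <;> simp [h1, h2, sq]
  rw [Complex.ofReal_inj] at hC
  rw [hC]
  have : ((Finset.univ.filter fun w : (Fˣ × Fˣ) × (Fˣ × Fˣ) =>
        σ w.1 - σ w.2 = 0 ∧ ρ w.1 - ρ w.2 = 0).card : ℝ) ≤ 3 * (Fintype.card Fˣ : ℝ) ^ 2 := by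
    exact_mod_cast card_equal_sums_le (F := F)
  calc _ ≤ 3 * (Fintype.card Fˣ : ℝ) ^ 2 * (Fintype.card F : ℝ) ^ 2 := by gcongr
    _ = _ := by ring

/-- Substituting cx for x shows that the sums with parameters (c, B/c) are all equal, so one value
is repeated |Fˣ| times in the fourth moment. -/
theorem norm_kloosterman_pow_four_le {ψ : AddChar F ℂ} (hψ : ψ.IsPrimitive) (B : F) :
    ‖kloosterman ψ 1 B‖ ^ 4 ≤ 3 * (Fintype.card F : ℝ) ^ 3 := by
  have horb : ∀ c : Fˣ, kloosterman ψ c (B * (c⁻¹ : Fˣ)) = kloosterman ψ 1 B := by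
    intro c
    refine Fintype.sum_equiv (Equiv.mulLeft c) _ _ fun x => ?_
    congr 1
    rw [Equiv.coe_mulLeft, mul_inv, Units.val_mul, Units.val_mul]
    ring
  have h1 : (Fintype.card Fˣ : ℝ) * ‖kloosterman ψ 1 B‖ ^ 4 ≤
      3 * (Fintype.card F : ℝ) ^ 2 * (Fintype.card Fˣ : ℝ) ^ 2 := by
    refine le_trans ?_ (sum_norm_kloosterman_pow_four_le hψ)
    have h2 : (Fintype.card Fˣ : ℝ) * ‖kloosterman ψ 1 B‖ ^ 4 =
        ∑ c : Fˣ, ‖kloosterman ψ c (B * (c⁻¹ : Fˣ))‖ ^ 4 := by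
      simp_rw [horb]; simp
    rw [h2]
    calc _ ≤ ∑ c : Fˣ, ∑ b : F, ‖kloosterman ψ c b‖ ^ 4 := Finset.sum_le_sum fun c _ =>
          Finset.single_le_sum (f := fun b => ‖kloosterman ψ c b‖ ^ 4) (fun _ _ => by positivity)
            (Finset.mem_univ (B * (c⁻¹ : Fˣ)))
      _ = ∑ a ∈ Finset.univ.map ⟨((↑) : Fˣ → F), Units.val_injective⟩, ∑ b : F, ‖kloosterman ψ a b‖ ^ 4 := by
          rw [Finset.sum_map]; rfl
      _ ≤ _ := Finset.sum_le_sum_of_subset_of_nonneg (Finset.subset_univ _)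
            fun _ _ _ => by positivity
  have hU : (0 : ℝ) < Fintype.card Fˣ := by exact_mod_cast Fintype.card_pos
  have hle : (Fintype.card Fˣ : ℝ) ≤ Fintype.card F := by
    exact_mod_cast Fintype.card_le_of_injective ((↑) : Fˣ → F) Units.val_injective
  have h3 : ‖kloosterman ψ 1 B‖ ^ 4 ≤ 3 * (Fintype.card F : ℝ) ^ 2 * (Fintype.card Fˣ : ℝ) := by
    refine le_of_mul_le_mul_left ?_ hU
    linarith
  calc _ ≤ _ := h3
    _ ≤ 3 * (Fintype.card F : ℝ) ^ 2 * (Fintype.card F : ℝ) := by gcongr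
    _ = _ := by ring

/-- Since 243 = 3⁵, a field with q ≥ 243 elements absorbs the constant: (3q³)⁵ ≤ q¹⁶. A bound
without constant can be multiplied over the prime factors of the modulus. -/
theorem norm_kloosterman_pow_five_le {ψ : AddChar F ℂ} (hψ : ψ.IsPrimitive) (B : F)
    (hF : 243 ≤ Fintype.card F) : ‖kloosterman ψ 1 B‖ ^ 5 ≤ (Fintype.card F : ℝ) ^ 4 := by
  have h1 := norm_kloosterman_pow_four_le hψ B
  have hF' : (243 : ℝ) ≤ Fintype.card F := by exact_mod_cast hF
  refine le_of_pow_le_pow_left₀ (n := 4) (by norm_num) (by positivity) ?_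
  calc (‖kloosterman ψ 1 B‖ ^ 5) ^ 4 = (‖kloosterman ψ 1 B‖ ^ 4) ^ 5 := by ring
    _ ≤ (3 * (Fintype.card F : ℝ) ^ 3) ^ 5 := by gcongr
    _ = 243 * (Fintype.card F : ℝ) ^ 15 := by ring
    _ ≤ (Fintype.card F : ℝ) * (Fintype.card F : ℝ) ^ 15 := by gcongr
    _ = _ := by ring

end field

theorem kloosterman_prod {R S : Type*} [CommRing R] [CommRing S] [Fintype Rˣ] [Fintype Sˣ]
    [Fintype (R × S)ˣ] (ψ : AddChar (R × S) ℂ) (a b : R × S) :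
    kloosterman ψ a b = kloosterman (ψ.compAddMonoidHom (AddMonoidHom.inl R S)) a.1 b.1 *
      kloosterman (ψ.compAddMonoidHom (AddMonoidHom.inr R S)) a.2 b.2 := by
  simp only [kloosterman]
  rw [Fintype.sum_mul_sum, ← Fintype.sum_prod_type' (f := fun (x : Rˣ) (y : Sˣ) => _ * _)]
  refine Fintype.sum_equiv MulEquiv.prodUnits.toEquiv _ _ fun x => ?_
  simp only [AddChar.compAddMonoidHom_apply, ← AddChar.map_add_eq_mul]
  congr 1
  ext <;> simp [MulEquiv.prodUnits]

theorem kloosterman_equiv {R S : Type*} [CommRing R] [CommRing S] [Fintype Rˣ] [Fintype Sˣ]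
    (e : R ≃+* S) (ψ : AddChar R ℂ) (a b : R) :
    kloosterman ψ a b = kloosterman (ψ.compAddMonoidHom (e.symm : S →+ R)) (e a) (e b) := by
  refine Fintype.sum_equiv (Units.mapEquiv (e : R ≃* S)).toEquiv _ _ fun x => ?_
  rw [AddChar.compAddMonoidHom_apply]
  congr 1
  simp [← map_inv]

theorem isPrimitive_inl {R S : Type*} [CommRing R] [CommRing S] {ψ : AddChar (R × S) ℂ}
    (h : ψ.IsPrimitive) : (ψ.compAddMonoidHom (AddMonoidHom.inl R S)).IsPrimitive := by
  intro a ha h1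
  refine h (a := (a, 0)) (by simpa using ha) ?_
  ext x
  have := DFunLike.congr_fun h1 x.1
  simpa [AddChar.mulShift_apply, Prod.mul_def] using this

theorem isPrimitive_inr {R S : Type*} [CommRing R] [CommRing S] {ψ : AddChar (R × S) ℂ}
    (h : ψ.IsPrimitive) : (ψ.compAddMonoidHom (AddMonoidHom.inr R S)).IsPrimitive := by
  intro a ha h1
  refine h (a := (0, a)) (by simpa using ha) ?_
  ext x
  have := DFunLike.congr_fun h1 x.2
  simpa [AddChar.mulShift_apply, Prod.mul_def] using this

theorem isPrimitive_equiv {R S : Type*} [CommRing R] [CommRing S] (e : R ≃+* S) {ψ : AddChar R ℂ}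
    (h : ψ.IsPrimitive) : (ψ.compAddMonoidHom (e.symm : S →+ R)).IsPrimitive := by
  intro a ha h1
  refine h (a := e.symm a) (by simpa using ha) ?_
  ext x
  have := DFunLike.congr_fun h1 (e x)
  simpa [AddChar.mulShift_apply] using this

/-- A nontrivial bound for Kloosterman sums to squarefree moduli without small prime factors. -/
theorem norm_kloosterman_zmod_pow_five_le (s : ℕ) [NeZero s] (hs : Squarefree s)
    (hp : ∀ p, p.Prime → p ∣ s → 243 ≤ p) {ψ : AddChar (ZMod s) ℂ} (hψ : ψ.IsPrimitive) (B : ZMod s) :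
    ‖kloosterman ψ 1 B‖ ^ 5 ≤ (s : ℝ) ^ 4 := by
  revert ψ B
  revert hs hp
  have main : ∀ s : ℕ, ∀ [NeZero s], Squarefree s → (∀ p, p.Prime → p ∣ s → 243 ≤ p) →
      ∀ {ψ : AddChar (ZMod s) ℂ}, ψ.IsPrimitive → ∀ B : ZMod s,
      ‖kloosterman ψ 1 B‖ ^ 5 ≤ (s : ℝ) ^ 4 := by
    intro s
    induction s using induction_on_primes with
    | zero => intro h; exact absurd rfl h.out
    | one =>
      intro _ _ _ ψ _ B
      have : ‖kloosterman ψ 1 B‖ ≤ 1 := by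
        refine (norm_sum_le _ _).trans ?_
        simp_rw [AddChar.norm_apply]
        simp
      simpa using pow_le_one₀ (norm_nonneg _) this
    | prime_mul p m hp ih =>
      intro hne hs h243 ψ hψ B
      have : NeZero m := ⟨by rintro rfl; simp at hs⟩
      have : Fact p.Prime := ⟨hp⟩
      have hcop := (Nat.squarefree_mul_iff.1 hs).1
      set e := ZMod.chineseRemainder hcop with he
      rw [kloosterman_equiv e, kloosterman_prod, norm_mul, mul_pow]
      have h1 := isPrimitive_equiv e hψ
      have hA := norm_kloosterman_pow_five_le (isPrimitive_inl h1) (e B).1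
        (by rw [ZMod.card]; exact h243 p hp (dvd_mul_right _ _))
      have hB := ih (Nat.squarefree_mul_iff.1 hs).2.2
        (fun q hq hqm => h243 q hq (hqm.mul_left _)) (isPrimitive_inr h1) (e B).2
      rw [ZMod.card] at hA
      rw [map_one, Prod.fst_one, Prod.snd_one]
      push_cast
      rw [mul_pow]
      exact mul_le_mul hA hB (by positivity) (by positivity)
  exact fun hs hp ψ hψ B => main s hs hp hψ B

end

end EtaQuotient

/-! ### From weight-zero multipliers to Kloosterman sums. -/

namespace EtaQuotient

noncomputable section

open Complex

/-- The frequency of `h'`, in units of `1/(48k)`, in the summand of the Kloosterman sums of weight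
zero. -/
def cuspFreq (α : ℤ) (k j : ℕ) : ℤ := if Even k then -2 * (α - 24 * j) else α + 24 * j

/-- The part of the phase of the summand of the Kloosterman sums of weight zero, in units of
`1/48`, that only depends on residues modulo `48`. -/
def cuspPhase (α : ℤ) (k : ℕ) (h h' b : ℤ) : ℤ :=
  if Even k then -α * ratioPhase h' b k (-h) else α * ratioPhase (-b) h h' k

theorem cexp_int_congr {P Q : ℤ} {m : ℕ} (hm : 0 < m) (h : (m : ℤ) ∣ P - Q) :
    cexp (2 * π * I * P / m) = cexp (2 * π * I * Q / m) := by
  obtain ⟨r, hr⟩ := h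
  rw [Complex.exp_eq_exp_iff_exists_int]
  refine ⟨r, ?_⟩
  have hmc : (m : ℂ) ≠ 0 := by exact_mod_cast hm.ne'
  have : (P : ℂ) - Q = m * r := by exact_mod_cast hr
  field_simp
  linear_combination this

/-- Any admissible h', not only `hPrime`, may be used. This freedom is needed to choose h' with
prescribed residues both modulo 48t and modulo s. -/
theorem multiplier_eq (α : ℤ) (n j : ℕ) {k h : ℕ} (hk : 0 < k) (hc : h.Coprime k) {h' b : ℤ}
    (hd : h * h' + b * k = -1) (he : Odd k → Even h') :
    multiplier α (-α) n k h j =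
      cexp (2 * π * I * ((2 * (α - 24 * n) * h + cuspFreq α k j * h' : ℤ) : ℂ) / (48 * k)) *
        cexp (2 * π * I * cuspPhase α k h h' b / 48) := by
  have : NeZero k := ⟨hk.ne'⟩
  have hkc : (k : ℂ) ≠ 0 := by exact_mod_cast hk.ne'
  have hP := hPrime_modEq h k hc
  have hdvd : (k : ℤ) ∣ hPrime h k - h' := by
    have h1 : (k : ℤ) ∣ h * (hPrime h k - h') := by
      have := hP.symm.dvd
      have h2 : (h : ℤ) * (hPrime h k - h') = (h * hPrime h k - -1) + b * k := by
        linear_combination -hd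
      rw [h2]
      exact dvd_add this (dvd_mul_left _ _)
    exact (Nat.isCoprime_iff_coprime.2 hc.symm).dvd_of_dvd_mul_left h1
  rw [multiplier, omega_neg_eq_zpow]
  rcases Nat.even_or_odd k with hk2 | hk2
  · have hexp : cexp (2 * π * I * ((hPrime h k * j : ℤ) : ℂ) / k) =
        cexp (2 * π * I * ((h' * j : ℤ) : ℂ) / k) :=
      cexp_int_congr hk (by rw [← sub_mul]; exact hdvd.mul_right _)
    rw [omega_even hk hk2 hc hd, cuspFreq, cuspPhase, if_pos hk2, if_pos hk2, if_pos hk2, mul_zpow,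
      ← Complex.exp_int_mul, ← Complex.exp_int_mul, Complex.exp_add]
    rw [show (2 * π * I * hPrime h k * j / k : ℂ) = 2 * π * I * ((hPrime h k * j : ℤ) : ℂ) / k by
      push_cast; ring, hexp, ← Complex.exp_add, ← Complex.exp_add, ← Complex.exp_add, ← Complex.exp_add]
    congr 1
    push_cast
    field_simp
    ring
  · have hne : ¬ Even k := Nat.not_even_iff_odd.2 hk2
    have h2k : ((2 * k : ℕ) : ℤ) ∣ hPrime h k - h' := by
      have h1 : (2 : ℤ) ∣ hPrime h k - h' := by
        refine even_iff_two_dvd.1 (Even.sub ?_ (he hk2))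
        exact_mod_cast hPrime_even h k hk2
      push_cast
      refine IsCoprime.mul_dvd ?_ h1 hdvd
      rw [Int.isCoprime_iff_gcd_eq_one]
      exact_mod_cast (Nat.coprime_two_left.2 hk2)
    have hexp : cexp (2 * π * I * ((hPrime h k * j : ℤ) : ℂ) / (2 * k : ℕ)) =
        cexp (2 * π * I * ((h' * j : ℤ) : ℂ) / (2 * k : ℕ)) :=
      cexp_int_congr (by omega) (by rw [← sub_mul]; exact h2k.mul_right _)
    rw [omega_odd hk2 hc hd (he hk2), cuspFreq, cuspPhase, if_neg hne, if_neg hne, if_neg hne, mul_zpow,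
      ← Complex.exp_int_mul, ← Complex.exp_int_mul, Complex.exp_add]
    rw [show (1 * π * I * hPrime h k * j / k : ℂ) = 2 * π * I * ((hPrime h k * j : ℤ) : ℂ) / (2 * k : ℕ) by
      push_cast; field_simp, hexp, ← Complex.exp_add, ← Complex.exp_add, ← Complex.exp_add, ← Complex.exp_add]
    congr 1
    push_cast
    field_simp
    ring

theorem ratioPhase_congr {a b c d a' b' c' d' : ℤ} (ha : (a : ZMod 48) = a') (hb : (b : ZMod 48) = b')
    (hc : (c : ZMod 48) = c') (hd : (d : ZMod 48) = d') :
    (ratioPhase a b c d : ZMod 48) = ratioPhase a' b' c' d' := by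
  unfold ratioPhase
  push_cast
  rw [ha, hb, hc, hd]

theorem cuspPhase_congr (α : ℤ) (k : ℕ) {h g h' g' b b' : ℤ} (hh : (48 : ℤ) ∣ h - g)
    (hh' : (48 : ℤ) ∣ h' - g') (hb : (48 : ℤ) ∣ b - b') :
    (48 : ℤ) ∣ cuspPhase α k h h' b - cuspPhase α k g g' b' := by
  have e : ∀ x y : ℤ, (48 : ℤ) ∣ x - y ↔ (x : ZMod 48) = y := fun x y => by
    rw [eq_comm, ZMod.intCast_eq_intCast_iff_dvd_sub]; rfl
  rw [e] at *
  unfold cuspPhase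
  split_ifs
  · push_cast
    rw [ratioPhase_congr hh' hb rfl (d' := -g) (by push_cast; rw [hh])]
  · push_cast
    rw [ratioPhase_congr (a' := -b') (by push_cast; rw [hb]) hh hh' rfl]

theorem multiplier_mod (α β : ℤ) (n j : ℕ) {k : ℕ} (hk : 0 < k) (h : ℕ) :
    multiplier α β n k (h % k) j = multiplier α β n k h j := by
  have h1 : hPrime (h % k) k = hPrime h k := by
    unfold hPrime
    rw [ZMod.natCast_mod]
  have h2 : omega α β (h % k) k = omega α β h k := by
    unfold omega
    rw [dedekindSum_congr hk (Nat.mod_modEq h k),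
      dedekindSum_congr hk ((Nat.mod_modEq h k).mul_left 2)]
  have h3 : cexp (2 * π * I * ((-(n * (h % k : ℕ)) : ℤ) : ℂ) / k) = cexp (2 * π * I * ((-(n * h) : ℤ) : ℂ) / k) :=
    cexp_int_congr hk (by
      rw [show (-((n : ℤ) * (h % k : ℕ)) - -(n * h)) = n * (h - (h % k : ℕ)) by ring]
      refine Dvd.dvd.mul_left ?_ _
      exact (Nat.modEq_iff_dvd.1 (Nat.mod_modEq h k)))
  unfold multiplier
  rw [h1, h2, Complex.exp_add, Complex.exp_add,
    show (-(2 * π * I * n * (h % k : ℕ) / k) : ℂ) = 2 * π * I * ((-(n * (h % k : ℕ)) : ℤ) : ℂ) / k by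
      simp only [Int.cast_neg, Int.cast_mul, Int.cast_natCast]; ring, h3]
  rw [show (2 * π * I * ((-(n * h) : ℤ) : ℂ) / k : ℂ) = -(2 * π * I * n * h / k) by push_cast; ring]

theorem dvd_mul_add_one {m a b c d : ℤ} (h1 : m ∣ a - b) (h2 : m ∣ c - d) (h3 : m ∣ b * d + 1) :
    m ∣ a * c + 1 := by
  have : a * c + 1 = c * (a - b) + b * (c - d) + (b * d + 1) := by ring
  rw [this]
  exact dvd_add (dvd_add (h1.mul_left _) (h2.mul_left _)) h3

theorem kloosterman_unit_mul {R : Type*} [CommRing R] [Fintype Rˣ] (ψ : AddChar R ℂ) (u : Rˣ) (b : R) :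
    kloosterman ψ u b = kloosterman (ψ.mulShift u) 1 ((u⁻¹ : Rˣ) * b) := by
  refine Finset.sum_congr rfl fun x _ => ?_
  rw [AddChar.mulShift_apply]
  congr 1
  have := u.mul_inv
  linear_combination (-b * ((x⁻¹ : Rˣ) : R)) * this

theorem isPrimitive_mulShift {R : Type*} [CommRing R] {ψ : AddChar R ℂ} (h : ψ.IsPrimitive) (u : Rˣ) :
    (ψ.mulShift (u : R)).IsPrimitive := by
  intro a ha h1
  rw [AddChar.mulShift_mulShift] at h1
  exact h (a := u * a) (by simpa using ha) h1

section lifts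

variable {s t : ℕ}

/-- Fix one g in the class. Multipliers do not change modulo k, so each h may be replaced by a lift
congruent to g modulo 48t and to a unit x modulo s, with h' congruent to g' modulo 48t and to -1/x
modulo s. Then `cuspPhase` is constant and what varies with x is a Kloosterman summand modulo s. -/
theorem norm_sum_fiber_le (α : ℤ) (n j : ℕ) (ht : 0 < t) (hs0 : 0 < s) (hs : Squarefree s)
    (hp : ∀ p, p.Prime → p ∣ s → 243 ≤ p) (hst : s.Coprime t)
    (hα : IsCoprime (α - 24 * n) (s : ℤ)) (r : ℕ) :
    ‖∑ h ∈ (units (t * s)).filter (fun h => h % t = r), multiplier α (-α) n (t * s) h j‖ ^ 5 ≤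
      (s : ℝ) ^ 4 := by
  have : NeZero s := ⟨hs0.ne'⟩
  set k := t * s with hk
  have hk0 : 0 < k := Nat.mul_pos ht hs0
  have : NeZero k := ⟨hk0.ne'⟩
  rcases ((units k).filter (fun h => h % t = r)).eq_empty_or_nonempty with hemp | ⟨g, hg⟩
  · rw [hemp, Finset.sum_empty, norm_zero]; simp
  rw [Finset.mem_filter, mem_units] at hg
  obtain ⟨⟨_, hgc⟩, hgr⟩ := hg
  have hs48 : s.Coprime 48 := by
    refine Nat.coprime_of_dvd fun p hpp hps hp48 => ?_
    have := hp p hpp hps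
    have := Nat.le_of_dvd (by norm_num) hp48
    omega
  have hco : (48 * t).Coprime s := (Nat.Coprime.mul_right hs48 hst).symm
  -- Idempotents for the coprime moduli 48t and s.
  obtain ⟨e₁, h11, h12⟩ := Nat.chineseRemainder hco 1 0
  obtain ⟨e₂, h21, h22⟩ := Nat.chineseRemainder hco 0 1
  obtain ⟨f, hf⟩ := (Nat.modEq_zero_iff_dvd.1 h21)
  obtain ⟨e₃, he₃⟩ := (Nat.modEq_zero_iff_dvd.1 h12)
  obtain ⟨u, hu⟩ := h11.symm.dvd
  obtain ⟨v, hv⟩ := h22.symm.dvd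
  push_cast at hu hv
  set g' : ℤ := (hPrime g k : ℤ) with hg'
  have hgg : (k : ℤ) ∣ g * g' + 1 := by
    have := (hPrime_modEq g k hgc).symm.dvd
    simpa using this
  set X : (ZMod s)ˣ → ℕ := fun x => (x : ZMod s).val with hX
  set Ht : (ZMod s)ˣ → ℕ := fun x => g * e₁ + X x * e₂ with hHt
  set H' : (ZMod s)ˣ → ℤ := fun x => g' * e₁ - X x⁻¹ * e₂ with hH'
  have hfz : (e₂ : ℤ) = 48 * t * f := by exact_mod_cast hf
  have he₃z : (e₁ : ℤ) = s * e₃ := by exact_mod_cast he₃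
  have d1 : ∀ x, (48 * t : ℤ) ∣ Ht x - g := fun x =>
    ⟨g * u + X x * f, by simp only [hHt]; push_cast; linear_combination (g : ℤ) * hu + (X x : ℤ) * hfz⟩
  have d2 : ∀ x, (48 * t : ℤ) ∣ H' x - g' := fun x =>
    ⟨g' * u - X x⁻¹ * f, by simp only [hH']; linear_combination g' * hu - (X x⁻¹ : ℤ) * hfz⟩
  have d3 : ∀ x, (s : ℤ) ∣ Ht x - X x := fun x =>
    ⟨g * e₃ + X x * v, by
      simp only [hHt]; push_cast; linear_combination (g : ℤ) * he₃z + (X x : ℤ) * hv⟩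
  have d4 : ∀ x, (s : ℤ) ∣ H' x + X x⁻¹ := fun x =>
    ⟨g' * e₃ - X x⁻¹ * v, by
      simp only [hH']; linear_combination g' * he₃z - (X x⁻¹ : ℤ) * hv⟩
  have d5 : ∀ x, (s : ℤ) ∣ X x * X x⁻¹ - 1 := fun x => by
    rw [← ZMod.intCast_zmod_eq_zero_iff_dvd]
    simp [hX]
  have htk : (t : ℤ) ∣ k := by rw [hk]; push_cast; exact dvd_mul_right _ _
  have hsk : (s : ℤ) ∣ k := by rw [hk]; push_cast; exact dvd_mul_left _ _
  have dk : ∀ x, (k : ℤ) ∣ Ht x * H' x + 1 := fun x => by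
    rw [hk]
    push_cast
    refine IsCoprime.mul_dvd (Nat.isCoprime_iff_coprime.2 hst.symm) ?_ ?_
    · exact dvd_mul_add_one ((dvd_mul_left (t : ℤ) 48).trans (d1 x))
        ((dvd_mul_left (t : ℤ) 48).trans (d2 x)) (htk.trans hgg)
    · refine dvd_mul_add_one (d3 x) (d := -X x⁻¹) (by simpa using d4 x) ?_
      rw [show (X x : ℤ) * -X x⁻¹ + 1 = -(X x * X x⁻¹ - 1) by ring]
      exact (d5 x).neg_right
  choose B hB using dk
  have hcopHt : ∀ x, (Ht x).Coprime k := fun x => by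
    rw [← Nat.isCoprime_iff_coprime]
    exact ⟨-H' x, B x, by linear_combination -hB x⟩
  have heven : ∀ x, Odd k → Even (H' x) := fun x ho => by
    have h1 : Even g' := by rw [hg']; exact_mod_cast hPrime_even g k ho
    have h2 : (2 : ℤ) ∣ H' x - g' := Dvd.dvd.trans ⟨24 * t, by ring⟩ (d2 x)
    have := h1.add (even_iff_two_dvd.2 h2)
    rwa [add_sub_cancel] at this
  -- The products h h' agree modulo 48t, so k(B x - B 1) is divisible by 48t. Cancel t, then s,
  -- which is coprime to 48.
  have h48B : ∀ x, (48 : ℤ) ∣ B x - B 1 := fun x => by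
    have h1 : (48 * t : ℤ) ∣ k * (B x - B 1) := by
      rw [show (k : ℤ) * (B x - B 1) = H' x * ((Ht x - g) - (Ht 1 - g)) + Ht 1 * ((H' x - g') - (H' 1 - g')) by
        linear_combination hB 1 - hB x]
      exact dvd_add ((dvd_sub (d1 x) (d1 1)).mul_left _) ((dvd_sub (d2 x) (d2 1)).mul_left _)
    have h2 : (48 : ℤ) ∣ s * (B x - B 1) := by
      refine Int.dvd_of_mul_dvd_mul_left (a := (t : ℤ)) (by exact_mod_cast ht.ne') ?_
      rw [hk] at h1
      push_cast at h1
      rwa [mul_comm (t : ℤ) 48, ← mul_assoc]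
    refine IsCoprime.dvd_of_dvd_mul_left ?_ h2
    exact_mod_cast Nat.isCoprime_iff_coprime.2 hs48.symm
  set Nn : ℤ := 2 * (α - 24 * n) with hNn
  set m : ℤ := cuspFreq α k j with hm
  -- The integer f is inverse to 48t modulo s, s is odd, and α - 24n is coprime to s. The unit
  -- coefficient of x permits the primitive-character bound whatever the coefficient of 1/x.
  have hunit : IsUnit ((f * Nn : ℤ) : ZMod s) := by
    rw [ZMod.coe_int_isUnit_iff_isCoprime]
    refine IsCoprime.mul_right ⟨-v, 48 * t, by linear_combination hv - hfz⟩ (IsCoprime.mul_right ?_ hα.symm)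
    exact_mod_cast Nat.isCoprime_iff_coprime.2 (hs48.coprime_dvd_right (by norm_num : 2 ∣ 48))
  obtain ⟨w, hw⟩ := hunit
  have hval : ∀ x, multiplier α (-α) n k (Ht x) j =
      (cexp (2 * π * I * (((Nn * g + m * g') * e₁ : ℤ) : ℂ) / (48 * k)) *
        cexp (2 * π * I * cuspPhase α k (Ht 1) (H' 1) (-B 1) / 48)) *
      ZMod.stdAddChar (N := s) ((w : ZMod s) * (x : ZMod s) +
        ((-(f * m) : ℤ) : ZMod s) * (x⁻¹ : (ZMod s)ˣ)) := by
    intro x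
    have hph : cexp (2 * π * I * cuspPhase α k (Ht x) (H' x) (-B x) / 48) =
        cexp (2 * π * I * cuspPhase α k (Ht 1) (H' 1) (-B 1) / 48) := by
      refine cexp_congr_phase (cuspPhase_congr α k ?_ ?_ ?_)
      · have := (dvd_mul_right (48 : ℤ) t).trans (dvd_sub (d1 x) (d1 1))
        rwa [sub_sub_sub_cancel_right] at this
      · have := (dvd_mul_right (48 : ℤ) t).trans (dvd_sub (d2 x) (d2 1))
        rwa [sub_sub_sub_cancel_right] at this
      · have := (h48B x).neg_right
        rwa [neg_sub, ← neg_sub_neg] at this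
    have hz : (w : ZMod s) * x + ((-(f * m) : ℤ) : ZMod s) * (x⁻¹ : (ZMod s)ˣ) =
        ((f * Nn * X x - f * m * X x⁻¹ : ℤ) : ZMod s) := by
      rw [hw]
      push_cast
      simp only [hX, ZMod.natCast_val, ZMod.cast_id', id_eq]
      ring
    have hexp : cexp (2 * π * I * ((Nn * Ht x + m * H' x : ℤ) : ℂ) / (48 * k)) =
        cexp (2 * π * I * (((Nn * g + m * g') * e₁ : ℤ) : ℂ) / (48 * k)) *
          cexp (2 * π * I * ((f * Nn * X x - f * m * X x⁻¹ : ℤ) : ℂ) / s) := by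
      have hsc : (s : ℂ) ≠ 0 := by exact_mod_cast hs0.ne'
      have htc : (t : ℂ) ≠ 0 := by exact_mod_cast ht.ne'
      have hfc : (e₂ : ℂ) = 48 * t * f := by exact_mod_cast hf
      rw [← Complex.exp_add]
      congr 1
      simp only [hHt, hH', hk]
      push_cast
      rw [hfc]
      field_simp
      ring
    rw [multiplier_eq α n j hk0 (hcopHt x) (h' := H' x) (b := -B x) (by linear_combination hB x) (heven x),
      hph, hz, ZMod.stdAddChar_coe, hexp]
    ring
  have hsum : ∑ h ∈ (units k).filter (fun h => h % t = r), multiplier α (-α) n k h j =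
      ∑ x : (ZMod s)ˣ, multiplier α (-α) n k (Ht x) j := by
    symm
    have hmodt : ∀ x, Ht x ≡ g [MOD t] := fun x =>
      (Nat.modEq_iff_dvd.2 ((dvd_mul_left (t : ℤ) 48).trans (d1 x))).symm
    have hmods : ∀ x, Ht x ≡ X x [MOD s] := fun x => (Nat.modEq_iff_dvd.2 (d3 x)).symm
    refine Finset.sum_bij (fun x _ => Ht x % k) ?_ ?_ ?_ ?_
    · intro x _
      rw [Finset.mem_filter, mem_units, hk, Nat.mod_mul_right_mod, ← hk, hmodt x]
      refine ⟨⟨Nat.mod_lt _ hk0, ?_⟩, hgr⟩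
      exact (Nat.ModEq.gcd_eq (Nat.mod_modEq _ _)).trans (hcopHt x)
    · intro x _ y _ hxy
      have h1 : Ht x ≡ Ht y [MOD s] := Nat.ModEq.of_dvd (Dvd.intro_left t rfl) hxy
      have h2 := ((hmods x).symm.trans h1).trans (hmods y)
      rw [← ZMod.natCast_eq_natCast_iff] at h2
      ext
      simpa [hX] using h2
    · intro h hh
      rw [Finset.mem_filter, mem_units] at hh
      have hcs : h.Coprime s := Nat.Coprime.coprime_dvd_right (Dvd.intro_left t rfl) hh.1.2
      refine ⟨ZMod.unitOfCoprime h hcs, Finset.mem_univ _, ?_⟩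
      have h1 : Ht (ZMod.unitOfCoprime h hcs) ≡ h [MOD t] :=
        (hmodt _).trans (show g % t = h % t by rw [hgr, hh.2])
      have h2 : Ht (ZMod.unitOfCoprime h hcs) ≡ h [MOD s] := by
        refine (hmods _).trans ?_
        rw [← ZMod.natCast_eq_natCast_iff]
        simp [hX]
      have h3 : Ht (ZMod.unitOfCoprime h hcs) ≡ h [MOD k] :=
        (Nat.modEq_and_modEq_iff_modEq_mul hst.symm).1 ⟨h1, h2⟩
      rw [h3, Nat.mod_eq_of_lt hh.1.1]
    · intro x _
      rw [multiplier_mod α (-α) n j hk0]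
  rw [hsum]
  simp_rw [hval]
  rw [← Finset.mul_sum]
  have hC : ‖cexp (2 * π * I * (((Nn * g + m * g') * e₁ : ℤ) : ℂ) / (48 * k)) *
        cexp (2 * π * I * cuspPhase α k (Ht 1) (H' 1) (-B 1) / 48)‖ = 1 := by
    rw [norm_mul, show (2 * π * I * (((Nn * g + m * g') * e₁ : ℤ) : ℂ) / (48 * k)) =
      ((2 * π * ((Nn * g + m * g') * e₁ : ℤ) / (48 * k) : ℝ) : ℂ) * I by push_cast; ring,
      show (2 * π * I * cuspPhase α k (Ht 1) (H' 1) (-B 1) / 48 : ℂ) =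
      ((2 * π * cuspPhase α k (Ht 1) (H' 1) (-B 1) / 48 : ℝ) : ℂ) * I by push_cast; ring,
      norm_exp_ofReal_mul_I, norm_exp_ofReal_mul_I, one_mul]
  rw [norm_mul, hC, one_mul]
  have := norm_kloosterman_zmod_pow_five_le s hs hp
    (isPrimitive_mulShift (ZMod.isPrimitive_stdAddChar s) w) ((w⁻¹ : (ZMod s)ˣ) * ((-(f * m) : ℤ) : ZMod s))
  rw [← kloosterman_unit_mul] at this
  exact this

/-- A bound for the Kloosterman sums of weight zero. -/
theorem norm_sum_multiplier_le (α : ℤ) (n j : ℕ) (ht : 0 < t) (hs0 : 0 < s) (hs : Squarefree s)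
    (hp : ∀ p, p.Prime → p ∣ s → 243 ≤ p) (hst : s.Coprime t)
    (hα : IsCoprime (α - 24 * n) (s : ℤ)) :
    ‖∑ h ∈ units (t * s), multiplier α (-α) n (t * s) h j‖ ≤ t * (s : ℝ) ^ (4 / 5 : ℝ) := by
  rw [← Finset.sum_fiberwise_of_maps_to (t := Finset.range t) (g := fun h => h % t)
    fun h _ => Finset.mem_range.2 (Nat.mod_lt _ ht)]
  refine (norm_sum_le _ _).trans ?_
  refine (Finset.sum_le_sum (g := fun _ => (s : ℝ) ^ (4 / 5 : ℝ)) fun r _ => ?_).trans_eq (by simp)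
  refine le_of_pow_le_pow_left₀ (n := 5) (by norm_num) (by positivity) ?_
  rw [← Real.rpow_mul_natCast (by positivity)]
  norm_num
  exact_mod_cast norm_sum_fiber_le α n j ht hs0 hs hp hst hα r

end lifts

end

end EtaQuotient

/-! ### Completing the sums, summability over k, and weight zero. -/

namespace EtaQuotient

noncomputable section

open Complex

theorem sum_zmod_eq_sum_range {M : Type*} [AddCommMonoid M] (k : ℕ) [NeZero k] (F : ZMod k → M) :
    ∑ l : ZMod k, F l = ∑ m ∈ Finset.range k, F m := by
  symm
  refine Finset.sum_bij (fun m _ => (m : ZMod k)) (fun _ _ => Finset.mem_univ _) ?_ ?_ fun _ _ => rfl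
  · intro x hx y hy hxy
    rw [ZMod.natCast_eq_natCast_iff, Nat.ModEq, Nat.mod_eq_of_lt (Finset.mem_range.1 hx),
      Nat.mod_eq_of_lt (Finset.mem_range.1 hy)] at hxy
    exact hxy
  · intro l _
    exact ⟨l.val, Finset.mem_range.2 (ZMod.val_lt l), by simp⟩

theorem two_mul_mul_le_sin {x : ℝ} (h0 : 0 ≤ x) (h1 : x ≤ 1) : 2 * (x * (1 - x)) ≤ Real.sin (π * x) := by
  have hpi := Real.pi_pos
  have key : ∀ y : ℝ, 0 ≤ y → y ≤ 1 / 2 → 2 * y ≤ Real.sin (π * y) := fun y hy hy' => by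
    have := Real.mul_le_sin (x := π * y) (by positivity) (by nlinarith)
    calc 2 * y = 2 / π * (π * y) := by field_simp
      _ ≤ _ := this
  rcases le_total x (1 / 2) with h | h
  · have := key x h0 h
    nlinarith
  · have := key (1 - x) (by linarith) (by linarith)
    rw [show π * (1 - x) = π - π * x by ring, Real.sin_pi_sub] at this
    nlinarith

/-- A geometric sum is at most 2/|z - 1|, and |z - 1| = 2 sin(πm/k) ≥ 4(m/k)(1 - m/k). Partial
fractions give the symmetric form. -/
theorem norm_sum_stdAddChar_le {k m : ℕ} [NeZero k] (hm : 0 < m) (hmk : m < k) (A : ℤ) (N : ℕ) :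
    ‖∑ i ∈ Finset.range N, ZMod.stdAddChar (N := k) (-(m : ZMod k) * ((A + i : ℤ) : ZMod k))‖ ≤
      (k : ℝ) * ((1 / (m : ℝ) + 1 / ((k - m : ℕ) : ℝ)) / 2) := by
  have hk0 : (0 : ℝ) < k := by exact_mod_cast hm.trans hmk
  have hm0 : (0 : ℝ) < m := by exact_mod_cast hm
  have hkm : ((k - m : ℕ) : ℝ) = k - m := by push_cast [hmk.le]; ring
  have hkm0 : (0 : ℝ) < k - m := by rw [← hkm]; exact_mod_cast Nat.sub_pos_of_lt hmk
  set z : ℂ := ZMod.stdAddChar (N := k) (-(m : ZMod k)) with hz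
  have hterm : ∀ i : ℕ, ZMod.stdAddChar (N := k) (-(m : ZMod k) * ((A + i : ℤ) : ZMod k)) =
      ZMod.stdAddChar (N := k) (-(m : ZMod k) * (A : ZMod k)) * z ^ i := by
    intro i
    rw [hz, ← AddChar.map_nsmul_eq_pow, ← AddChar.map_add_eq_mul]
    congr 1
    push_cast
    simp only [nsmul_eq_mul]
    ring
  have hznorm : ‖z‖ = 1 := AddChar.norm_apply _ _
  have hz1 : ‖z - 1‖ = 2 * Real.sin (π * (m / k)) := by
    have hzexp : z = cexp (I * ((-(2 * π * (m / k)) : ℝ) : ℂ)) := by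
      have := ZMod.stdAddChar_coe (N := k) (-(m : ℤ))
      rw [hz]
      push_cast at this ⊢
      rw [this]
      congr 1
      ring
    rw [hzexp, Complex.norm_exp_I_mul_ofReal_sub_one,
      show -(2 * π * (m / k)) / 2 = -(π * ((m : ℝ) / k)) by ring, Real.sin_neg, mul_neg, norm_neg,
      Real.norm_of_nonneg]
    have := two_mul_mul_le_sin (x := (m : ℝ) / k) (by positivity) ((div_le_one hk0).2 (by linarith))
    have h2 : (m : ℝ) / k ≤ 1 := (div_le_one hk0).2 (by linarith)
    have : 0 ≤ (m : ℝ) / k * (1 - m / k) := mul_nonneg (by positivity) (by linarith)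
    linarith
  have hlow : 4 * ((m : ℝ) / k * (1 - m / k)) ≤ ‖z - 1‖ := by
    rw [hz1]
    have := two_mul_mul_le_sin (x := (m : ℝ) / k) (by positivity) ((div_le_one hk0).2 (by linarith))
    linarith
  have hpos : 0 < 4 * ((m : ℝ) / k * (1 - m / k)) := by
    have : 1 - (m : ℝ) / k = (k - m) / k := by field_simp
    rw [this]; positivity
  have hzne : z ≠ 1 := fun h => by rw [h, sub_self, norm_zero] at hlow; linarith
  simp_rw [hterm]
  rw [← Finset.mul_sum, norm_mul, AddChar.norm_apply, one_mul, geom_sum_eq hzne, norm_div, hkm]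
  calc ‖z ^ N - 1‖ / ‖z - 1‖ ≤ 2 / (4 * ((m : ℝ) / k * (1 - m / k))) := by
        gcongr
        refine (norm_sub_le _ _).trans ?_
        rw [norm_pow, hznorm, one_pow, norm_one]; norm_num
    _ = _ := by
        have : (k : ℝ) - m ≠ 0 := hkm0.ne'
        have h1 : 1 - (m : ℝ) / k = (k - m) / k := by field_simp
        rw [h1]
        field_simp
        ring

theorem sum_one_div_le (k : ℕ) :
    ∑ m ∈ Finset.Ico 1 k, (1 / (m : ℝ) + 1 / ((k - m : ℕ) : ℝ)) / 2 ≤ 1 + Real.log k := by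
  have h1 : ∑ m ∈ Finset.Ico 1 k, 1 / ((k - m : ℕ) : ℝ) = ∑ m ∈ Finset.Ico 1 k, 1 / (m : ℝ) := by
    refine Finset.sum_nbij' (fun m => k - m) (fun m => k - m) ?_ ?_ ?_ ?_ fun _ _ => rfl <;>
      intro m hm <;> simp only [Finset.mem_Ico] at * <;> omega
  rw [← Finset.sum_div, Finset.sum_add_distrib, h1, ← two_mul, mul_div_cancel_left₀ _ two_ne_zero]
  have h2 := harmonic_le_one_add_log k
  rw [harmonic_eq_sum_Icc] at h2
  push_cast at h2
  refine le_trans ?_ h2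
  simp_rw [one_div]
  refine Finset.sum_le_sum_of_subset_of_nonneg ?_ fun _ _ _ => by positivity
  intro m hm
  simp only [Finset.mem_Ico, Finset.mem_Icc] at *
  omega

theorem exists_mem_Ioc_iff {k : ℕ} {h : ℕ} (hc : h.Coprime k) {d' A B : ℤ} (hd : (k : ℤ) ∣ h * d' + 1) :
    (∃ d : ℤ, A < d ∧ d ≤ B ∧ (k : ℤ) ∣ h * d + 1) ↔ ∃ d ∈ Finset.Ioc A B, (k : ℤ) ∣ d' - d := by
  have key : ∀ d : ℤ, (k : ℤ) ∣ h * d + 1 ↔ (k : ℤ) ∣ d' - d := fun d => by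
    constructor
    · intro h1
      have h2 : (k : ℤ) ∣ h * (d' - d) := by
        have := dvd_sub hd h1
        rwa [add_sub_add_right_eq_sub, ← mul_sub] at this
      exact (Nat.isCoprime_iff_coprime.2 hc.symm).dvd_of_dvd_mul_left h2
    · intro h1
      have := dvd_sub hd (h1.mul_left (h : ℤ))
      rwa [show (h : ℤ) * d' + 1 - h * (d' - d) = h * d + 1 by ring] at this
  simp only [Finset.mem_Ioc, key, and_assoc]

/-- Incomplete sums over `h`, with `-1/h` restricted to an interval modulo `k`, are bounded by the
complete twisted sums, up to a logarithm. -/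
theorem norm_sum_unitsIn_le {k : ℕ} (hk : 0 < k) {θ : ℕ → ℂ} {M : ℝ}
    (hM : ∀ m : ℕ, ‖∑ h ∈ units k, θ h * cexp (2 * π * I * hPrime h k * m / k)‖ ≤ M)
    {A B : ℤ} (hAB : A ≤ B) (hBA : B ≤ A + k) :
    ‖∑ h ∈ unitsIn k A B, θ h‖ ≤ (2 + Real.log k) * M := by
  classical
  have : NeZero k := ⟨hk.ne'⟩
  have hk0 : (0 : ℝ) < k := by exact_mod_cast hk
  have hkc : (k : ℂ) ≠ 0 := by exact_mod_cast hk.ne'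
  have hM0 : 0 ≤ M := (norm_nonneg _).trans (hM 0)
  obtain ⟨N, hN⟩ := Int.eq_ofNat_of_zero_le (sub_nonneg.2 hAB)
  have hNk : N ≤ k := by omega
  -- Unnormalised Fourier coefficients of the indicator of (A, B] modulo k. Since N ≤ k, the
  -- interval meets each residue class at most once.
  set c : ZMod k → ℂ := fun l =>
    ∑ i ∈ Finset.range N, ZMod.stdAddChar (N := k) (-l * ((A + 1 + i : ℤ) : ZMod k)) with hc
  have hind : ∀ h ∈ units k, (if ∃ d : ℤ, A < d ∧ d ≤ B ∧ (k : ℤ) ∣ h * d + 1 then (k : ℂ) else 0) =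
      ∑ l : ZMod k, c l * ZMod.stdAddChar (N := k) (l * (hPrime h k : ZMod k)) := by
    intro h hh
    have hcop := (mem_units.1 hh).2
    have hd : (k : ℤ) ∣ h * (hPrime h k : ℤ) + 1 := by
      have := (hPrime_modEq h k hcop).symm.dvd
      simpa using this
    have h1 : ∑ l : ZMod k, c l * ZMod.stdAddChar (N := k) (l * (hPrime h k : ZMod k)) =
        ∑ i ∈ Finset.range N, if (k : ℤ) ∣ hPrime h k - (A + 1 + i) then (k : ℂ) else 0 := by
      simp only [hc, Finset.sum_mul]
      rw [Finset.sum_comm]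
      refine Finset.sum_congr rfl fun i _ => ?_
      have h2 := AddChar.sum_mulShift (R := ZMod k) ((hPrime h k : ZMod k) - ((A + 1 + i : ℤ) : ZMod k))
        (ZMod.isPrimitive_stdAddChar k)
      rw [ZMod.card] at h2
      have h3 : (hPrime h k : ZMod k) - ((A + 1 + i : ℤ) : ZMod k) = 0 ↔
          (k : ℤ) ∣ hPrime h k - (A + 1 + i) := by
        rw [← ZMod.intCast_zmod_eq_zero_iff_dvd]; push_cast; rfl
      simp only [h3] at h2
      rw [show ((if (k : ℤ) ∣ hPrime h k - (A + 1 + i) then (k : ℂ) else 0) : ℂ) =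
        (((if (k : ℤ) ∣ hPrime h k - (A + 1 + i) then k else 0 : ℕ)) : ℂ) by split_ifs <;> simp, ← h2]
      refine Finset.sum_congr rfl fun l _ => ?_
      rw [← AddChar.map_add_eq_mul]
      congr 1
      ring
    rw [h1, exists_mem_Ioc_iff hcop hd]
    split_ifs with hex
    · obtain ⟨d, hdm, hdk⟩ := hex
      rw [Finset.mem_Ioc] at hdm
      obtain ⟨i, hi⟩ := Int.eq_ofNat_of_zero_le (show 0 ≤ d - A - 1 by omega)
      have hdi : d = A + 1 + i := by omega
      rw [Finset.sum_eq_single i]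
      · rw [← hdi, if_pos hdk]
      · intro i' hi' hne
        refine if_neg fun hdk' => hne ?_
        have h5 := dvd_sub hdk' hdk
        have h6 : (k : ℤ) ∣ (i : ℤ) - i' := by
          rwa [hdi, sub_sub_sub_cancel_left, add_sub_add_left_eq_sub] at h5
        rw [Finset.mem_range] at hi'
        have h7 : |(i : ℤ) - i'| < k := by rw [abs_lt]; constructor <;> omega
        have := Int.eq_zero_of_abs_lt_dvd h6 h7
        omega
      · intro hi'
        exact absurd (Finset.mem_range.2 (by omega)) hi'
    · symm
      refine Finset.sum_eq_zero fun i hi => if_neg fun hdk => hex ⟨A + 1 + i, ?_, hdk⟩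
      rw [Finset.mem_range] at hi
      rw [Finset.mem_Ioc]
      omega
  have hsum : (k : ℂ) * ∑ h ∈ unitsIn k A B, θ h = ∑ m ∈ Finset.range k, c m *
      ∑ h ∈ units k, θ h * cexp (2 * π * I * hPrime h k * m / k) := by
    have h1 : (k : ℂ) * ∑ h ∈ unitsIn k A B, θ h = ∑ h ∈ units k,
        (if ∃ d : ℤ, A < d ∧ d ≤ B ∧ (k : ℤ) ∣ h * d + 1 then (k : ℂ) else 0) * θ h := by
      unfold unitsIn
      rw [Finset.sum_filter, Finset.mul_sum]
      exact Finset.sum_congr rfl fun h _ => by split_ifs <;> simp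
    rw [h1, Finset.sum_congr rfl fun h hh => by rw [hind h hh]]
    simp_rw [sum_zmod_eq_sum_range, Finset.sum_mul]
    rw [Finset.sum_comm]
    refine Finset.sum_congr rfl fun m _ => ?_
    rw [Finset.mul_sum]
    refine Finset.sum_congr rfl fun h _ => ?_
    have h2 := ZMod.stdAddChar_coe (N := k) ((m * hPrime h k : ℕ) : ℤ)
    push_cast at h2
    rw [h2, show (2 * π * I * (m * hPrime h k) / k : ℂ) = 2 * π * I * hPrime h k * m / k by ring]
    ring
  have hc0 : ‖c (0 : ℕ)‖ ≤ k * 1 := by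
    refine (norm_sum_le _ _).trans ?_
    simp_rw [AddChar.norm_apply]
    simpa using hNk
  have hcm : ∀ m ∈ Finset.Ico 1 k, ‖c m‖ ≤ k * ((1 / (m : ℝ) + 1 / ((k - m : ℕ) : ℝ)) / 2) := by
    intro m hm
    rw [Finset.mem_Ico] at hm
    exact norm_sum_stdAddChar_le hm.1 hm.2 (A + 1) N
  have hctot : ∑ m ∈ Finset.range k, ‖c m‖ ≤ k * (2 + Real.log k) := by
    rw [Finset.range_eq_Ico, Finset.sum_eq_sum_Ico_succ_bot hk]
    calc _ ≤ k * 1 + ∑ m ∈ Finset.Ico 1 k, k * ((1 / (m : ℝ) + 1 / ((k - m : ℕ) : ℝ)) / 2) :=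
          add_le_add hc0 (Finset.sum_le_sum hcm)
      _ ≤ k * 1 + k * (1 + Real.log k) := by
          rw [← Finset.mul_sum]
          gcongr
          exact sum_one_div_le k
      _ = _ := by ring
  refine le_of_mul_le_mul_left ?_ hk0
  calc (k : ℝ) * ‖∑ h ∈ unitsIn k A B, θ h‖ = ‖(k : ℂ) * ∑ h ∈ unitsIn k A B, θ h‖ := by
        rw [norm_mul, norm_natCast]
    _ ≤ ∑ m ∈ Finset.range k, ‖c m‖ * M := by
        rw [hsum]
        refine (norm_sum_le _ _).trans (Finset.sum_le_sum fun m _ => ?_)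
        rw [norm_mul]
        gcongr
        exact hM m
    _ ≤ k * (2 + Real.log k) * M := by rw [← Finset.sum_mul]; gcongr
    _ = _ := by ring

/-- Twisting only shifts j, so a bound for the complete sums uniform in j already bounds all twisted
sums required for completion. The shift is 2m for odd k because the frequency of h' is then counted
in units of 1/(2k). -/
theorem multiplier_mul_cexp (α β : ℤ) (n k h j m : ℕ) :
    multiplier α β n k h j * cexp (2 * π * I * hPrime h k * m / k) =
      multiplier α β n k h (if Even k then j + m else j + 2 * m) := by
  unfold multiplier
  rw [mul_assoc, ← Complex.exp_add]
  congr 2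
  split_ifs <;> push_cast <;> ring

theorem norm_sum_unitsIn_multiplier_le {α β : ℤ} {n k : ℕ} (hk : 0 < k) {M : ℝ}
    (hM : ∀ j, ‖∑ h ∈ units k, multiplier α β n k h j‖ ≤ M) (j : ℕ) {A B : ℤ} (hAB : A ≤ B)
    (hBA : B ≤ A + k) :
    ‖∑ h ∈ unitsIn k A B, multiplier α β n k h j‖ ≤ (2 + Real.log k) * M :=
  norm_sum_unitsIn_le hk (fun m => by simp_rw [multiplier_mul_cexp]; exact hM _) hAB hBA

/-- Every positive integer is, up to a bounded factor, the product of a powerful number and of a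
coprime squarefree number without small prime factors. -/
theorem exists_squarefree_factor (P : ℕ) : ∃ U : ℕ, ∀ k : ℕ, 0 < k → ∃ u c w s : ℕ,
    k = u * c ^ 2 * w ^ 3 * s ∧ u ≤ U ∧ Squarefree s ∧ (∀ p, p.Prime → p ∣ s → P ≤ p) ∧
      s.Coprime (u * c ^ 2 * w ^ 3) := by
  refine ⟨∏ p ∈ (Finset.range P).filter Nat.Prime, p, fun k hk => ?_⟩
  -- Here k = b²a with a squarefree. The primes of a below P go to u, the other ones dividing b to
  -- w, the rest to s; with b = wc this gives k = u c² w³ s.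
  obtain ⟨a, b, hab, ha⟩ := Nat.sq_mul_squarefree k
  have ha0 : a ≠ 0 := ha.ne_zero
  set S := a.primeFactors with hS
  set u := ∏ p ∈ S.filter (· < P), p with hu
  set w := ∏ p ∈ (S.filter (¬ · < P)).filter (· ∣ b), p with hw
  set s := ∏ p ∈ (S.filter (¬ · < P)).filter (¬ · ∣ b), p with hs
  have hprime : ∀ p ∈ S, p.Prime := fun p hp => Nat.prime_of_mem_primeFactors hp
  have hprod : u * (w * s) = a := by
    rw [hw, hs, Finset.prod_filter_mul_prod_filter_not, hu, Finset.prod_filter_mul_prod_filter_not]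
    exact Nat.prod_primeFactors_of_squarefree ha
  have hwb : w ∣ b := by
    refine Finset.prod_primes_dvd b (fun p hp => ?_) fun p hp => (Finset.mem_filter.1 hp).2
    exact (hprime p (Finset.mem_filter.1 (Finset.mem_filter.1 hp).1).1).prime
  obtain ⟨c, hc⟩ := hwb
  have hsp : ∀ p, p.Prime → p ∣ s → P ≤ p ∧ ¬ p ∣ b := by
    intro p hp hps
    rw [hs, hp.prime.dvd_finsetProd_iff] at hps
    obtain ⟨q, hq, hpq⟩ := hps
    simp only [Finset.mem_filter] at hq
    rw [(Nat.prime_dvd_prime_iff_eq hp (hprime q hq.1.1)).1 hpq]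
    exact ⟨not_lt.1 hq.1.2, hq.2⟩
  have hup : ∀ p, p.Prime → p ∣ u → p < P := by
    intro p hp hpu
    rw [hu, hp.prime.dvd_finsetProd_iff] at hpu
    obtain ⟨q, hq, hpq⟩ := hpu
    simp only [Finset.mem_filter] at hq
    rw [(Nat.prime_dvd_prime_iff_eq hp (hprime q hq.1)).1 hpq]
    exact hq.2
  refine ⟨u, c, w, s, ?_, ?_, ?_, fun p hp hps => (hsp p hp hps).1, ?_⟩
  · rw [← hab, hc, ← hprod]; ring
  · refine Finset.prod_le_prod_of_subset_of_one_le' ?_ fun p hp _ => ?_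
    · intro p hp
      rw [Finset.mem_filter] at hp ⊢
      exact ⟨Finset.mem_range.2 hp.2, hprime p hp.1⟩
    · exact (Finset.mem_filter.1 hp).2.one_le
  · exact ha.squarefree_of_dvd ⟨u * w, by rw [← hprod]; ring⟩
  · refine Nat.coprime_of_dvd fun p hp hps hpt => ?_
    obtain ⟨h1, h2⟩ := hsp p hp hps
    rcases (Nat.Prime.dvd_mul hp).1 hpt with h3 | h3
    · rcases (Nat.Prime.dvd_mul hp).1 h3 with h4 | h4
      · exact absurd (hup p hp h4) (not_lt.2 h1)
      · exact h2 (hc ▸ (hp.dvd_of_dvd_pow h4).mul_left w)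
    · exact h2 (hc ▸ (hp.dvd_of_dvd_pow h3).mul_right c)

theorem two_add_log_le {k : ℕ} (hk : 0 < k) : 2 + Real.log k ≤ 12 * (k : ℝ) ^ (1 / 10 : ℝ) := by
  have hk1 : (1 : ℝ) ≤ k := by exact_mod_cast hk
  have h1 := Real.log_le_rpow_div (x := (k : ℝ)) (by positivity) (ε := 1 / 10) (by norm_num)
  have h2 : 1 ≤ (k : ℝ) ^ (1 / 10 : ℝ) := Real.one_le_rpow hk1 (by norm_num)
  linarith

/-- Use the trivial bound on t = u c² w³ and the 4/5 power on s. With 2 + log k ≪ k^(1/10), the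
weighted bound is ≪ k^(-9/10) s^(-1/5) = u^(-9/10) c^(-9/5) w^(-27/10) s^(-11/10). The exponents of
c, w and s are below -1, and u is bounded. -/
theorem exists_summable_bound {α : ℤ} {n : ℕ} (hα : α - 24 * n ≠ 0) :
    ∃ W : ℕ → ℝ, (∀ k : ℕ, 0 < k → ∀ (j : ℕ) (A B : ℤ), A ≤ B → B ≤ A + k →
      ‖∑ h ∈ unitsIn k A B, multiplier α (-α) n k h j‖ ≤ W k) ∧
      Summable fun k => W k * (k : ℝ) ^ (-2 : ℝ) := by
  -- The threshold 243 serves the Kloosterman bound; exceeding |α - 24n| ensures that no prime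
  -- factor of s divides α - 24n, which is nonzero.
  obtain ⟨U, hU⟩ := exists_squarefree_factor (max 243 ((α - 24 * n).natAbs + 1))
  choose! u c w s hk hu hs hp hco using hU
  set W : ℕ → ℝ := fun k => (2 + Real.log k) * (((u k * c k ^ 2 * w k ^ 3 : ℕ) : ℝ) *
    (s k : ℝ) ^ (4 / 5 : ℝ)) with hW
  have hpos : ∀ k, 0 < k → 0 < u k ∧ 0 < c k ∧ 0 < w k ∧ 0 < s k := fun k hk0 => by
    have h1 := hk k hk0
    refine ⟨?_, ?_, ?_, ?_⟩ <;> refine Nat.pos_of_ne_zero fun h => ?_ <;> rw [h] at h1 <;> simp at h1 <;> omega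
  refine ⟨W, fun k hk0 j A B hAB hBA => ?_, ?_⟩
  · obtain ⟨h1, h2, h3, h4⟩ := hpos k hk0
    refine norm_sum_unitsIn_multiplier_le hk0 (fun j => ?_) j hAB hBA
    have hcop : IsCoprime (α - 24 * n) (s k : ℤ) := by
      rw [Int.isCoprime_iff_gcd_eq_one, Int.gcd, Int.natAbs_natCast]
      refine Nat.Coprime.symm (Nat.coprime_of_dvd fun p hpp hps hpa => ?_)
      have h5 := hp k hk0 p hpp hps
      have h6 := Nat.le_of_dvd (Int.natAbs_pos.2 hα) hpa
      have h7 := le_max_right 243 ((α - 24 * n).natAbs + 1)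
      omega
    have := norm_sum_multiplier_le (t := u k * c k ^ 2 * w k ^ 3) (s := s k) α n j (by positivity) h4
      (hs k hk0) (fun p hpp hps => (le_max_left _ _).trans (hp k hk0 p hpp hps)) (hco k hk0) hcop
    rwa [← hk k hk0] at this
  · set g : ℕ × ℕ × ℕ × ℕ → ℝ := fun x => (x.1 : ℝ) ^ (-2 : ℝ) * ((x.2.1 : ℝ) ^ (-(9 / 5) : ℝ) *
      ((x.2.2.1 : ℝ) ^ (-(27 / 10) : ℝ) * (x.2.2.2 : ℝ) ^ (-(11 / 10) : ℝ))) with hg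
    have hgs : Summable g := by
      have hsum : ∀ p : ℝ, p < -1 → Summable fun m : ℕ => (m : ℝ) ^ p := fun p hp =>
        Real.summable_nat_rpow.2 hp
      have hnn : ∀ p : ℝ, 0 ≤ fun m : ℕ => (m : ℝ) ^ p := fun p m => by positivity
      have h1 := (hsum (-(27 / 10)) (by norm_num)).mul_of_nonneg (hsum (-(11 / 10)) (by norm_num))
        (hnn _) (hnn _)
      have h2 := (hsum (-(9 / 5)) (by norm_num)).mul_of_nonneg h1 (hnn _) (fun x => by positivity)
      exact (hsum (-2) (by norm_num)).mul_of_nonneg h2 (hnn _) (fun x => by positivity)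
    -- The quadruple determines k, so the series over k is bounded by one over all quadruples, which
    -- factors.
    have hinj : Function.Injective fun k : ℕ => (u (k + 1), c (k + 1), w (k + 1), s (k + 1)) := by
      intro x y hxy
      simp only [Prod.mk.injEq] at hxy
      obtain ⟨h1, h2, h3, h4⟩ := hxy
      have h5 := hk (x + 1) x.succ_pos
      rw [h1, h2, h3, h4, ← hk (y + 1) y.succ_pos] at h5
      omega
    refine (summable_nat_add_iff 1).1 (Summable.of_nonneg_of_le (fun k => ?_) (fun k => ?_)
      ((hgs.comp_injective hinj).mul_left (12 * (U : ℝ) ^ 2)))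
    · have : 0 ≤ Real.log ((k + 1 : ℕ) : ℝ) := Real.log_natCast_nonneg _
      simp only [hW]
      positivity
    · have hk0 : 0 < k + 1 := by omega
      simp only [hW, hg, Function.comp]
      generalize k + 1 = m at hk0 ⊢
      obtain ⟨h1, h2, h3, h4⟩ := hpos m hk0
      have hu' := hu m hk0
      have hm := hk m hk0
      generalize u m = u at h1 h2 h3 h4 hu' hm ⊢
      generalize c m = c at h1 h2 h3 h4 hu' hm ⊢
      generalize w m = w at h1 h2 h3 h4 hu' hm ⊢
      generalize s m = s at h1 h2 h3 h4 hu' hm ⊢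
      have hm0 : (0 : ℝ) < m := by exact_mod_cast hk0
      have hu0 : (0 : ℝ) < u := by exact_mod_cast h1
      have hc0 : (0 : ℝ) < c := by exact_mod_cast h2
      have hw0 : (0 : ℝ) < w := by exact_mod_cast h3
      have hs0 : (0 : ℝ) < s := by exact_mod_cast h4
      have hmr : (m : ℝ) = (u * c ^ 2 * w ^ 3) * s := by exact_mod_cast hm
      have htr : ((u * c ^ 2 * w ^ 3 : ℕ) : ℝ) = m * (s : ℝ) ^ (-1 : ℝ) := by
        rw [Real.rpow_neg_one, hmr]; push_cast; field_simp
      have e1 : (m : ℝ) ^ (-(9 / 10) : ℝ) = (u : ℝ) ^ (-(9 / 10) : ℝ) * (c : ℝ) ^ (-(9 / 5) : ℝ) *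
          (w : ℝ) ^ (-(27 / 10) : ℝ) * (s : ℝ) ^ (-(9 / 10) : ℝ) := by
        rw [hmr, Real.mul_rpow (by positivity) hs0.le, Real.mul_rpow (by positivity) (by positivity),
          Real.mul_rpow hu0.le (by positivity), ← Real.rpow_natCast, ← Real.rpow_natCast,
          ← Real.rpow_mul hc0.le, ← Real.rpow_mul hw0.le]
        norm_num
      -- The exponent -9/10 alone is not summable in u; boundedness of u trades it for the exponent
      -- -2.
      have e2 : (u : ℝ) ^ (-(9 / 10) : ℝ) ≤ (U : ℝ) ^ 2 * (u : ℝ) ^ (-2 : ℝ) := by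
        have hu1 : (1 : ℝ) ≤ u := by exact_mod_cast h1
        have huU : (u : ℝ) ≤ U := by exact_mod_cast hu'
        calc (u : ℝ) ^ (-(9 / 10) : ℝ) ≤ 1 := Real.rpow_le_one_of_one_le_of_nonpos hu1 (by norm_num)
          _ = (u : ℝ) ^ 2 * (u : ℝ) ^ (-2 : ℝ) := by
              rw [← Real.rpow_natCast, ← Real.rpow_add hu0]; norm_num
          _ ≤ _ := by gcongr
      calc (2 + Real.log m) * (((u * c ^ 2 * w ^ 3 : ℕ) : ℝ) * (s : ℝ) ^ (4 / 5 : ℝ)) * (m : ℝ) ^ (-2 : ℝ)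
          ≤ (12 * (m : ℝ) ^ (1 / 10 : ℝ)) * (((u * c ^ 2 * w ^ 3 : ℕ) : ℝ) * (s : ℝ) ^ (4 / 5 : ℝ)) *
            (m : ℝ) ^ (-2 : ℝ) := by gcongr; exact two_add_log_le hk0
        _ = 12 * ((m : ℝ) ^ (1 / 10 : ℝ) * (m : ℝ) ^ (1 : ℝ) * (m : ℝ) ^ (-2 : ℝ)) *
            ((s : ℝ) ^ (-1 : ℝ) * (s : ℝ) ^ (4 / 5 : ℝ)) := by rw [htr, Real.rpow_one]; ring
        _ = 12 * (m : ℝ) ^ (-(9 / 10) : ℝ) * (s : ℝ) ^ (-(1 / 5) : ℝ) := by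
            rw [← Real.rpow_add hm0, ← Real.rpow_add hm0, ← Real.rpow_add hs0]; norm_num
        _ = 12 * ((u : ℝ) ^ (-(9 / 10) : ℝ) * ((c : ℝ) ^ (-(9 / 5) : ℝ) *
            ((w : ℝ) ^ (-(27 / 10) : ℝ) * ((s : ℝ) ^ (-(9 / 10) : ℝ) * (s : ℝ) ^ (-(1 / 5) : ℝ))))) := by
            rw [e1]; ring
        _ = 12 * ((u : ℝ) ^ (-(9 / 10) : ℝ) * ((c : ℝ) ^ (-(9 / 5) : ℝ) *
            ((w : ℝ) ^ (-(27 / 10) : ℝ) * (s : ℝ) ^ (-(11 / 10) : ℝ)))) := by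
            rw [← Real.rpow_add hs0]; norm_num
        _ ≤ 12 * (((U : ℝ) ^ 2 * (u : ℝ) ^ (-2 : ℝ)) * ((c : ℝ) ^ (-(9 / 5) : ℝ) *
            ((w : ℝ) ^ (-(27 / 10) : ℝ) * (s : ℝ) ^ (-(11 / 10) : ℝ)))) := by gcongr
        _ = _ := by ring

theorem exact_formula_of_eq_zero {α β : ℤ} (hαβ : α + β = 0) {n : ℕ}
    (hn : -((α : ℝ) + 2 * β) / 24 < (n : ℝ)) :
    (∀ j : ℕ, (j : ℝ) < -((α : ℝ) + 2 * β) / 24 →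
      Summable fun m : ℕ => evenTerm α β n j (2 * m + 2)) ∧
    (∀ j : ℕ, (j : ℝ) < -(2 * (α : ℝ) + β) / 24 →
      Summable fun m : ℕ => oddTerm α β n j (2 * m + 1)) ∧
    a α β n =
      2 * (π : ℂ) * ∑ j ∈ Finset.range ⌈-((α : ℝ) + 2 * β) / 24⌉₊,
        ∑' m : ℕ, evenTerm α β n j (2 * m + 2) +
      2 * (π : ℂ) * ∑ j ∈ Finset.range ⌈-(2 * (α : ℝ) + β) / 24⌉₊,
        ∑' m : ℕ, oddTerm α β n j (2 * m + 1) := by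
  obtain rfl : β = -α := by omega
  -- For β = -α the hypothesis on n reads α < 24n; this is where it secures a nonzero frequency of
  -- h.
  have hα : α - 24 * n ≠ 0 := by
    intro h
    have h1 : (α : ℝ) - 24 * n = 0 := by exact_mod_cast h
    push_cast at hn
    linarith
  obtain ⟨W, hW, hWs⟩ := exists_summable_bound hα
  refine exact_formula hαβ.le hn hW ?_
  convert hWs using 4
  push_cast
  ring

end

end EtaQuotient
/-- In the finite sums over `j`, membership in `Finset.range ⌈x⌉₊` means `j < x`. In the series
over `k`, `k = 2 * m + 2` runs over the even and `k = 2 * m + 1` over the odd positive integers;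
all these series converge absolutely. -/
theorem theorem6p1 (α β : ℤ) (hαβ : α + β ≤ 0) (n : ℕ)
    (hn : -((α : ℝ) + 2 * β) / 24 < (n : ℝ)) :
    (∀ j : ℕ, (j : ℝ) < -((α : ℝ) + 2 * β) / 24 →
      Summable fun m : ℕ => EtaQuotient.evenTerm α β n j (2 * m + 2)) ∧
    (∀ j : ℕ, (j : ℝ) < -(2 * (α : ℝ) + β) / 24 →
      Summable fun m : ℕ => EtaQuotient.oddTerm α β n j (2 * m + 1)) ∧
    EtaQuotient.a α β n =
      2 * (π : ℂ) * ∑ j ∈ Finset.range ⌈-((α : ℝ) + 2 * β) / 24⌉₊,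
        ∑' m : ℕ, EtaQuotient.evenTerm α β n j (2 * m + 2) +
      2 * (π : ℂ) * ∑ j ∈ Finset.range ⌈-(2 * (α : ℝ) + β) / 24⌉₊,
        ∑' m : ℕ, EtaQuotient.oddTerm α β n j (2 * m + 1) := by
  rcases hαβ.lt_or_eq with h | h
  · exact EtaQuotient.exact_formula_of_neg h hn
  · exact EtaQuotient.exact_formula_of_eq_zero h hn
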